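/- Let $\mathbb{D}$ be the open unit disk, $\mathbb{T}$ the unit circle, and let $H^2(\mathbb{D}^2)$ be the Hardy space of all holomorphic functions $f$ on $\mathbb{D}^2$ with $\|f\|^2=\sup_{0\le r<1}\int_{\mathbb{T}^2}|f(rz,rw)|^2\,dm<\infty$, where $m$ is normalized Lebesgue measure on $\mathbb{T}^2$. A function $\theta\in H^2(\mathbb{D}^2)$ is called inner if its radial boundary values have modulus $1$ almost everywhere on $\mathbb{T}^2$, and rational inner if it is moreover a rational function of $(z,w)$. For an inner function $\theta$ put $\mathcal{K}_\theta=H^2(\mathbb{D}^2)\ominus\theta H^2(\mathbb{D}^2)$, let $P$ be the orthogonal projection of $H^2(\mathbb{D}^2)$ onto $\mathcal{K}_\theta$, and let $S_z f=P(zf)$ for $f\in\mathcal{K}_\theta$. Write $\sigma(S_z)$ for the spectrum of $S_z$ and $\sigma_e(S_z)$ for its essential spectrum, the set of $\lambda\in\mathbb{C}$ for which $S_z-\lambda$ is not Fredholm. For $E\subseteq\mathbb{C}$ let $E^*=\{\bar\lambda:\lambda\in E\}$. Let $\Omega\subseteq\mathbb{C}$ be a nonempty bounded open set with distinct connected components $\Omega_i$,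 and let $\alpha=(\alpha_i)$ be a family of positive integers with the same index set. A bounded linear operator $T$ on a separable complex Hilbert space $\mathcal{H}$ belongs to the generalized Cowen–Douglas class $\mathfrak{B}_\alpha(\Omega)$ if (1) $\operatorname{Ran}(T-\lambda)=\mathcal{H}$ for all $\lambda\in\Omega$; (2) the closed linear span of $\bigcup_{\lambda\in\Omega}\ker(T-\lambda)$ is $\mathcal{H}$; (3) $\dim\ker(T-\lambda)=\alpha_i$ for all $i$ and all $\lambda\in\Omega_i$. **Theorem.** Let $\theta$ be a nonconstant rational inner function on $\mathbb{D}^2$ that has no nonconstant inner factor depending only on $z$; that is, $\theta$ is not a product $\varphi\psi$ of inner functions with $\varphi$ nonconstant and depending only on $z$. Let $\Omega=\sigma(S_z)\setminus\sigma_e(S_z)$ and let $\Omega_i$ be the distinct connected components of $\Omega$. Then, for every $i$, the number $\alpha_i$ of zeros of $\theta(\lambda,\cdot)$ in $\mathbb{D}$, counted with multiplicity, is finite, positive and the same for all $\lambda\in\Omega_i$, and, with $\alpha=(\alpha_i)$, the operator $S_z^*$ on $\mathcal{K}_\theta$ belongs to $\mathfrak{B}_\alpha(\Omega^*)$, where $\alpha_i$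 is attached to the component $\Omega_i^*$ of $\Omega^*$. -/

import Mathlib

noncomputable section

open MeasureTheory Set Filter Topology
open scoped ComplexConjugate

namespace HardyBidisk

/-- The open unit bidisk `𝔻²`. -/
def bidisk : Set (ℂ × ℂ) := Metric.ball 0 1 ×ˢ Metric.ball 0 1

/-- The point `(r₁ e^{2πi s}, r₂ e^{2πi t})`. -/
def torusPoint (r₁ r₂ : ℝ) (t : UnitAddCircle × UnitAddCircle) : ℂ × ℂ :=
  ((r₁ : ℂ) * (AddCircle.toCircle t.1 : ℂ), (r₂ : ℂ) * (AddCircle.toCircle t.2 : ℂ))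

/-- Normalized Lebesgue measure on the torus `𝕋²`, parametrized by `(s, t) ↦ (e^{2πi s}, e^{2πi t})`. -/
def torusMeasure : Measure (UnitAddCircle × UnitAddCircle) :=
  (AddCircle.haarAddCircle : Measure UnitAddCircle).prod AddCircle.haarAddCircle

instance : IsProbabilityMeasure torusMeasure := by
  unfold torusMeasure; infer_instance

/-- `∫_{𝕋²} |f(rz, rw)|² dm`. -/
def torusMean (f : ℂ × ℂ → ℂ) (r : ℝ) : ℝ :=
  ∫ t, ‖f (torusPoint r r t)‖ ^ 2 ∂torusMeasure

theorem isOpen_bidisk : IsOpen bidisk := Metric.isOpen_ball.prod Metric.isOpen_ball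

theorem mem_bidisk {x : ℂ × ℂ} : x ∈ bidisk ↔ ‖x.1‖ < 1 ∧ ‖x.2‖ < 1 := by
  simp [bidisk]

theorem torusPoint_mem {r₁ r₂ : ℝ} (h₁ : r₁ ∈ Ico (0 : ℝ) 1) (h₂ : r₂ ∈ Ico (0 : ℝ) 1)
    (t : UnitAddCircle × UnitAddCircle) : torusPoint r₁ r₂ t ∈ bidisk := by
  rw [mem_bidisk]
  simpa [torusPoint, abs_of_nonneg h₁.1, abs_of_nonneg h₂.1, Circle.norm_coe] using ⟨h₁.2, h₂.2⟩

theorem continuous_torusPoint (r₁ r₂ : ℝ) : Continuous (torusPoint r₁ r₂) := by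
  unfold torusPoint; fun_prop

theorem continuous_comp_torusPoint {f : ℂ × ℂ → ℂ} (hf : DifferentiableOn ℂ f bidisk) {r₁ r₂ : ℝ}
    (h₁ : r₁ ∈ Ico (0 : ℝ) 1) (h₂ : r₂ ∈ Ico (0 : ℝ) 1) :
    Continuous fun t => f (torusPoint r₁ r₂ t) :=
  hf.continuousOn.comp_continuous (continuous_torusPoint r₁ r₂) (torusPoint_mem h₁ h₂)

theorem integrable_of_continuous {E : Type*} [NormedAddCommGroup E]
    {g : UnitAddCircle × UnitAddCircle → E} (hg : Continuous g) :
    Integrable g torusMeasure :=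
  hg.integrable_of_hasCompactSupport (HasCompactSupport.of_compactSpace g)

theorem integral_fourier_mul (m n : ℤ) :
    ∫ t : UnitAddCircle, fourier (-m) t * fourier n t ∂AddCircle.haarAddCircle
      = if m = n then 1 else 0 := by
  have := (orthonormal_iff_ite.mp (orthonormal_fourier (T := 1))) m n
  rw [ContinuousMap.inner_toLp] at this
  rw [← this]
  refine integral_congr_ae (ae_of_all _ fun t => ?_)
  simp only [fourier_neg, mul_comm]

theorem toCircle_pow (k : ℕ) (t : UnitAddCircle) :
    (AddCircle.toCircle t : ℂ) ^ k = fourier (k : ℤ) t := by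
  rw [fourier_apply, natCast_zsmul, AddCircle.toCircle_nsmul, Circle.coe_pow]

/-- Fourier coefficients on the circle of radius `r` of a holomorphic function on the disk. -/
theorem hasSum_circle {g : ℂ → ℂ} (hg : DifferentiableOn ℂ g (Metric.ball 0 1)) {r : ℝ}
    (hr : r ∈ Ico (0 : ℝ) 1) (n : ℤ) :
    ∫ t : UnitAddCircle, fourier (-n) t * g (r * (AddCircle.toCircle t : ℂ))
        ∂AddCircle.haarAddCircle
      = if 0 ≤ n then ((n.toNat.factorial : ℂ)⁻¹ * iteratedDeriv n.toNat g 0) * (r : ℂ) ^ n.toNat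
        else 0 := by
  set b : ℕ → ℂ := fun k => (k.factorial : ℂ)⁻¹ * iteratedDeriv k g 0 with hb
  have hs : ∀ z : ℂ, ‖z‖ < 1 → HasSum (fun k => b k * z ^ k) (g z) := by
    intro z hz
    have := Complex.hasSum_taylorSeries_on_ball hg (z := z) (by simpa using hz)
    refine this.congr_fun fun k => ?_
    simp [hb]; ring
  have hsum : Summable fun k => ‖b k * (r : ℂ) ^ k‖ :=
    (hs r (by simpa [abs_of_nonneg hr.1] using hr.2)).summable.norm
  let F : ℕ → UnitAddCircle → ℂ := fun k t => (b k * (r : ℂ) ^ k) * (fourier (-n) t * fourier k t)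
  have hF : ∀ t : UnitAddCircle, ∑' k, F k t =
      fourier (-n) t * g (r * (AddCircle.toCircle t : ℂ)) := by
    intro t
    have := (hs (r * (AddCircle.toCircle t : ℂ))
      (by simpa [abs_of_nonneg hr.1, Circle.norm_coe] using hr.2)).mul_left (fourier (-n) t)
    rw [← this.tsum_eq]
    refine tsum_congr fun k => ?_
    simp only [F]
    rw [mul_pow, toCircle_pow]; ring
  have hcont : ∀ k, Continuous (F k) := fun k => by simp only [F]; fun_prop
  have hnorm : ∀ k t, ‖F k t‖ = ‖b k * (r : ℂ) ^ k‖ := by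
    intro k t
    simp [F, fourier_apply, Circle.norm_coe]
  have key := hasSum_integral_of_summable_integral_norm (μ := AddCircle.haarAddCircle) (F := F)
    (fun k => (hcont k).integrable_of_hasCompactSupport (HasCompactSupport.of_compactSpace _))
    (by simpa [hnorm] using hsum)
  simp_rw [hF] at key
  have hval : ∀ k : ℕ, ∫ t, F k t ∂AddCircle.haarAddCircle
      = if n = k then b k * (r : ℂ) ^ k else 0 := by
    intro k
    simp only [F]
    rw [integral_const_mul, integral_fourier_mul]
    split_ifs <;> simp
  simp_rw [hval] at key
  rw [← key.tsum_eq]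
  split_ifs with h
  · rw [tsum_eq_single n.toNat]
    · rw [if_pos (by omega)]
    · intro k hk
      rw [if_neg (by omega)]
  · convert tsum_zero with k
    rw [if_neg (by omega)]

/-- The Fourier coefficient of index `(m, n)` of `f` on the torus of radii `(r₁, r₂)`. -/
def torusCoeff (f : ℂ × ℂ → ℂ) (r₁ r₂ : ℝ) (m n : ℤ) : ℂ :=
  ∫ t, fourier (-m) t.1 * fourier (-n) t.2 * f (torusPoint r₁ r₂ t) ∂torusMeasure

theorem torusCoeff_eq₂ {f : ℂ × ℂ → ℂ} (hf : DifferentiableOn ℂ f bidisk) {r₁ : ℝ}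
    (h₁ : r₁ ∈ Ico (0 : ℝ) 1) (m n : ℤ) : ∃ G : ℂ, ∀ r₂ ∈ Ico (0 : ℝ) 1,
    torusCoeff f r₁ r₂ m n = if 0 ≤ n then G * (r₂ : ℂ) ^ n.toNat else 0 := by
  refine ⟨∫ s : UnitAddCircle, fourier (-m) s * ((n.toNat.factorial : ℂ)⁻¹ *
    iteratedDeriv n.toNat (fun w => f (r₁ * (AddCircle.toCircle s : ℂ), w)) 0)
      ∂AddCircle.haarAddCircle, fun r₂ h₂ => ?_⟩
  have hc := continuous_comp_torusPoint hf h₁ h₂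
  have hi : Integrable (fun t : UnitAddCircle × UnitAddCircle =>
      fourier (-m) t.1 * fourier (-n) t.2 * f (torusPoint r₁ r₂ t)) torusMeasure :=
    integrable_of_continuous ((((fourier (-m)).continuous.comp continuous_fst).mul
      ((fourier (-n)).continuous.comp continuous_snd)).mul hc)
  have hd : ∀ s : UnitAddCircle, DifferentiableOn ℂ
      (fun w => f (r₁ * (AddCircle.toCircle s : ℂ), w)) (Metric.ball 0 1) := by
    intro s
    refine hf.comp (by fun_prop) fun w hw => ?_
    rw [mem_bidisk]
    exact ⟨by simpa [abs_of_nonneg h₁.1, Circle.norm_coe] using h₁.2, by simpa using hw⟩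
  unfold torusCoeff torusMeasure at *
  rw [integral_prod _ hi]
  simp only [torusPoint, mul_assoc, integral_const_mul, hasSum_circle (hd _) h₂]
  split_ifs
  · simp_rw [← mul_assoc]
    rw [integral_mul_const]
  · simp

theorem torusCoeff_eq₁ {f : ℂ × ℂ → ℂ} (hf : DifferentiableOn ℂ f bidisk) {r₂ : ℝ}
    (h₂ : r₂ ∈ Ico (0 : ℝ) 1) (m n : ℤ) : ∃ G : ℂ, ∀ r₁ ∈ Ico (0 : ℝ) 1,
    torusCoeff f r₁ r₂ m n = if 0 ≤ m then G * (r₁ : ℂ) ^ m.toNat else 0 := by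
  have hf' : DifferentiableOn ℂ (fun x : ℂ × ℂ => f x.swap) bidisk := by
    refine hf.comp (t := bidisk) (f := Prod.swap) (by unfold Prod.swap; fun_prop) fun x hx => ?_
    rw [mem_bidisk] at hx ⊢
    exact hx.symm
  obtain ⟨G, hG⟩ := torusCoeff_eq₂ hf' h₂ n m
  refine ⟨G, fun r₁ h₁ => ?_⟩
  rw [← hG r₁ h₁]
  unfold torusCoeff torusMeasure
  rw [← integral_prod_swap]
  refine integral_congr_ae (ae_of_all _ fun t => ?_)
  simp only [torusPoint, Prod.swap]
  ring_nf

/-- The Taylor coefficient of `z ^ m w ^ n`, computed on the torus of radius `1 / 2`. -/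
def taylorCoeff (f : ℂ × ℂ → ℂ) (k : ℕ × ℕ) : ℂ :=
  2 ^ (k.1 + k.2) * torusCoeff f (1 / 2) (1 / 2) k.1 k.2

theorem torusCoeff_eq {f : ℂ × ℂ → ℂ} (hf : DifferentiableOn ℂ f bidisk) {r₁ r₂ : ℝ}
    (h₁ : r₁ ∈ Ico (0 : ℝ) 1) (h₂ : r₂ ∈ Ico (0 : ℝ) 1) (k : ℕ × ℕ) :
    torusCoeff f r₁ r₂ k.1 k.2 = taylorCoeff f k * (r₁ : ℂ) ^ k.1 * (r₂ : ℂ) ^ k.2 := by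
  have hh : (1 / 2 : ℝ) ∈ Ico (0 : ℝ) 1 := by constructor <;> norm_num
  obtain ⟨G, hG⟩ := torusCoeff_eq₂ hf h₁ k.1 k.2
  obtain ⟨G', hG'⟩ := torusCoeff_eq₁ hf hh k.1 k.2
  have e1 := hG r₂ h₂
  have e2 := hG _ hh
  have e3 := hG' r₁ h₁
  have e4 := hG' _ hh
  simp only [Int.natCast_nonneg, if_true, Int.toNat_natCast] at e1 e2 e3 e4
  have hp : ∀ j : ℕ, (((1 / 2 : ℝ) : ℂ)) ^ j * 2 ^ j = 1 := fun j => by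
    rw [← mul_pow]; norm_num
  unfold taylorCoeff
  rw [e1, e4, pow_add]
  have : G = G' * (r₁ : ℂ) ^ k.1 * 2 ^ k.2 := by
    rw [← e3, e2, mul_assoc, hp, mul_one]
  rw [this]
  linear_combination -(G' * (r₁ : ℂ) ^ k.1 * 2 ^ k.2 * (r₂ : ℂ) ^ k.2) * hp k.1

theorem torusCoeff_eq_zero {f : ℂ × ℂ → ℂ} (hf : DifferentiableOn ℂ f bidisk) {r₁ r₂ : ℝ}
    (h₁ : r₁ ∈ Ico (0 : ℝ) 1) (h₂ : r₂ ∈ Ico (0 : ℝ) 1) {m n : ℤ} (h : m < 0 ∨ n < 0) :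
    torusCoeff f r₁ r₂ m n = 0 := by
  rcases h with h | h
  · obtain ⟨G, hG⟩ := torusCoeff_eq₁ hf h₂ m n
    rw [hG r₁ h₁, if_neg (by omega)]
  · obtain ⟨G, hG⟩ := torusCoeff_eq₂ hf h₁ m n
    rw [hG r₂ h₂, if_neg (by omega)]

/-- The measure on `UnitAddTorus (Fin 2)` used in Parseval's identity. -/
theorem integral_torus {E : Type*} [NormedAddCommGroup E] [NormedSpace ℝ E]
    (g : UnitAddCircle × UnitAddCircle → E) :
    ∫ x : Fin 2 → UnitAddCircle, g (x 0, x 1) ∂(Measure.pi fun _ => AddCircle.haarAddCircle)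
      = ∫ t, g t ∂torusMeasure :=
  (measurePreserving_finTwoArrow (AddCircle.haarAddCircle : Measure UnitAddCircle)).integral_comp'
    (g := g)

/-- `f` on the torus of radii `(r₁, r₂)`, as a continuous function. -/
def torusFun {f : ℂ × ℂ → ℂ} (hf : DifferentiableOn ℂ f bidisk) {r₁ r₂ : ℝ}
    (h₁ : r₁ ∈ Ico (0 : ℝ) 1) (h₂ : r₂ ∈ Ico (0 : ℝ) 1) : C(UnitAddTorus (Fin 2), ℂ) :=
  ⟨fun x => f (torusPoint r₁ r₂ (x 0, x 1)),
    (continuous_comp_torusPoint hf h₁ h₂).comp (by fun_prop)⟩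

theorem mFourierCoeff_torusFun {f : ℂ × ℂ → ℂ} (hf : DifferentiableOn ℂ f bidisk) {r₁ r₂ : ℝ}
    (h₁ : r₁ ∈ Ico (0 : ℝ) 1) (h₂ : r₂ ∈ Ico (0 : ℝ) 1) (n : Fin 2 → ℤ) :
    UnitAddTorus.mFourierCoeff (torusFun hf h₁ h₂) n = torusCoeff f r₁ r₂ (n 0) (n 1) := by
  unfold torusCoeff
  rw [← integral_torus]
  unfold UnitAddTorus.mFourierCoeff
  refine integral_congr_ae (ae_of_all _ fun x => ?_)
  simp [UnitAddTorus.mFourier, torusFun, Fin.prod_univ_two]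

/-- The embedding of `ℕ × ℕ` in the index set of double Fourier series. -/
def idx (k : ℕ × ℕ) : Fin 2 → ℤ := ![k.1, k.2]

theorem idx_injective : Function.Injective idx := by
  intro k l h
  have h0 := congrFun h 0
  have h1 := congrFun h 1
  simp [idx] at h0 h1
  exact Prod.ext h0 h1

theorem torusCoeff_eq_zero_of_notMem {f : ℂ × ℂ → ℂ} (hf : DifferentiableOn ℂ f bidisk)
    {r₁ r₂ : ℝ} (h₁ : r₁ ∈ Ico (0 : ℝ) 1) (h₂ : r₂ ∈ Ico (0 : ℝ) 1) (n : Fin 2 → ℤ)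
    (hn : n ∉ range idx) : torusCoeff f r₁ r₂ (n 0) (n 1) = 0 := by
  apply torusCoeff_eq_zero hf h₁ h₂
  by_contra! h
  refine hn ⟨((n 0).toNat, (n 1).toNat), ?_⟩
  ext i
  fin_cases i <;> simp [idx, h.1, h.2]

/-- Parseval's identity on the torus of radii `(r₁, r₂)`. -/
theorem hasSum_sq_torus {f : ℂ × ℂ → ℂ} (hf : DifferentiableOn ℂ f bidisk) {r₁ r₂ : ℝ}
    (h₁ : r₁ ∈ Ico (0 : ℝ) 1) (h₂ : r₂ ∈ Ico (0 : ℝ) 1) :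
    HasSum (fun k : ℕ × ℕ => ‖taylorCoeff f k * (r₁ : ℂ) ^ k.1 * (r₂ : ℂ) ^ k.2‖ ^ 2)
      (∫ t, ‖f (torusPoint r₁ r₂ t)‖ ^ 2 ∂torusMeasure) := by
  have key := UnitAddTorus.hasSum_sq_mFourierCoeff (d := Fin 2)
    (ContinuousMap.toLp (E := ℂ) 2 (Measure.pi fun _ => AddCircle.haarAddCircle) ℂ
      (torusFun hf h₁ h₂))
  have e : ∀ n, UnitAddTorus.mFourierCoeff (ContinuousMap.toLp (E := ℂ) 2
      (Measure.pi fun _ => AddCircle.haarAddCircle) ℂ (torusFun hf h₁ h₂)) n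
      = torusCoeff f r₁ r₂ (n 0) (n 1) := fun n =>
    (UnitAddTorus.mFourierCoeff_toLp (torusFun hf h₁ h₂) n).trans
      (mFourierCoeff_torusFun hf h₁ h₂ n)
  simp_rw [e] at key
  rw [← idx_injective.hasSum_iff (fun n hn => by
    rw [torusCoeff_eq_zero_of_notMem hf h₁ h₂ n hn]; simp)] at key
  convert key using 1
  · ext k
    rw [← torusCoeff_eq hf h₁ h₂ k]
    simp [idx]
  · rw [← integral_torus]
    refine integral_congr_ae ?_
    filter_upwards [ContinuousMap.coeFn_toLp (E := ℂ) (p := 2) (𝕜 := ℂ)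
      (Measure.pi fun _ => AddCircle.haarAddCircle) (torusFun hf h₁ h₂)] with x hx
    rw [hx]
    rfl

/-- A holomorphic function on the bidisk vanishes if its Taylor coefficients do. -/
theorem eq_zero_of_taylorCoeff {f : ℂ × ℂ → ℂ} (hf : DifferentiableOn ℂ f bidisk)
    (h : ∀ k, taylorCoeff f k = 0) {x : ℂ × ℂ} (hx : x ∈ bidisk) : f x = 0 := by
  rw [mem_bidisk] at hx
  have h₁ : ‖x.1‖ ∈ Ico (0 : ℝ) 1 := ⟨norm_nonneg _, hx.1⟩
  have h₂ : ‖x.2‖ ∈ Ico (0 : ℝ) 1 := ⟨norm_nonneg _, hx.2⟩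
  have hz : ∀ n, UnitAddTorus.mFourierCoeff (torusFun hf h₁ h₂) n = 0 := by
    intro n
    rw [mFourierCoeff_torusFun]
    by_cases hn : n ∈ range idx
    · obtain ⟨k, rfl⟩ := hn
      have := torusCoeff_eq hf h₁ h₂ k
      rw [h k, zero_mul, zero_mul] at this
      simpa [idx] using this
    · exact torusCoeff_eq_zero_of_notMem hf h₁ h₂ n hn
  have hs : Summable (UnitAddTorus.mFourierCoeff (torusFun hf h₁ h₂)) := by
    rw [funext hz]; exact summable_zero
  have harg : ∀ z : ℂ, ∃ t : UnitAddCircle, (‖z‖ : ℂ) * (AddCircle.toCircle t : ℂ) = z := by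
    intro z
    obtain ⟨t, ht⟩ := (AddCircle.homeomorphCircle (T := 1) one_ne_zero).surjective
      (Circle.exp z.arg)
    refine ⟨t, ?_⟩
    rw [AddCircle.homeomorphCircle_apply] at ht
    rw [ht, Circle.coe_exp]
    exact Complex.norm_mul_exp_arg_mul_I z
  obtain ⟨s, hs1⟩ := harg x.1
  obtain ⟨t, ht1⟩ := harg x.2
  have := UnitAddTorus.hasSum_mFourier_series_apply_of_summable hs ![s, t]
  simp_rw [hz, zero_smul] at this
  have h0 := this.unique hasSum_zero
  simpa [torusFun, torusPoint, hs1, ht1] using h0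

theorem sum_sq_taylorCoeff_le {f : ℂ × ℂ → ℂ} (hf : DifferentiableOn ℂ f bidisk) {C : ℝ}
    (hC : ∀ r ∈ Ico (0 : ℝ) 1, torusMean f r ≤ C) (s : Finset (ℕ × ℕ)) :
    ∑ k ∈ s, ‖taylorCoeff f k‖ ^ 2 ≤ C := by
  have hlim : Tendsto (fun r : ℝ => ∑ k ∈ s, ‖taylorCoeff f k * (r : ℂ) ^ k.1 * (r : ℂ) ^ k.2‖ ^ 2)
      (𝓝[<] 1) (𝓝 (∑ k ∈ s, ‖taylorCoeff f k‖ ^ 2)) := by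
    have hc : Continuous (fun r : ℝ =>
        ∑ k ∈ s, ‖taylorCoeff f k * (r : ℂ) ^ k.1 * (r : ℂ) ^ k.2‖ ^ 2) := by fun_prop
    have := (hc.tendsto 1).mono_left (nhdsWithin_le_nhds (s := Iio 1))
    simpa using this
  refine le_of_tendsto hlim ?_
  filter_upwards [Ico_mem_nhdsLT (zero_lt_one (α := ℝ))] with r hr
  exact (sum_le_hasSum s (fun _ _ => by positivity) (hasSum_sq_torus hf hr hr)).trans (hC r hr)

theorem summable_sq_taylorCoeff {f : ℂ × ℂ → ℂ} (hf : DifferentiableOn ℂ f bidisk) {C : ℝ}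
    (hC : ∀ r ∈ Ico (0 : ℝ) 1, torusMean f r ≤ C) : Summable fun k => ‖taylorCoeff f k‖ ^ 2 :=
  summable_of_sum_le (fun _ => by positivity) (sum_sq_taylorCoeff_le hf hC)

theorem torusMean_le {f : ℂ × ℂ → ℂ} (hf : DifferentiableOn ℂ f bidisk)
    (hs : Summable fun k => ‖taylorCoeff f k‖ ^ 2) {r : ℝ} (hr : r ∈ Ico (0 : ℝ) 1) :
    torusMean f r ≤ ∑' k, ‖taylorCoeff f k‖ ^ 2 := by
  refine hasSum_le (fun k => ?_) (hasSum_sq_torus hf hr hr) hs.hasSum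
  have h1 : ‖(r : ℂ)‖ ≤ 1 := by simpa [abs_of_nonneg hr.1] using hr.2.le
  rw [norm_mul, norm_mul, norm_pow, norm_pow]
  gcongr
  calc ‖taylorCoeff f k‖ * ‖(r : ℂ)‖ ^ k.1 * ‖(r : ℂ)‖ ^ k.2
      ≤ ‖taylorCoeff f k‖ * 1 * 1 := by
        gcongr
        · exact pow_le_one₀ (norm_nonneg _) h1
        · exact pow_le_one₀ (norm_nonneg _) h1
    _ = ‖taylorCoeff f k‖ := by ring

/-- The sum of a double power series on the bidisk, extended by zero. -/
def powerSum (a : ℕ × ℕ → ℂ) : ℂ × ℂ → ℂ :=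
  bidisk.indicator fun x => ∑' k : ℕ × ℕ, a k * (x.1 ^ k.1 * x.2 ^ k.2)

theorem summable_geom {ρ : ℝ} (h0 : 0 ≤ ρ) (h1 : ρ < 1) :
    Summable fun k : ℕ × ℕ => ρ ^ k.1 * ρ ^ k.2 :=
  (summable_geometric_of_lt_one h0 h1).mul_of_nonneg (summable_geometric_of_lt_one h0 h1)
    (fun _ => by positivity) (fun _ => by positivity)

theorem summable_geom' {ρ : ℝ} (h0 : 0 ≤ ρ) (h1 : ρ < 1) :
    Summable fun n : ℕ => (n : ℝ) * ρ ^ (n - 1) := by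
  rw [← summable_nat_add_iff 1]
  have h2 := summable_pow_mul_geometric_of_norm_lt_one 1
    (by rwa [Real.norm_of_nonneg h0] : ‖ρ‖ < 1)
  refine (h2.add (summable_geometric_of_lt_one h0 h1)).congr fun n => ?_
  push_cast
  simp
  ring

theorem differentiableOn_powerSum {a : ℕ × ℕ → ℂ} {C : ℝ} (hC : ∀ k, ‖a k‖ ≤ C) :
    DifferentiableOn ℂ (powerSum a) bidisk := by
  have hC0 : 0 ≤ C := (norm_nonneg _).trans (hC 0)
  intro x hx
  have hx' := mem_bidisk.1 hx
  have hxn : ‖x‖ < 1 := max_lt hx'.1 hx'.2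
  obtain ⟨ρ, hρ, hρ1⟩ := exists_between hxn
  have h0 : 0 ≤ ρ := (norm_nonneg _).trans hρ.le
  let f' : ℕ × ℕ → ℂ × ℂ → (ℂ × ℂ →L[ℂ] ℂ) := fun k y =>
    a k • ((y.1 ^ k.1) • (((k.2 : ℂ) * y.2 ^ (k.2 - 1)) • ContinuousLinearMap.snd ℂ ℂ ℂ)
      + (y.2 ^ k.2) • (((k.1 : ℂ) * y.1 ^ (k.1 - 1)) • ContinuousLinearMap.fst ℂ ℂ ℂ))
  have hd : ∀ k y, HasFDerivAt (fun y : ℂ × ℂ => a k * (y.1 ^ k.1 * y.2 ^ k.2)) (f' k y) y := by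
    intro k y
    have e1 : HasFDerivAt (fun y : ℂ × ℂ => y.1 ^ k.1)
        (((k.1 : ℂ) * y.1 ^ (k.1 - 1)) • ContinuousLinearMap.fst ℂ ℂ ℂ) y :=
      (hasDerivAt_pow k.1 y.1).comp_hasFDerivAt y hasFDerivAt_fst
    have e2 : HasFDerivAt (fun y : ℂ × ℂ => y.2 ^ k.2)
        (((k.2 : ℂ) * y.2 ^ (k.2 - 1)) • ContinuousLinearMap.snd ℂ ℂ ℂ) y :=
      (hasDerivAt_pow k.2 y.2).comp_hasFDerivAt y hasFDerivAt_snd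
    exact (e1.mul e2).const_mul (a k)
  let u : ℕ × ℕ → ℝ := fun k =>
    C * (ρ ^ k.1 * ((k.2 : ℝ) * ρ ^ (k.2 - 1)) + ((k.1 : ℝ) * ρ ^ (k.1 - 1)) * ρ ^ k.2)
  have hg := summable_geometric_of_lt_one h0 hρ1
  have hg' := summable_geom' h0 hρ1
  have hu : Summable u :=
    ((hg.mul_of_nonneg hg' (fun _ => by positivity) (fun _ => by positivity)).add
      (hg'.mul_of_nonneg hg (fun _ => by positivity) (fun _ => by positivity))).mul_left C
  have hb : ∀ k, ∀ y ∈ Metric.ball (0 : ℂ × ℂ) ρ, ‖f' k y‖ ≤ u k := by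
    intro k y hy
    rw [mem_ball_zero_iff] at hy
    have y1 : ‖y.1‖ ≤ ρ := (norm_fst_le y).trans hy.le
    have y2 : ‖y.2‖ ≤ ρ := (norm_snd_le y).trans hy.le
    simp only [f', u, norm_smul]
    refine mul_le_mul (hC k) ((norm_add_le _ _).trans (add_le_add ?_ ?_)) (norm_nonneg _) hC0
    · rw [norm_smul, norm_smul, norm_mul, norm_pow, norm_pow, Complex.norm_natCast]
      have := ContinuousLinearMap.norm_snd_le ℂ ℂ ℂ
      calc ‖y.1‖ ^ k.1 * ((k.2 : ℝ) * ‖y.2‖ ^ (k.2 - 1) * ‖ContinuousLinearMap.snd ℂ ℂ ℂ‖)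
          ≤ ρ ^ k.1 * ((k.2 : ℝ) * ρ ^ (k.2 - 1) * 1) := by gcongr
        _ = _ := by ring
    · rw [norm_smul, norm_smul, norm_mul, norm_pow, norm_pow, Complex.norm_natCast]
      have := ContinuousLinearMap.norm_fst_le ℂ ℂ ℂ
      calc ‖y.2‖ ^ k.2 * ((k.1 : ℝ) * ‖y.1‖ ^ (k.1 - 1) * ‖ContinuousLinearMap.fst ℂ ℂ ℂ‖)
          ≤ ρ ^ k.2 * ((k.1 : ℝ) * ρ ^ (k.1 - 1) * 1) := by gcongr
        _ = _ := by ring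
  have h00 : Summable fun k : ℕ × ℕ => a k * ((0 : ℂ × ℂ).1 ^ k.1 * (0 : ℂ × ℂ).2 ^ k.2) := by
    refine summable_of_ne_finset_zero (s := {0}) fun k hk => ?_
    have : k.1 ≠ 0 ∨ k.2 ≠ 0 := by
      by_contra! h
      exact hk (by simpa using Prod.ext h.1 h.2)
    rcases this with h | h <;> simp [h]
  have hρ0 : (0 : ℂ × ℂ) ∈ Metric.ball (0 : ℂ × ℂ) ρ :=
    Metric.mem_ball_self ((norm_nonneg _).trans_lt hρ)
  have key := hasFDerivAt_tsum_of_isPreconnected hu Metric.isOpen_ball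
    (convex_ball (0 : ℂ × ℂ) ρ).isPreconnected (fun k y _ => hd k y) hb hρ0 h00
    (x := x) (by simpa using hρ)
  have hev : powerSum a =ᶠ[𝓝 x] fun y => ∑' k : ℕ × ℕ, a k * (y.1 ^ k.1 * y.2 ^ k.2) := by
    filter_upwards [isOpen_bidisk.mem_nhds hx] with y hy
    simp [powerSum, hy]
  exact (key.congr_of_eventuallyEq hev).differentiableAt.differentiableWithinAt

theorem taylorCoeff_powerSum {a : ℕ × ℕ → ℂ} {C : ℝ} (hC : ∀ k, ‖a k‖ ≤ C) (k : ℕ × ℕ) :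
    taylorCoeff (powerSum a) k = a k := by
  have hC0 : 0 ≤ C := (norm_nonneg _).trans (hC 0)
  have hh : (1 / 2 : ℝ) ∈ Ico (0 : ℝ) 1 := by constructor <;> norm_num
  let h : ℂ := ((1 / 2 : ℝ) : ℂ)
  let F : ℕ × ℕ → UnitAddCircle × UnitAddCircle → ℂ := fun l t =>
    (a l * (h ^ l.1 * h ^ l.2)) * ((fourier (-(k.1 : ℤ)) t.1 * fourier (l.1 : ℤ) t.1) *
      (fourier (-(k.2 : ℤ)) t.2 * fourier (l.2 : ℤ) t.2))
  have hcont : ∀ l, Continuous (F l) := fun l =>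
    continuous_const.mul (((((fourier _).continuous.comp continuous_fst)).mul
      ((fourier _).continuous.comp continuous_fst)).mul
      ((((fourier _).continuous.comp continuous_snd)).mul
      ((fourier _).continuous.comp continuous_snd)))
  have hnorm : ∀ l t, ‖F l t‖ = ‖a l * (h ^ l.1 * h ^ l.2)‖ := by
    intro l t
    simp [F, fourier_apply, Circle.norm_coe]
  have hsum : Summable fun l => ‖a l * (h ^ l.1 * h ^ l.2)‖ := by
    refine Summable.of_nonneg_of_le (fun _ => norm_nonneg _) (fun l => ?_)
      ((summable_geom hh.1 hh.2).mul_left C)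
    rw [norm_mul]
    refine mul_le_mul (hC l) (le_of_eq ?_) (norm_nonneg _) hC0
    simp [h]
  have key := hasSum_integral_of_summable_integral_norm (μ := torusMeasure) (F := F)
    (fun l => integrable_of_continuous (hcont l)) (by simpa [hnorm] using hsum)
  have hF : ∀ t, ∑' l, F l t = fourier (-(k.1 : ℤ)) t.1 * fourier (-(k.2 : ℤ)) t.2 *
      powerSum a (torusPoint (1 / 2) (1 / 2) t) := by
    intro t
    rw [powerSum, indicator_of_mem (torusPoint_mem hh hh t), ← tsum_mul_left]
    refine tsum_congr fun l => ?_
    simp only [F, torusPoint, mul_pow, toCircle_pow, h]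
    ring
  have hval : ∀ l, ∫ t, F l t ∂torusMeasure =
      if l = k then a k * (h ^ k.1 * h ^ k.2) else 0 := by
    intro l
    simp only [F]
    rw [integral_const_mul, torusMeasure, integral_prod_mul
      (fun s : UnitAddCircle => fourier (-(k.1 : ℤ)) s * fourier (l.1 : ℤ) s)
      (fun s : UnitAddCircle => fourier (-(k.2 : ℤ)) s * fourier (l.2 : ℤ) s),
      integral_fourier_mul, integral_fourier_mul]
    by_cases hl : l = k
    · subst hl; simp
    · rw [if_neg hl]
      have : ¬ ((k.1 : ℤ) = l.1) ∨ ¬ ((k.2 : ℤ) = l.2) := by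
        by_contra! hc
        exact hl (Prod.ext (by exact_mod_cast hc.1.symm) (by exact_mod_cast hc.2.symm))
      rcases this with hc | hc <;> simp only [if_neg hc] <;> ring
  simp_rw [hF, hval] at key
  have e := key.unique (hasSum_ite_eq k _)
  have hp : ∀ j : ℕ, h ^ j * 2 ^ j = 1 := fun j => by
    rw [← mul_pow]; norm_num [h]
  unfold taylorCoeff torusCoeff
  rw [e, pow_add]
  linear_combination (a k * h ^ k.2 * 2 ^ k.2) * hp k.1 + a k * hp k.2

/-- The space of functions underlying `H²(𝔻²)`: all holomorphic `f` on `𝔻²` such that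
`sup_{0 ≤ r < 1} ∫_{𝕋²} |f(rz, rw)|² dm < ∞`.  A function on the bidisk is represented by its
extension by zero to `ℂ²`. -/
def hardySubmodule : Submodule ℂ (ℂ × ℂ → ℂ) where
  carrier := {f | DifferentiableOn ℂ f bidisk ∧ (∀ x ∉ bidisk, f x = 0) ∧
    ∃ C : ℝ, ∀ r ∈ Ico (0 : ℝ) 1, torusMean f r ≤ C}
  zero_mem' := ⟨differentiableOn_const 0, fun _ _ => rfl, 0, fun r _ => by simp [torusMean]⟩
  add_mem' := by
    rintro f g ⟨hf, hf0, C, hC⟩ ⟨hg, hg0, D, hD⟩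
    refine ⟨hf.add hg, fun x hx => by simp [hf0 x hx, hg0 x hx], 2 * C + 2 * D, fun r hr => ?_⟩
    have cf := continuous_comp_torusPoint hf hr hr
    have cg := continuous_comp_torusPoint hg hr hr
    have i1 : Integrable (fun t => ‖f (torusPoint r r t)‖ ^ 2) torusMeasure :=
      integrable_of_continuous (cf.norm.pow 2)
    have i2 : Integrable (fun t => ‖g (torusPoint r r t)‖ ^ 2) torusMeasure :=
      integrable_of_continuous (cg.norm.pow 2)
    calc torusMean (f + g) r
        ≤ ∫ t, (2 * ‖f (torusPoint r r t)‖ ^ 2 + 2 * ‖g (torusPoint r r t)‖ ^ 2)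
            ∂torusMeasure := by
          refine integral_mono (integrable_of_continuous ((cf.add cg).norm.pow 2))
            ((i1.const_mul 2).add (i2.const_mul 2)) fun t => ?_
          have := norm_add_le (f (torusPoint r r t)) (g (torusPoint r r t))
          have h3 := norm_nonneg (f (torusPoint r r t) + g (torusPoint r r t))
          simp only [Pi.add_apply]
          nlinarith [sq_nonneg (‖f (torusPoint r r t)‖ - ‖g (torusPoint r r t)‖)]
      _ = 2 * torusMean f r + 2 * torusMean g r := by
          rw [integral_add (i1.const_mul 2) (i2.const_mul 2), integral_const_mul,
            integral_const_mul]
          rfl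
      _ ≤ 2 * C + 2 * D := by linarith [hC r hr, hD r hr]
  smul_mem' := by
    rintro c f ⟨hf, hf0, C, hC⟩
    refine ⟨hf.const_smul c, fun x hx => by simp [hf0 x hx], ‖c‖ ^ 2 * C, fun r hr => ?_⟩
    have : torusMean (c • f) r = ‖c‖ ^ 2 * torusMean f r := by
      simp only [torusMean, Pi.smul_apply, norm_smul, mul_pow, integral_const_mul]
    rw [this]
    exact mul_le_mul_of_nonneg_left (hC r hr) (by positivity)

/-- The Hardy space `H²(𝔻²)` of holomorphic functions on the bidisk with
`‖f‖² = sup_{0 ≤ r < 1} ∫_{𝕋²} |f(rz, rw)|² dm < ∞`. -/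
def HardySpace : Type := hardySubmodule

namespace HardySpace

instance : AddCommGroup HardySpace := inferInstanceAs (AddCommGroup hardySubmodule)

instance : Module ℂ HardySpace := inferInstanceAs (Module ℂ hardySubmodule)

instance : CoeFun HardySpace fun _ => ℂ × ℂ → ℂ := ⟨Subtype.val⟩

theorem differentiableOn (f : HardySpace) : DifferentiableOn ℂ f bidisk := f.2.1

theorem eq_zero_of_notMem (f : HardySpace) {x : ℂ × ℂ} (hx : x ∉ bidisk) : f x = 0 := f.2.2.1 x hx

theorem add_apply (f g : HardySpace) (x : ℂ × ℂ) : (f + g) x = f x + g x := rfl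

theorem smul_apply (c : ℂ) (f : HardySpace) (x : ℂ × ℂ) : (c • f) x = c * f x := rfl

theorem zero_apply (x : ℂ × ℂ) : (0 : HardySpace) x = 0 := rfl

theorem ext {f g : HardySpace} (h : ∀ x ∈ bidisk, f x = g x) : f = g := by
  apply Subtype.ext
  funext x
  by_cases hx : x ∈ bidisk
  · exact h x hx
  · exact (f.eq_zero_of_notMem hx).trans (g.eq_zero_of_notMem hx).symm

theorem summable_sq (f : HardySpace) : Summable fun k => ‖taylorCoeff f k‖ ^ 2 :=
  let ⟨_, hC⟩ := f.2.2.2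
  summable_sq_taylorCoeff f.differentiableOn hC

theorem torusCoeff_add (f g : HardySpace) {r : ℝ} (hr : r ∈ Ico (0 : ℝ) 1) (m n : ℤ) :
    torusCoeff (f + g : HardySpace) r r m n = torusCoeff f r r m n + torusCoeff g r r m n := by
  have hi : ∀ f : HardySpace, Integrable (fun t : UnitAddCircle × UnitAddCircle =>
      fourier (-m) t.1 * fourier (-n) t.2 * f (torusPoint r r t)) torusMeasure := fun f =>
    integrable_of_continuous ((((fourier (-m)).continuous.comp continuous_fst).mul
      ((fourier (-n)).continuous.comp continuous_snd)).mul
      (continuous_comp_torusPoint f.differentiableOn hr hr))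
  unfold torusCoeff
  rw [← integral_add (hi f) (hi g)]
  simp only [add_apply, mul_add]

/-- The family of Taylor coefficients of `f`, as an element of `ℓ²(ℕ × ℕ)`. -/
def coeffSeq (f : HardySpace) : lp (fun _ : ℕ × ℕ => ℂ) 2 :=
  ⟨taylorCoeff f, memℓp_gen (by simpa using f.summable_sq)⟩

theorem coeffSeq_apply (f : HardySpace) (k : ℕ × ℕ) : coeffSeq f k = taylorCoeff f k := rfl

theorem coeffSeq_add (f g : HardySpace) : coeffSeq (f + g) = coeffSeq f + coeffSeq g := by
  ext k
  rw [lp.coeFn_add, Pi.add_apply, coeffSeq_apply, coeffSeq_apply, coeffSeq_apply]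
  unfold taylorCoeff
  rw [torusCoeff_add f g (by constructor <;> norm_num), mul_add]

theorem coeffSeq_smul (c : ℂ) (f : HardySpace) : coeffSeq (c • f) = c • coeffSeq f := by
  ext k
  rw [lp.coeFn_smul, Pi.smul_apply, coeffSeq_apply, coeffSeq_apply]
  simp only [taylorCoeff, torusCoeff, smul_apply, smul_eq_mul]
  simp_rw [mul_left_comm _ c]
  rw [integral_const_mul, mul_left_comm]

/-- The Taylor coefficients, as a linear bijection from `H²(𝔻²)` to `ℓ²(ℕ × ℕ)`. -/
def coeffEquiv : HardySpace ≃ₗ[ℂ] lp (fun _ : ℕ × ℕ => ℂ) 2 :=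
  LinearEquiv.ofBijective ⟨⟨coeffSeq, coeffSeq_add⟩, coeffSeq_smul⟩ <| by
    constructor
    · rw [← LinearMap.ker_eq_bot, LinearMap.ker_eq_bot']
      intro f hf
      refine ext fun x hx => eq_zero_of_taylorCoeff f.differentiableOn (fun k => ?_) hx
      exact congrFun (congrArg Subtype.val hf) k
    · intro a
      have hC : ∀ k, ‖a k‖ ≤ ‖a‖ := fun k => lp.norm_apply_le_norm two_ne_zero a k
      have hs : Summable fun k => ‖taylorCoeff (powerSum a) k‖ ^ 2 := by
        simp_rw [taylorCoeff_powerSum hC]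
        simpa using (lp.memℓp a).summable (by simp)
      refine ⟨⟨powerSum a, differentiableOn_powerSum hC, fun x hx => by simp [powerSum, hx],
        _, fun r hr => torusMean_le (differentiableOn_powerSum hC) hs hr⟩, ?_⟩
      ext k
      exact taylorCoeff_powerSum hC k

theorem coeffEquiv_apply (f : HardySpace) (k : ℕ × ℕ) : coeffEquiv f k = taylorCoeff f k := rfl

instance : Norm HardySpace := ⟨fun f => √(⨆ r : Ico (0 : ℝ) 1, torusMean f r)⟩

theorem norm_def (f : HardySpace) : ‖f‖ = √(⨆ r : Ico (0 : ℝ) 1, torusMean f r) := rfl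

theorem bddAbove_torusMean (f : HardySpace) :
    BddAbove (range fun r : Ico (0 : ℝ) 1 => torusMean f r) := by
  obtain ⟨C, hC⟩ := f.2.2.2
  exact ⟨C, by rintro _ ⟨r, rfl⟩; exact hC r r.2⟩

theorem norm_coeffEquiv (f : HardySpace) : ‖coeffEquiv f‖ = ‖f‖ := by
  have : Nonempty (Ico (0 : ℝ) 1) := ⟨⟨0, by simp⟩⟩
  have h1 : ‖coeffEquiv f‖ ^ 2 = ∑' k, ‖taylorCoeff f k‖ ^ 2 := by
    have := lp.norm_rpow_eq_tsum (p := 2) (by simp) (coeffEquiv f)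
    simpa [coeffEquiv_apply] using this
  have h2 : ⨆ r : Ico (0 : ℝ) 1, torusMean f r = ∑' k, ‖taylorCoeff f k‖ ^ 2 := by
    apply le_antisymm
    · exact ciSup_le fun r => torusMean_le f.differentiableOn f.summable_sq r.2
    · refine f.summable_sq.tsum_le_of_sum_le fun s => ?_
      exact sum_sq_taylorCoeff_le f.differentiableOn
        (fun r hr => le_ciSup f.bddAbove_torusMean ⟨r, hr⟩) s
  rw [norm_def, h2, ← h1, Real.sqrt_sq (norm_nonneg _)]

instance : NormedAddCommGroup HardySpace where
  dist f g := ‖-f + g‖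
  dist_self f := by simp [← norm_coeffEquiv]
  dist_comm f g := by
    rw [← norm_coeffEquiv, ← norm_coeffEquiv, ← norm_neg (coeffEquiv (-g + f)), ← map_neg]
    congr 2
    abel
  dist_triangle f g h := by
    rw [← norm_coeffEquiv, ← norm_coeffEquiv, ← norm_coeffEquiv]
    refine le_trans (le_of_eq ?_) (norm_add_le _ _)
    rw [← map_add]
    congr 2
    abel
  eq_of_dist_eq_zero {f g} h := by
    rw [← norm_coeffEquiv, norm_eq_zero, map_eq_zero_iff _ coeffEquiv.injective,
      neg_add_eq_zero] at h
    exact h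
  dist_eq _ _ := rfl

/-- The inner product of `H²(𝔻²)`, written through Taylor coefficients; the norm that it induces is
the norm `√(sup_r ∫ |f(rz, rw)|² dm)`. -/
instance : InnerProductSpace ℂ HardySpace where
  inner f g := inner ℂ (coeffEquiv f) (coeffEquiv g)
  norm_smul_le c f := by
    rw [← norm_coeffEquiv, ← norm_coeffEquiv, map_smul, norm_smul]
  norm_sq_eq_re_inner f := by
    rw [← norm_coeffEquiv]; exact norm_sq_eq_re_inner (𝕜 := ℂ) _
  conj_inner_symm f g := inner_conj_symm _ _
  add_left f g h := by rw [map_add, inner_add_left]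
  smul_left f g c := by rw [map_smul, inner_smul_left]

/-- `H²(𝔻²)` and `ℓ²(ℕ × ℕ)` are isometrically isomorphic through Taylor coefficients. -/
def coeffIsometry : HardySpace ≃ₗᵢ[ℂ] lp (fun _ : ℕ × ℕ => ℂ) 2 :=
  ⟨coeffEquiv, norm_coeffEquiv⟩

instance : CompleteSpace HardySpace :=
  (completeSpace_congr (e := coeffIsometry.toEquiv) coeffIsometry.isometry.isUniformEmbedding).2
    inferInstance

theorem torusMean_mul_fst_le (f : HardySpace) {r : ℝ} (hr : r ∈ Ico (0 : ℝ) 1) :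
    torusMean (fun x => x.1 * f x) r ≤ torusMean f r := by
  have hc := continuous_comp_torusPoint f.differentiableOn hr hr
  refine integral_mono (integrable_of_continuous
    (((continuous_fst.comp (continuous_torusPoint r r)).mul hc).norm.pow 2))
    (integrable_of_continuous (hc.norm.pow 2)) fun t => ?_
  have h1 := (mem_bidisk.1 (torusPoint_mem hr hr t)).1
  simp only [norm_mul]
  gcongr
  exact mul_le_of_le_one_left (norm_nonneg _) h1.le

theorem mul_fst_mem (f : HardySpace) : (fun x : ℂ × ℂ => x.1 * f x) ∈ hardySubmodule := by
  obtain ⟨C, hC⟩ := f.2.2.2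
  refine ⟨differentiableOn_fst.mul f.differentiableOn,
    fun x hx => by simp [f.eq_zero_of_notMem hx], C, fun r hr => (?_ : _ ≤ _).trans (hC r hr)⟩
  exact torusMean_mul_fst_le f hr

/-- Multiplication by the coordinate function `z` on `H²(𝔻²)`. -/
def shiftZ : HardySpace →L[ℂ] HardySpace :=
  LinearMap.mkContinuous
    { toFun := fun f => (⟨fun x => x.1 * f x, f.mul_fst_mem⟩ : hardySubmodule)
      map_add' := fun f g => ext fun x _ => mul_add _ _ _
      map_smul' := fun c f => ext fun x _ => mul_left_comm _ _ _ } 1 <| by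
    intro f
    rw [one_mul]
    exact Real.sqrt_le_sqrt (ciSup_mono f.bddAbove_torusMean
      fun r => torusMean_mul_fst_le f r.2)

theorem shiftZ_apply (f : HardySpace) (x : ℂ × ℂ) : shiftZ f x = x.1 * f x := rfl

end HardySpace

/-- The submodule `θ H²(𝔻²)` of `H²(𝔻²)`. -/
def multiples (θ : HardySpace) : Submodule ℂ HardySpace where
  carrier := {f | ∃ h : HardySpace, ∀ x ∈ bidisk, f x = θ x * h x}
  zero_mem' := ⟨0, fun x _ => by simp [HardySpace.zero_apply]⟩
  add_mem' := by
    rintro f g ⟨h, hh⟩ ⟨k, hk⟩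
    exact ⟨h + k, fun x hx => by
      rw [HardySpace.add_apply, HardySpace.add_apply, hh x hx, hk x hx, mul_add]⟩
  smul_mem' := by
    rintro c f ⟨h, hh⟩
    exact ⟨c • h, fun x hx => by
      rw [HardySpace.smul_apply, HardySpace.smul_apply, hh x hx, mul_left_comm]⟩

/-- The quotient module `K_θ = H²(𝔻²) ⊖ θ H²(𝔻²)`. -/
def quotientModule (θ : HardySpace) : Submodule ℂ HardySpace := (multiples θ)ᗮ

instance (θ : HardySpace) : CompleteSpace (quotientModule θ) :=
  inferInstanceAs (CompleteSpace ((multiples θ)ᗮ : Submodule ℂ HardySpace))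

/-- The compressed shift `S_z = P T_z |_{K_θ}`, where `P` is the orthogonal projection onto `K_θ`. -/
def compressedShift (θ : HardySpace) : quotientModule θ →L[ℂ] quotientModule θ :=
  (quotientModule θ).orthogonalProjectionOnto ∘L HardySpace.shiftZ ∘L (quotientModule θ).subtypeL

/-- `θ ∈ H²(𝔻²)` is inner if its radial boundary values on `𝕋²` are unimodular almost everywhere. -/
def IsInner (θ : HardySpace) : Prop :=
  ∀ᵐ t ∂torusMeasure, ∃ c : ℂ, ‖c‖ = 1 ∧
    Tendsto (fun r : ℝ => θ (torusPoint r r t)) (𝓝[<] 1) (𝓝 c)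

/-- `θ` is the restriction to `𝔻²` of a rational function `q / p` in two variables. -/
def IsRational (θ : HardySpace) : Prop :=
  ∃ p q : MvPolynomial (Fin 2) ℂ, p ≠ 0 ∧
    ∀ x ∈ bidisk, θ x * MvPolynomial.eval ![x.1, x.2] p = MvPolynomial.eval ![x.1, x.2] q

/-- `θ` is constant on `𝔻²`. -/
def IsConst (θ : HardySpace) : Prop := ∃ c : ℂ, ∀ x ∈ bidisk, θ x = c

/-- `θ` depends only on the variable `z`. -/
def DependsOnlyOnZ (θ : HardySpace) : Prop :=
  ∃ g : ℂ → ℂ, ∀ x ∈ bidisk, θ x = g x.1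

/-- `θ` has a (nonconstant) inner factor depending only on `z`. -/
def HasInnerFactorInZ (θ : HardySpace) : Prop :=
  ∃ φ ψ : HardySpace, IsInner φ ∧ IsInner ψ ∧ ¬ IsConst φ ∧ DependsOnlyOnZ φ ∧
    ∀ x ∈ bidisk, θ x = φ x * ψ x

/-- `f` has exactly `n` zeros in the open unit disk, counted with multiplicity. -/
def HasZeroCount (f : ℂ → ℂ) (n : ℕ) : Prop :=
  ∃ s : Finset ℂ, (∀ w, w ∈ s ↔ w ∈ Metric.ball (0 : ℂ) 1 ∧ f w = 0) ∧
    ∑ w ∈ s, analyticOrderAt f w = n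

/-- The essential spectrum: all `l` such that `T - l` is not a Fredholm operator. -/
def essentialSpectrum {H : Type*} [NormedAddCommGroup H] [InnerProductSpace ℂ H]
    (T : H →L[ℂ] H) : Set ℂ :=
  {l | ¬ (T - l • ContinuousLinearMap.id ℂ H).IsFredholm}

/-- The complex conjugate `Ω^*` of a set of complex numbers. -/
def conjSet (Ω : Set ℂ) : Set ℂ := (starRingEnd ℂ) '' Ω

/-- `(Ωᵢ)` lists the connected components of `Ω`, each exactly once. -/
def EnumeratesComponents {ι : Type*} (Ω : Set ℂ) (Ωc : ι → Set ℂ) : Prop :=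
  Function.Injective Ωc ∧ range Ωc = {C | ∃ x ∈ Ω, C = connectedComponentIn Ω x}

/-- The generalized Cowen–Douglas class `𝔅_α(Ω)`, where `Ω` is a nonempty bounded open set with
connected components `(Ωᵢ)` and `α = (αᵢ)` is a family of positive integers. -/
structure GeneralizedCowenDouglas {H : Type*} [NormedAddCommGroup H] [InnerProductSpace ℂ H]
    {ι : Type*} (Ω : Set ℂ) (Ωc : ι → Set ℂ) (α : ι → ℕ) (T : H →L[ℂ] H) : Prop where
  complete : CompleteSpace H
  separable : TopologicalSpace.SeparableSpace H
  isOpen : IsOpen Ω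
  isBounded : Bornology.IsBounded Ω
  nonempty : Ω.Nonempty
  components : EnumeratesComponents Ω Ωc
  index_pos : ∀ i, 0 < α i
  range_eq : ∀ l ∈ Ω, (T - l • ContinuousLinearMap.id ℂ H).range = ⊤
  span_ker : (⨆ l ∈ Ω, (T - l • ContinuousLinearMap.id ℂ H).ker).topologicalClosure = ⊤
  rank_ker : ∀ i, ∀ l ∈ Ωc i, Module.rank ℂ (T - l • ContinuousLinearMap.id ℂ H).ker = α i

end HardyBidisk

end

open HardyBidisk

noncomputable section

open MeasureTheory Set Filter Topology
open scoped ComplexConjugate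

namespace HardyBidisk

/-! Write `θ = q / p` with polynomials in `z, w`. For `|l| < 1` everything about `S_z - l` is read
off on the line `z = l`: modulo `θH² + (z - l)H²`, a function `f` matters only through `f(l, ·)`,
and `P f` lies in `Ran (S_z - l)` exactly when `f(l, ·) = θ(l, ·) g(l, ·)` for some `g ∈ H²`
(`projK_mem_range_iff`). An inner function vanishing on `z = l` has a Blaschke factor in `z`, so
here `θ(l, ·)` is never identically zero, and this makes `S_z - l` injective
(`ker_shiftSub_eq_bot`). For `|l| ≥ 1` the contraction `S_z` has no eigenvalue `l`, so a Fredholm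
`S_z - l` is invertible; hence `Ω` lies in the disk.

An injective Fredholm operator has a left inverse. Its adjoint is therefore onto, with kernel of
dimension equal to the codimension of the range, and that codimension is locally constant in `l`. It
equals the number of zeros of `θ(l, ·)`: the cokernel is `ℂ[w] / (b)`, where `b` generates the ideal
of polynomials divisible by `θ(l, ·)`, all roots of `b` lie in the disk, and `b / θ(l, ·)` has no
zero there (`hasZeroCount`).

For the density of the span of the kernels, a vector `k` orthogonal to all of them lies in every
range `Ran (S_z - l)`, `l ∈ Ω`. So `k(l, ·)` is divisible by `θ(l, ·)` for every Fredholm point `l`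
of the disk. These points are dense, because `q(l, ·)` is free of zeros on the circle for a dense
set of `l`; this is a resultant argument (`exists_forall_evalEval_ne_zero`). Cauchy's formula in `w`
then gives a holomorphic `k / θ` on the bidisk (`exists_quotient`), and division by `θ` does not
increase the norm (`exists_div`), so `k ∈ θH² ∩ K_θ = 0`. The same argument with `Ω` empty would
give `K_θ = 0`, hence `1 ∈ θH²` and `θ` constant; so `Ω` is nonempty. -/

/-! ### Zeros of bivariate polynomials on the unit circle -/

open Polynomial in
/-- A polynomial in `z` and `conj z` that vanishes on a nonempty open set vanishes identically. -/
theorem eval_eq_zero_of_forall_conj {R : MvPolynomial (Fin 2) ℂ} {U : Set ℂ} (hU : IsOpen U)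
    (hne : U.Nonempty) (h : ∀ s ∈ U, MvPolynomial.eval ![s, conj s] R = 0) (s t : ℂ) :
    MvPolynomial.eval ![s, t] R = 0 := by
  obtain ⟨a, ha⟩ := hne
  obtain ⟨ε, hε, hball⟩ := Metric.isOpen_iff.1 hU a ha
  -- `P(u, v) = R(u + iv, u - iv)` vanishes for real `u, v` in a rectangle around `a`, a product of
  -- infinite sets, so `P = 0`.
  let P : MvPolynomial (Fin 2) ℂ := MvPolynomial.bind₁
    ![MvPolynomial.X 0 + MvPolynomial.C Complex.I * MvPolynomial.X 1,
      MvPolynomial.X 0 - MvPolynomial.C Complex.I * MvPolynomial.X 1] R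
  have hP : ∀ x : Fin 2 → ℂ, MvPolynomial.eval x P =
      MvPolynomial.eval ![x 0 + Complex.I * x 1, x 0 - Complex.I * x 1] R := by
    intro x
    simp only [P, MvPolynomial.eval, MvPolynomial.eval₂Hom_bind₁]
    congr 2
    ext i
    fin_cases i <;> simp
  let S : Fin 2 → Set ℂ := ![((↑) : ℝ → ℂ) '' Ioo (a.re - ε / 2) (a.re + ε / 2),
    ((↑) : ℝ → ℂ) '' Ioo (a.im - ε / 2) (a.im + ε / 2)]
  have hS : ∀ i, (S i).Infinite := by
    intro i
    fin_cases i
    · exact (Ioo_infinite (by linarith)).image Complex.ofReal_injective.injOn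
    · exact (Ioo_infinite (by linarith)).image Complex.ofReal_injective.injOn
  have hP0 : P = 0 := by
    refine MvPolynomial.funext_set S hS fun x hx => ?_
    obtain ⟨u, hu, hu'⟩ : x 0 ∈ ((↑) : ℝ → ℂ) '' Ioo (a.re - ε / 2) (a.re + ε / 2) :=
      hx 0 (mem_univ _)
    obtain ⟨v, hv, hv'⟩ : x 1 ∈ ((↑) : ℝ → ℂ) '' Ioo (a.im - ε / 2) (a.im + ε / 2) :=
      hx 1 (mem_univ _)
    rw [hP, map_zero, ← hu', ← hv']
    have hmem : (u : ℂ) + Complex.I * v ∈ U := by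
      refine hball ?_
      rw [Metric.mem_ball, Complex.dist_eq]
      refine (Complex.norm_le_abs_re_add_abs_im _).trans_lt ?_
      have h1 : |u - a.re| < ε / 2 := abs_lt.2 ⟨by linarith [hu.1], by linarith [hu.2]⟩
      have h2 : |v - a.im| < ε / 2 := abs_lt.2 ⟨by linarith [hv.1], by linarith [hv.2]⟩
      simp only [Complex.sub_re, Complex.add_re, Complex.ofReal_re, Complex.mul_re, Complex.I_re,
        Complex.I_im, Complex.ofReal_im, Complex.sub_im, Complex.add_im, Complex.mul_im]
      simp only [zero_mul, mul_zero, one_mul, add_zero, zero_add, sub_zero]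
      linarith
    have := h _ hmem
    simpa [sub_eq_add_neg] using this
  -- The inverse substitution, now with complex arguments, recovers `R(s, t)`.
  have := hP ![(s + t) / 2, (s - t) / (2 * Complex.I)]
  rw [hP0, map_zero] at this
  rw [this]
  congr 2
  have hI : Complex.I ≠ 0 := Complex.I_ne_zero
  ext i
  fin_cases i
  · simp; field_simp; ring
  · simp; field_simp; ring

open Polynomial in
/-- If every `q(λ, ·)` with `λ` in a nonempty open set has a zero on the unit circle, then some
`w - c` divides `q`. -/
theorem exists_eval_C_eq_zero {q : ℂ[X][X]} {U : Set ℂ} (hU : IsOpen U) (hne : U.Nonempty)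
    (h : ∀ s ∈ U, ∃ w : ℂ, ‖w‖ = 1 ∧ q.evalEval s w = 0) : ∃ c : ℂ, q.eval (C c) = 0 := by
  by_contra! hc
  set n := q.natDegree with hn
  have hn0 : n ≠ 0 := by
    intro h0
    obtain ⟨a, ha⟩ := natDegree_eq_zero.1 (hn.symm.trans h0)
    have ha0 : a = 0 := by
      refine Polynomial.eq_zero_of_infinite_isRoot a ?_
      refine (infinite_of_mem_nhds hne.some (hU.mem_nhds hne.some_mem)).mono fun s hs => ?_
      obtain ⟨w, -, hw⟩ := h s hs
      rw [← ha, evalEval_C] at hw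
      exact hw
    exact hc 0 (by rw [← ha, ha0]; simp)
  let es : ℂ[X] →+* MvPolynomial (Fin 2) ℂ := eval₂RingHom MvPolynomial.C (MvPolynomial.X 0)
  let et : ℂ[X] →+* MvPolynomial (Fin 2) ℂ := eval₂RingHom (MvPolynomial.C.comp (starRingEnd ℂ)) (MvPolynomial.X 1)
  -- At `t = conj s` this is the resultant of `q(s, ·)` and its reflection `w ^ n * conj (q(s, 1 /
  -- conj w))`, which share every zero on the unit circle. Treating `conj s` as a free variable `t`
  -- keeps `R` polynomial.
  let R : MvPolynomial (Fin 2) ℂ := (q.map es).resultant ((q.map et).reflect n) n n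
  let gt : ℂ → ℂ[X] := fun t => (q.map (eval₂RingHom (starRingEnd ℂ) t)).reflect n
  have hR : ∀ s t, MvPolynomial.eval ![s, t] R =
      (q.map (evalRingHom s)).resultant (gt t) n n := by
    intro s t
    have e1 : (MvPolynomial.eval ![s, t]).comp es = evalRingHom s := by
      ext <;> simp [es]
    have e2 : (MvPolynomial.eval ![s, t]).comp et = eval₂RingHom (starRingEnd ℂ) t := by
      ext <;> simp [et]
    simp only [R, gt]
    rw [← resultant_map_map, ← reflect_map, Polynomial.map_map, Polynomial.map_map, e1, e2]
  have hdeg : ∀ t, (gt t).natDegree ≤ n := fun t =>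
    natDegree_reflect_le.trans (max_le le_rfl natDegree_map_le)
  have hzero : ∀ s t, MvPolynomial.eval ![s, t] R = 0 := by
    refine eval_eq_zero_of_forall_conj hU hne fun s hs => ?_
    obtain ⟨w, hw, hqw⟩ := h s hs
    have hw0 : w ≠ 0 := by rintro rfl; simp at hw
    rw [hR]
    obtain ⟨a, b, -, -, hab⟩ := exists_mul_add_mul_eq_C_resultant (m := n) (n := n)
      (q.map (evalRingHom s)) (gt (conj s)) natDegree_map_le (hdeg _) (Or.inl hn0)
    have e := congrArg (Polynomial.eval w) hab
    rw [eval_add, eval_mul, eval_mul, eval_C, map_evalRingHom_eval, hqw, zero_mul, zero_add] at e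
    rw [← e]
    have hg : (gt (conj s)).eval w = 0 := by
      let : Invertible (conj w) := invertibleOfNonzero (by simpa using hw0)
      have hinv : ⅟(conj w) = w := by
        rw [invOf_eq_inv, ← map_inv₀, Complex.inv_def, Complex.normSq_eq_norm_sq, hw]
        simp
      have := (eval₂_reflect_eq_zero_iff (RingHom.id ℂ) (conj w) n
        (q.map (eval₂RingHom (starRingEnd ℂ) (conj s))) natDegree_map_le).2 ?_
      · rwa [hinv] at this
      · have e3 : eval₂RingHom (starRingEnd ℂ) (conj s) = (starRingEnd ℂ).comp (evalRingHom s) := by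
          ext <;> simp
        rw [e3, ← Polynomial.map_map, eval₂_id, eval_map, eval₂_hom, map_evalRingHom_eval, hqw,
          map_zero]
    rw [hg, zero_mul]
  -- Reflection moves the coefficient of degree `0` to degree `n`. Where it does not vanish, the
  -- reflected polynomial has full degree `n`, and the resultant is, up to a nonzero factor, the
  -- product of `q(s, c)` over the roots `c` of a polynomial independent of `s`.
  have hq0 : q.coeff 0 ≠ 0 := by
    have := hc 0
    rwa [map_zero, ← coeff_zero_eq_eval_zero] at this
  obtain ⟨s₀, hs₀⟩ : ∃ s, (q.coeff 0).eval s ≠ 0 := by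
    by_contra! h'
    exact hq0 (Polynomial.funext fun s => by simpa using h' s)
  set g := gt (conj s₀) with hg
  have hgn : g.coeff n ≠ 0 := by
    simp only [hg, gt, coeff_reflect, coeff_map, revAt_le le_rfl, Nat.sub_self]
    rw [coe_eval₂RingHom, eval₂_hom]
    simpa using hs₀
  have hgd : g.natDegree = n := le_antisymm (hdeg _) (le_natDegree_of_ne_zero hgn)
  have hprod : (g.roots.map fun c => q.eval (C c)).prod = 0 := by
    refine Polynomial.funext fun s => ?_
    have e := hzero s (conj s₀)
    rw [hR, resultant_comm, ← hg] at e
    have e' := resultant_eq_prod_eval g (q.map (evalRingHom s)) n natDegree_map_le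
      (IsAlgClosed.splits g)
    rw [hgd] at e'
    rw [e'] at e
    have hl : g.leadingCoeff ≠ 0 := by rwa [leadingCoeff, hgd]
    have e2 : (g.roots.map (q.map (evalRingHom s)).eval).prod = 0 := by
      simpa [hl, pow_eq_zero_iff] using e
    rw [eval_multiset_prod, Multiset.map_map, eval_zero, ← e2]
    congr 1
    refine Multiset.map_congr rfl fun c _ => ?_
    rw [map_evalRingHom_eval]
    rfl
  obtain ⟨c, -, hc'⟩ := Multiset.mem_map.1 (Multiset.prod_eq_zero_iff.1 hprod)
  exact hc c hc'

open Polynomial in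
/-- If no `w - c` with `|c| = 1` divides `q`, then for a dense set of `λ` the polynomial `q(λ, ·)`
has no zero on the unit circle. -/
theorem exists_forall_evalEval_ne_zero {q : ℂ[X][X]}
    (hq : ∀ c : ℂ, ‖c‖ = 1 → q.eval (C c) ≠ 0) {U : Set ℂ} (hU : IsOpen U) (hne : U.Nonempty) :
    ∃ s ∈ U, ∀ w : ℂ, ‖w‖ = 1 → q.evalEval s w ≠ 0 := by
  induction hn : q.natDegree using Nat.strong_induction_on generalizing q with
  | _ n ih =>
    by_contra! h
    -- This `c` need not lie on the unit circle, so there is no contradiction yet: the factor `w -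
    -- c` is split off and the degree drops.
    obtain ⟨c, hc⟩ := exists_eval_C_eq_zero hU hne h
    obtain ⟨r, rfl⟩ := dvd_iff_isRoot.2 hc
    have hr0 : r ≠ 0 := by
      rintro rfl
      exact hq 1 (by simp) (by simp)
    have hdeg : r.natDegree < n := by
      rw [← hn, natDegree_mul (X_sub_C_ne_zero _) hr0, natDegree_X_sub_C]
      omega
    obtain ⟨s, hs, hs'⟩ := ih _ hdeg (fun d hd h0 => hq d hd (by rw [eval_mul, h0, mul_zero])) rfl
    obtain ⟨w, hw, hw'⟩ := h s hs
    rw [evalEval_mul, mul_eq_zero] at hw'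
    rcases hw' with hw' | hw'
    · have : w = c := by simpa [evalEval, sub_eq_zero] using hw'
      subst this
      exact hq w hw hc
    · exact hs' w hw hw'

/-! ### Multipliers, shifts and difference quotients on the Hardy space -/

namespace HardySpace

theorem torusMean_le_norm_sq (f : HardySpace) {r : ℝ} (hr : r ∈ Ico (0 : ℝ) 1) :
    torusMean f r ≤ ‖f‖ ^ 2 := by
  have h := le_ciSup f.bddAbove_torusMean ⟨r, hr⟩
  have h0 : 0 ≤ torusMean f r := integral_nonneg fun _ => by positivity
  rw [norm_def, Real.sq_sqrt (h0.trans h)]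
  exact h

theorem norm_le_of_torusMean_le {f : HardySpace} {C : ℝ} (hC : 0 ≤ C)
    (h : ∀ r ∈ Ico (0 : ℝ) 1, torusMean f r ≤ C ^ 2) : ‖f‖ ≤ C := by
  have : Nonempty (Ico (0 : ℝ) 1) := ⟨⟨0, by simp⟩⟩
  rw [norm_def]
  exact (Real.sqrt_le_sqrt (ciSup_le fun r : Ico (0 : ℝ) 1 => h r r.2)).trans (Real.sqrt_sq hC).le

/-- A holomorphic function with bounded means defines an element of `H²(𝔻²)`. -/
theorem exists_of_torusMean_le {f : ℂ × ℂ → ℂ} (hf : DifferentiableOn ℂ f bidisk) {C : ℝ}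
    (hC : 0 ≤ C) (h : ∀ r ∈ Ico (0 : ℝ) 1, torusMean f r ≤ C ^ 2) :
    ∃ g : HardySpace, (∀ x ∈ bidisk, g x = f x) ∧ ‖g‖ ≤ C := by
  have hm : ∀ r ∈ Ico (0 : ℝ) 1, torusMean (bidisk.indicator f) r ≤ C ^ 2 := by
    intro r hr
    refine le_trans (le_of_eq ?_) (h r hr)
    refine integral_congr_ae (ae_of_all _ fun t => ?_)
    simp only [indicator_of_mem (torusPoint_mem hr hr t)]
  refine ⟨(⟨bidisk.indicator f, hf.congr fun x hx => indicator_of_mem hx f,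
    fun x hx => indicator_of_notMem hx f, C ^ 2, hm⟩ : hardySubmodule),
    fun x hx => indicator_of_mem hx f, norm_le_of_torusMean_le hC hm⟩

/-- Multiplication by a holomorphic function that is bounded on the tori of equal radii. -/
theorem exists_mul {φ : ℂ × ℂ → ℂ} (hφ : DifferentiableOn ℂ φ bidisk) {C : ℝ} (hC : 0 ≤ C)
    (hb : ∀ r ∈ Ico (0 : ℝ) 1, ∀ t, ‖φ (torusPoint r r t)‖ ≤ C) (f : HardySpace) :
    ∃ g : HardySpace, (∀ x ∈ bidisk, g x = φ x * f x) ∧ ‖g‖ ≤ C * ‖f‖ := by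
  refine exists_of_torusMean_le (hφ.mul f.differentiableOn) (by positivity) fun r hr => ?_
  have hc := continuous_comp_torusPoint f.differentiableOn hr hr
  calc torusMean (fun x => φ x * f x) r
      ≤ ∫ t, C ^ 2 * ‖f (torusPoint r r t)‖ ^ 2 ∂torusMeasure := by
        refine integral_mono (integrable_of_continuous
          (((continuous_comp_torusPoint hφ hr hr).mul hc).norm.pow 2))
          ((integrable_of_continuous (hc.norm.pow 2)).const_mul _) fun t => ?_
        simp only [norm_mul, mul_pow]
        gcongr
        exact hb r hr t
    _ = C ^ 2 * torusMean f r := integral_const_mul _ _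
    _ ≤ C ^ 2 * ‖f‖ ^ 2 := by gcongr; exact f.torusMean_le_norm_sq hr
    _ = (C * ‖f‖) ^ 2 := by ring

/-- `f` composed with the exchange of the variables. -/
theorem exists_swap (f : HardySpace) : ∃ g : HardySpace, ∀ x, g x = f x.swap := by
  have hs : ∀ x : ℂ × ℂ, x.swap ∈ bidisk ↔ x ∈ bidisk := fun x => by
    rw [mem_bidisk, mem_bidisk]; exact and_comm
  obtain ⟨C, hC⟩ := f.2.2.2
  refine ⟨(⟨fun x => f x.swap, ?_, fun x hx => f.eq_zero_of_notMem (by rwa [hs]), C,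
    fun r hr => (le_of_eq ?_).trans (hC r hr)⟩ : hardySubmodule), fun _ => rfl⟩
  · exact f.differentiableOn.comp (t := bidisk) (f := Prod.swap) (by unfold Prod.swap; fun_prop)
      fun x hx => (hs x).2 hx
  · unfold torusMean torusMeasure
    rw [← integral_prod_swap]
    rfl

/-- The power series defines an element of the Hardy space with the same Taylor coefficients, and
these determine the element. -/
theorem apply_eq_powerSum (f : HardySpace) (x : ℂ × ℂ) : f x = powerSum (taylorCoeff f) x := by
  have hC : ∀ k, ‖taylorCoeff f k‖ ≤ ‖coeffEquiv f‖ := fun k =>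
    lp.norm_apply_le_norm two_ne_zero (coeffEquiv f) k
  have hs : Summable fun k => ‖taylorCoeff (powerSum (taylorCoeff f)) k‖ ^ 2 := by
    simp_rw [taylorCoeff_powerSum hC]
    exact f.summable_sq
  let g : HardySpace := (⟨powerSum (taylorCoeff f), differentiableOn_powerSum hC,
    fun x hx => by simp [powerSum, hx],
    _, fun r hr => torusMean_le (differentiableOn_powerSum hC) hs hr⟩ : hardySubmodule)
  have : f = g := by
    apply coeffEquiv.injective
    ext k
    exact (taylorCoeff_powerSum hC k).symm
  conv_lhs => rw [this]

theorem apply_eq_tsum (f : HardySpace) {x : ℂ × ℂ} (hx : x ∈ bidisk) :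
    f x = ∑' k : ℕ × ℕ, taylorCoeff f k * (x.1 ^ k.1 * x.2 ^ k.2) := by
  rw [apply_eq_powerSum, powerSum, indicator_of_mem hx]

/-- The orthonormal basis of monomials. -/
def monomialBasis : HilbertBasis (ℕ × ℕ) ℂ HardySpace := HilbertBasis.ofRepr coeffIsometry

theorem inner_monomialBasis (k : ℕ × ℕ) (f : HardySpace) :
    inner ℂ (monomialBasis k) f = taylorCoeff f k :=
  (monomialBasis.repr_apply_apply f k).symm

theorem taylorCoeff_monomialBasis (k l : ℕ × ℕ) :
    taylorCoeff (monomialBasis k) l = if l = k then 1 else 0 := by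
  rw [← inner_monomialBasis, orthonormal_iff_ite.1 monomialBasis.orthonormal]

theorem monomialBasis_apply (k : ℕ × ℕ) {x : ℂ × ℂ} (hx : x ∈ bidisk) :
    monomialBasis k x = x.1 ^ k.1 * x.2 ^ k.2 := by
  rw [apply_eq_tsum _ hx, tsum_eq_single k]
  · simp [taylorCoeff_monomialBasis]
  · intro l hl
    simp [taylorCoeff_monomialBasis, hl]

instance : TopologicalSpace.SeparableSpace HardySpace := by
  have h : TopologicalSpace.IsSeparable
      (closure (Submodule.span ℂ (range monomialBasis) : Set HardySpace)) :=
    ((countable_range monomialBasis).isSeparable.span (R := ℂ)).closure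
  rw [← Submodule.topologicalClosure_coe, monomialBasis.dense_span, Submodule.top_coe] at h
  exact TopologicalSpace.isSeparable_univ_iff.1 h

theorem taylorCoeff_shiftZ (f : HardySpace) (m n : ℕ) :
    taylorCoeff (shiftZ f) (m + 1, n) = taylorCoeff f (m, n) := by
  have : torusCoeff (shiftZ f) (1 / 2) (1 / 2) (m + 1 : ℕ) n =
      2⁻¹ * torusCoeff f (1 / 2) (1 / 2) m n := by
    unfold torusCoeff
    rw [← integral_const_mul]
    refine integral_congr_ae (ae_of_all _ fun t => ?_)
    have h1 : fourier (-((m + 1 : ℕ) : ℤ)) t.1 * (AddCircle.toCircle t.1 : ℂ) =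
        fourier (-(m : ℤ)) t.1 := by
      have h2 : (AddCircle.toCircle t.1 : ℂ) = fourier 1 t.1 := by
        simp [fourier_apply]
      rw [h2, ← fourier_add, show -((m + 1 : ℕ) : ℤ) + 1 = -(m : ℤ) by push_cast; ring]
    simp only [shiftZ_apply]
    rw [show (torusPoint (1 / 2) (1 / 2) t).1 = 2⁻¹ * (AddCircle.toCircle t.1 : ℂ) by
      simp [torusPoint]]
    linear_combination (2⁻¹ * fourier (-(n : ℤ)) t.2 * f (torusPoint (1 / 2) (1 / 2) t)) * h1
  unfold taylorCoeff
  simp only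
  rw [this]
  ring

theorem shiftZ_monomialBasis (m n : ℕ) :
    shiftZ (monomialBasis (m, n)) = monomialBasis (m + 1, n) := by
  refine ext fun x hx => ?_
  rw [shiftZ_apply, monomialBasis_apply _ hx, monomialBasis_apply _ hx, pow_succ']
  ring

theorem taylorCoeff_adjoint_shiftZ (f : HardySpace) (m n : ℕ) :
    taylorCoeff (ContinuousLinearMap.adjoint shiftZ f) (m, n) = taylorCoeff f (m + 1, n) := by
  rw [← inner_monomialBasis, ContinuousLinearMap.adjoint_inner_right, shiftZ_monomialBasis,
    inner_monomialBasis]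

theorem mem_bidisk_zero_left {x : ℂ × ℂ} (hx : x ∈ bidisk) : ((0 : ℂ), x.2) ∈ bidisk := by
  rw [mem_bidisk] at *
  exact ⟨by simp, hx.2⟩

/-- The adjoint of the shift is the backward shift on coefficients, so `f` minus the shift of its
backward shift retains only the monomials free of `z`. -/
theorem shiftZ_adjoint_apply (f : HardySpace) {x : ℂ × ℂ} (hx : x ∈ bidisk) :
    x.1 * ContinuousLinearMap.adjoint shiftZ f x = f x - f (0, x.2) := by
  set u : HardySpace := f - shiftZ (ContinuousLinearMap.adjoint shiftZ f) with hu
  have hsub : ∀ y, u y = f y - y.1 * ContinuousLinearMap.adjoint shiftZ f y := fun y => by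
    rw [← shiftZ_apply, hu, sub_eq_add_neg, add_apply, ← neg_one_smul ℂ (shiftZ _), smul_apply]
    ring
  have hcoef : ∀ m n, taylorCoeff u (m + 1, n) = 0 := by
    intro m n
    rw [← inner_monomialBasis, hu, inner_sub_right, inner_monomialBasis, inner_monomialBasis,
      taylorCoeff_shiftZ, taylorCoeff_adjoint_shiftZ, sub_self]
  have hu0 : u x = u (0, x.2) := by
    rw [apply_eq_tsum u hx, apply_eq_tsum u (mem_bidisk_zero_left hx)]
    refine tsum_congr fun k => ?_
    obtain ⟨m, n⟩ := k
    cases m with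
    | zero => simp
    | succ m => rw [hcoef]; simp
  rw [hsub, hsub] at hu0
  linear_combination -hu0

theorem norm_shiftZ_le : ‖shiftZ‖ ≤ 1 := LinearMap.mkContinuous_norm_le _ zero_le_one _

/-- `(f(z, w) - f(a, w)) / (z - a)` belongs to `H²(𝔻²)`. -/
theorem exists_sub_eq_mul_fst (f : HardySpace) {a : ℂ} (ha : ‖a‖ < 1) :
    ∃ g : HardySpace, ∀ x ∈ bidisk, f x - f (a, x.2) = (x.1 - a) * g x := by
  set B : HardySpace →L[ℂ] HardySpace := ContinuousLinearMap.adjoint shiftZ with hB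
  -- With `B` the backward shift, the difference quotient is `g = (1 - aB)⁻¹ B f`, where the inverse
  -- exists by a Neumann series.
  have hBn : ‖a • B‖ < 1 := by
    rw [norm_smul]
    have : ‖B‖ ≤ 1 := by
      rw [hB, LinearIsometryEquiv.norm_map]
      exact norm_shiftZ_le
    calc ‖a‖ * ‖B‖ ≤ ‖a‖ * 1 := by gcongr
      _ < 1 := by rwa [mul_one]
  obtain ⟨U, hU⟩ := isUnit_one_sub_of_norm_lt_one hBn
  set g : HardySpace := (↑U⁻¹ : HardySpace →L[ℂ] HardySpace) (B f) with hg
  have hgB : g = B f + a • B g := by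
    have h1 : (U : HardySpace →L[ℂ] HardySpace) g = B f := by
      rw [hg, ← mul_apply_eq_comp, Units.mul_inv, one_apply_eq_self]
    rw [hU] at h1
    rw [← h1]
    simp
  have key : ∀ x ∈ bidisk, (x.1 - a) * g x = f x - (f (0, x.2) + a * g (0, x.2)) := by
    intro x hx
    have e1 := shiftZ_adjoint_apply f hx
    have e2 := shiftZ_adjoint_apply g hx
    have e3 : g x = B f x + a * B g x := by
      conv_lhs => rw [hgB]
      rfl
    rw [← hB] at e1 e2
    linear_combination x.1 * e3 + e1 + a * e2
  refine ⟨g, fun x hx => ?_⟩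
  have hx' : (a, x.2) ∈ bidisk := by
    rw [mem_bidisk] at *
    exact ⟨ha, hx.2⟩
  -- The remainder in `key` depends on `w` alone; setting `z = a` identifies it with `f(a, w)`.
  have e := key x hx
  have e' := key _ hx'
  simp only [sub_self, zero_mul] at e'
  linear_combination -e + e'

/-- `(f(z, w) - f(z, a)) / (w - a)` belongs to `H²(𝔻²)`. -/
theorem exists_sub_eq_mul_snd (f : HardySpace) {a : ℂ} (ha : ‖a‖ < 1) :
    ∃ g : HardySpace, ∀ x ∈ bidisk, f x - f (x.1, a) = (x.2 - a) * g x := by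
  obtain ⟨f', hf'⟩ := exists_swap f
  obtain ⟨g', hg'⟩ := exists_sub_eq_mul_fst f' ha
  obtain ⟨g, hg⟩ := exists_swap g'
  refine ⟨g, fun x hx => ?_⟩
  have := hg' x.swap (by rw [mem_bidisk] at *; exact hx.symm)
  rw [hf', hf'] at this
  rw [hg]
  simpa using this

/-- Multiplication by the coordinate function `w` on `H²(𝔻²)`. -/
def shiftW : HardySpace →L[ℂ] HardySpace :=
  have h (f : HardySpace) : ∃ g : HardySpace, (∀ x ∈ bidisk, g x = x.2 * f x) ∧
      ‖g‖ ≤ 1 * ‖f‖ :=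
    exists_mul differentiableOn_snd zero_le_one
      (fun _ hr t => (mem_bidisk.1 (torusPoint_mem hr hr t)).2.le) f
  LinearMap.mkContinuous
    { toFun := fun f => (h f).choose
      map_add' := fun f g => ext fun x hx => by
        rw [add_apply, (h _).choose_spec.1 x hx, (h _).choose_spec.1 x hx,
          (h _).choose_spec.1 x hx, add_apply, mul_add]
      map_smul' := fun c f => ext fun x hx => by
        rw [RingHom.id_apply, smul_apply, (h _).choose_spec.1 x hx,
          (h _).choose_spec.1 x hx, smul_apply, mul_left_comm] } 1
    fun f => (h f).choose_spec.2

theorem shiftW_apply (f : HardySpace) {x : ℂ × ℂ} (hx : x ∈ bidisk) :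
    shiftW f x = x.2 * f x := by
  have h : ∃ g : HardySpace, (∀ x ∈ bidisk, g x = x.2 * f x) ∧ ‖g‖ ≤ 1 * ‖f‖ :=
    exists_mul differentiableOn_snd zero_le_one
      (fun _ hr t => (mem_bidisk.1 (torusPoint_mem hr hr t)).2.le) f
  exact h.choose_spec.1 x hx

theorem norm_shiftW_le : ‖shiftW‖ ≤ 1 := by
  unfold shiftW
  exact LinearMap.mkContinuous_norm_le _ zero_le_one _

theorem sub_apply (f g : HardySpace) (x : ℂ × ℂ) : (f - g) x = f x - g x := rfl

open Polynomial in
theorem aeval_shiftW_apply (r : ℂ[X]) (f : HardySpace) {x : ℂ × ℂ} (hx : x ∈ bidisk) :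
    (aeval shiftW r) f x = r.eval x.2 * f x := by
  induction r using Polynomial.induction_on generalizing f with
  | C a => simp [smul_apply, Algebra.algebraMap_eq_smul_one]
  | add p q hp hq =>
    rw [map_add, _root_.add_apply, add_apply, hp, hq, eval_add, add_mul]
  | monomial n a h =>
    rw [pow_succ, ← mul_assoc, map_mul, mul_apply_eq_comp, h, aeval_X,
      shiftW_apply _ hx, eval_mul (p := C a * X ^ n), eval_X, mul_assoc]

/-- The constant function `1`. -/
def one : HardySpace := monomialBasis 0

theorem one_apply {x : ℂ × ℂ} (hx : x ∈ bidisk) : one x = 1 := by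
  rw [one, monomialBasis_apply _ hx]
  simp

end HardySpace

/-! ### Contractions and injective Fredholm operators -/

section Operators

variable {E : Type*} [NormedAddCommGroup E] [InnerProductSpace ℂ E] [CompleteSpace E]

open ContinuousLinearMap

theorem adjoint_sub_smul_id (T : E →L[ℂ] E) (l : ℂ) :
    adjoint (T - l • ContinuousLinearMap.id ℂ E) =
      adjoint T - conj l • ContinuousLinearMap.id ℂ E := by
  rw [map_sub, LinearIsometryEquiv.map_smulₛₗ, adjoint_id]

/-- An eigenvector of the adjoint of a contraction for an eigenvalue outside the open unit disk is
an eigenvector of the contraction. -/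
theorem eq_smul_of_adjoint_eq_smul {T : E →L[ℂ] E} (hT : ‖T‖ ≤ 1) {l : ℂ} (hl : 1 ≤ ‖l‖) {f : E}
    (h : adjoint T f = conj l • f) : T f = l • f := by
  have h1 : inner ℂ (T f) (l • f) = ((‖l‖ ^ 2 * ‖f‖ ^ 2 : ℝ) : ℂ) := by
    rw [← adjoint_inner_right, map_smul, h, smul_smul, inner_smul_right, Complex.mul_conj,
      inner_self_eq_norm_sq_to_K, Complex.normSq_eq_norm_sq]
    push_cast
    rfl
  have h2 := norm_sub_sq (𝕜 := ℂ) (T f) (l • f)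
  rw [h1, norm_smul] at h2
  have h3 : ‖T f‖ ≤ ‖f‖ := (T.le_of_opNorm_le hT f).trans_eq (one_mul _)
  have h5 : RCLike.re (((‖l‖ ^ 2 * ‖f‖ ^ 2 : ℝ) : ℂ)) = ‖l‖ ^ 2 * ‖f‖ ^ 2 := Complex.ofReal_re _
  rw [h5] at h2
  -- Expanding gives `‖Tf‖² - |l|² ‖f‖²`, which is at most `(1 - |l|²) ‖f‖²`.
  have h6 : ‖T f - l • f‖ ^ 2 ≤ 0 := by
    rw [h2]
    have : ‖T f‖ ^ 2 ≤ ‖f‖ ^ 2 := by gcongr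
    have : ‖f‖ ^ 2 ≤ ‖l‖ ^ 2 * ‖f‖ ^ 2 :=
      le_mul_of_one_le_left (by positivity) (one_le_pow₀ hl)
    nlinarith
  rw [← sub_eq_zero, ← norm_eq_zero]
  exact pow_eq_zero_iff two_ne_zero |>.1 (le_antisymm h6 (by positivity))

/-- If `T` is a contraction, `|l| ≥ 1` and `T - l` is injective, then `T - l` has dense range. -/
theorem topologicalClosure_range_eq_top {T : E →L[ℂ] E} (hT : ‖T‖ ≤ 1) {l : ℂ} (hl : 1 ≤ ‖l‖)
    (h : ∀ f, T f = l • f → f = 0) :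
    (T - l • ContinuousLinearMap.id ℂ E).range.topologicalClosure = ⊤ := by
  rw [Submodule.topologicalClosure_eq_top_iff, orthogonal_range, adjoint_sub_smul_id,
    Submodule.eq_bot_iff]
  intro f hf
  refine h f (eq_smul_of_adjoint_eq_smul hT hl ?_)
  simpa [sub_eq_zero] using hf

/-- A range of finite codimension has a finite-dimensional, hence closed, algebraic complement. For
an injective bounded operator this makes the range closed, and the operator a homeomorphism onto it.
-/
theorem isFredholm_of_ker_eq_bot {A : E →L[ℂ] E} (hk : A.ker = ⊥) (hf : A.range.CoFG) :
    A.IsFredholm := by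
  obtain ⟨N, hN⟩ := A.range.exists_isCompl
  have hfd : FiniteDimensional ℂ N := Module.Finite.iff_fg.2 (hf.fg_of_isCompl hN)
  have hcl := A.closed_complemented_range_of_isCompl_of_ker_eq_bot N hN
    N.closed_of_finiteDimensional hk
  have hinj : Function.Injective A := LinearMap.ker_eq_bot.1 hk
  refine ⟨?_, hcl, by rw [hk]; infer_instance, hf, ?_⟩
  · obtain ⟨K, hK⟩ := A.antilipschitz_of_injective_of_isClosed_range hinj hcl
    exact (hK.isUniformEmbedding A.uniformContinuous).isEmbedding.isStrictMap
  · rw [hk]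
    exact Submodule.closedComplemented_bot

theorem exists_leftInverse {A : E →L[ℂ] E} (hk : A.ker = ⊥) (hA : A.IsFredholm) :
    ∃ L : E →L[ℂ] E, L * A = 1 := by
  obtain ⟨L, hL⟩ := HasLeftInverse.of_injective_of_isClosed_range_of_closedComplement_range
    (LinearMap.ker_eq_bot.1 hk) hA.isClosed_range hA.closedComplemented_range
  exact ⟨L, ContinuousLinearMap.ext hL⟩

/-- Taking adjoints in `L A = 1` turns a left inverse of `A` into a right inverse of its adjoint. -/
theorem range_adjoint_eq_top {A : E →L[ℂ] E} (hk : A.ker = ⊥) (hA : A.IsFredholm) :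
    (adjoint A).range = ⊤ := by
  obtain ⟨L, hL⟩ := exists_leftInverse hk hA
  have h := congrArg star hL
  rw [star_mul, star_one] at h
  rw [LinearMap.range_eq_top]
  exact fun f => ⟨star L f, congrArg (fun B : E →L[ℂ] E => B f) h⟩

theorem rank_ker_adjoint {A : E →L[ℂ] E} (hA : A.IsFredholm) :
    Module.rank ℂ (adjoint A).ker = Module.finrank ℂ (E ⧸ A.range) := by
  have := hA.finite_coker
  have : CompleteSpace A.range := hA.isClosed_range.completeSpace_coe
  rw [← orthogonal_range, Module.finrank_eq_rank]
  exact (Submodule.quotientEquivOfIsCompl _ _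
    (Submodule.isCompl_orthogonal _)).rank_eq.symm

/-- Stability of injective Fredholm operators: near `l₀`, the ranges of `T - l` have a common
complement. -/
theorem eventually_isFredholm {T : E →L[ℂ] E} {l₀ : ℂ}
    (hk : (T - l₀ • ContinuousLinearMap.id ℂ E).ker = ⊥)
    (hA : (T - l₀ • ContinuousLinearMap.id ℂ E).IsFredholm) :
    ∀ᶠ l in 𝓝 l₀, (T - l • ContinuousLinearMap.id ℂ E).IsFredholm ∧
      Module.finrank ℂ (E ⧸ (T - l • ContinuousLinearMap.id ℂ E).range) =
      Module.finrank ℂ (E ⧸ (T - l₀ • ContinuousLinearMap.id ℂ E).range) := by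
  obtain ⟨L, hL⟩ := exists_leftInverse hk hA
  -- With `L` a left inverse at `l₀`, invertibility of `L (T - l)` is an open condition on `l`, and
  -- it makes the fixed space `ker L` a complement of the range.
  have hcompl : ∀ l : ℂ, IsUnit (L * (T - l • ContinuousLinearMap.id ℂ E)) →
      (T - l • ContinuousLinearMap.id ℂ E).ker = ⊥ ∧
        IsCompl (T - l • ContinuousLinearMap.id ℂ E).range L.ker := by
    rintro l ⟨U, hU⟩
    set A := T - l • ContinuousLinearMap.id ℂ E
    have h1 : ∀ f, (↑U⁻¹ : E →L[ℂ] E) (L (A f)) = f := fun f => by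
      have := congrArg (fun B : E →L[ℂ] E => B f) U.inv_mul
      rw [hU] at this
      exact this
    have h2 : ∀ f, L (A ((↑U⁻¹ : E →L[ℂ] E) f)) = f := fun f => by
      have := congrArg (fun B : E →L[ℂ] E => B f) U.mul_inv
      rw [hU] at this
      exact this
    refine ⟨?_, ?_⟩
    · rw [Submodule.eq_bot_iff]
      intro f hf
      rw [← h1 f, show A f = 0 from hf, map_zero, map_zero]
    · refine IsCompl.of_eq ?_ ?_
      · rw [Submodule.eq_bot_iff]
        rintro _ ⟨⟨f, rfl⟩, hf⟩
        have hf' : L (A f) = 0 := hf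
        have := h1 f
        rw [hf', map_zero] at this
        rw [← this, map_zero]
      · rw [eq_top_iff]
        intro f _
        refine Submodule.mem_sup.2 ⟨A ((↑U⁻¹ : E →L[ℂ] E) (L f)), ⟨_, rfl⟩,
          f - A ((↑U⁻¹ : E →L[ℂ] E) (L f)), ?_, by abel⟩
        change L _ = 0
        rw [map_sub, h2, sub_self]
  have hev : ∀ᶠ l in 𝓝 l₀, IsUnit (L * (T - l • ContinuousLinearMap.id ℂ E)) := by
    have hc : Continuous fun l : ℂ => L * (T - l • ContinuousLinearMap.id ℂ E) := by fun_prop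
    refine hc.continuousAt.eventually_mem (Units.isOpen.mem_nhds ?_)
    change IsUnit _
    rw [hL]
    exact isUnit_one
  have h0 := hcompl l₀ (by rw [hL]; exact isUnit_one)
  have hfd : L.ker.FG := Submodule.CoFG.fg_of_isCompl h0.2 hA.finite_coker
  filter_upwards [hev] with l hl
  have h := hcompl l hl
  refine ⟨isFredholm_of_ker_eq_bot h.1 (Submodule.FG.cofg_of_isCompl h.2.symm hfd), ?_⟩
  exact ((Submodule.quotientEquivOfIsCompl _ _ h.2).trans
    (Submodule.quotientEquivOfIsCompl _ _ h0.2).symm).finrank_eq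

theorem mem_spectrum_iff {T : E →L[ℂ] E} {l : ℂ} :
    l ∈ spectrum ℂ T ↔ ¬ ((T - l • ContinuousLinearMap.id ℂ E).ker = ⊥ ∧
      (T - l • ContinuousLinearMap.id ℂ E).range = ⊤) := by
  rw [spectrum.mem_iff, not_iff_not, ← IsUnit.neg_iff, neg_sub, isUnit_iff_bijective,
    Function.Bijective]
  have : T - (algebraMap ℂ (E →L[ℂ] E)) l = T - l • ContinuousLinearMap.id ℂ E := by
    rw [Algebra.algebraMap_eq_smul_one]; rfl
  rw [this]
  exact and_congr LinearMap.ker_eq_bot.symm LinearMap.range_eq_top.symm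

end Operators

/-! ### Null sets of the torus and rational functions on the disk -/

theorem exists_toCircle_eq {u : ℂ} (hu : ‖u‖ = 1) :
    ∃ t : UnitAddCircle, (AddCircle.toCircle t : ℂ) = u := by
  obtain ⟨t, ht⟩ := (AddCircle.homeomorphCircle (T := 1) one_ne_zero).surjective
    ⟨u, mem_sphere_zero_iff_norm.2 hu⟩
  rw [AddCircle.homeomorphCircle_apply] at ht
  exact ⟨t, by rw [ht]⟩

instance : Nontrivial UnitAddCircle := by
  obtain ⟨s, hs⟩ := exists_toCircle_eq (u := 1) (by simp)
  obtain ⟨t, ht⟩ := exists_toCircle_eq (u := -1) (by simp)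
  refine ⟨s, t, fun h => ?_⟩
  rw [h, ht] at hs
  norm_num at hs

instance : NullSingletonClass (AddCircle.haarAddCircle : Measure UnitAddCircle) := by
  have : (𝓝[≠] (0 : UnitAddCircle)).NeBot :=
    ConnectedSpace.neBot_nhdsWithin_compl_of_nontrivial_of_t1space 0
  infer_instance

/-- Positivity on open sets upgrades almost everywhere identities between continuous functions on
the torus to identities everywhere. -/
instance : torusMeasure.IsOpenPosMeasure := by unfold torusMeasure; infer_instance

/-- Invariance is what allows torus means to be averaged over diagonal rotations. -/
instance : torusMeasure.IsAddRightInvariant := by unfold torusMeasure; infer_instance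

section Polynomials

open Polynomial

theorem ae_eval_toCircle_ne_zero {P : ℂ[X]} (hP : P ≠ 0) :
    ∀ᵐ t ∂(AddCircle.haarAddCircle : Measure UnitAddCircle),
      P.eval (AddCircle.toCircle t : ℂ) ≠ 0 := by
  have hinj : Function.Injective fun t : UnitAddCircle => (AddCircle.toCircle t : ℂ) :=
    Subtype.val_injective.comp (AddCircle.injective_toCircle one_ne_zero)
  have hfin : {t : UnitAddCircle | P.eval (AddCircle.toCircle t : ℂ) = 0}.Finite :=
    (P.rootSet_finite ℂ).preimage hinj.injOn |>.subset fun t ht => by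
      simpa [mem_rootSet, hP] using ht
  simpa [ae_iff] using hfin.measure_zero _

theorem differentiable_evalEval (p : ℂ[X][X]) :
    Differentiable ℂ fun x : ℂ × ℂ => p.evalEval x.1 x.2 := by
  have : (fun x : ℂ × ℂ => p.evalEval x.1 x.2) =
      fun x => ∑ n ∈ p.support, (p.coeff n).eval x.1 * x.2 ^ n := by
    ext x
    rw [← eval₂_evalRingHom, eval₂_eq_sum, Polynomial.sum]
    rfl
  rw [this]
  refine Differentiable.fun_sum fun n _ => ?_
  exact ((p.coeff n).differentiable.comp differentiable_fst).mul (differentiable_snd.pow n)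

theorem continuous_evalEval (p : ℂ[X][X]) : Continuous fun x : ℂ × ℂ => p.evalEval x.1 x.2 :=
  (differentiable_evalEval p).continuous

theorem continuous_evalEval_toCircle (p : ℂ[X][X]) :
    Continuous fun t : UnitAddCircle × UnitAddCircle =>
      p.evalEval (AddCircle.toCircle t.1 : ℂ) (AddCircle.toCircle t.2 : ℂ) :=
  (continuous_evalEval p).comp (f := fun t : UnitAddCircle × UnitAddCircle =>
    ((AddCircle.toCircle t.1 : ℂ), (AddCircle.toCircle t.2 : ℂ))) (by fun_prop)

/-- By Fubini: for almost every `s` the leading coefficient of `p` in `w` is nonzero there, so the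
polynomial in `w` is nonzero and has finitely many zeros. -/
theorem ae_evalEval_ne_zero {p : ℂ[X][X]} (hp : p ≠ 0) :
    ∀ᵐ t ∂torusMeasure,
      p.evalEval (AddCircle.toCircle t.1 : ℂ) (AddCircle.toCircle t.2 : ℂ) ≠ 0 := by
  have hm : MeasurableSet {t : UnitAddCircle × UnitAddCircle |
      p.evalEval (AddCircle.toCircle t.1 : ℂ) (AddCircle.toCircle t.2 : ℂ) ≠ 0} :=
    (isOpen_ne_fun (continuous_evalEval_toCircle p) continuous_const).measurableSet
  refine (Measure.ae_prod_mem_iff_ae_ae_mem hm).2 ?_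
  filter_upwards [ae_eval_toCircle_ne_zero (leadingCoeff_ne_zero.2 hp)] with s hs
  have hs' : p.map (evalRingHom (AddCircle.toCircle s : ℂ)) ≠ 0 := by
    intro h
    have := congrArg (fun r : ℂ[X] => r.coeff p.natDegree) h
    simp only [coeff_map, coeff_zero, coeff_natDegree] at this
    exact hs this
  filter_upwards [ae_eval_toCircle_ne_zero hs'] with t ht
  rw [map_evalRingHom_eval] at ht
  exact ht

/-- The restriction of `p` to the slice `{(a x, b x)}`. -/
def slicePoly (a b : ℂ) : ℂ[X][X] →+* ℂ[X] :=
  eval₂RingHom (compRingHom (C a * X)) (C b * X)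

theorem eval_slicePoly (a b x : ℂ) (p : ℂ[X][X]) :
    (slicePoly a b p).eval x = p.evalEval (a * x) (b * x) := by
  have : (evalRingHom x).comp (slicePoly a b) = evalEvalRingHom (a * x) (b * x) := by
    ext <;> simp [slicePoly]
  exact congrArg (fun f : ℂ[X][X] →+* ℂ => f p) this

theorem exists_isCoprime_factorization {P : ℂ[X]} (Q : ℂ[X]) (hP : P ≠ 0) :
    ∃ D P₁ Q₁ : ℂ[X], P = D * P₁ ∧ Q = D * Q₁ ∧ D ≠ 0 ∧ IsCoprime P₁ Q₁ := by
  classical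
  obtain ⟨P₁, h1⟩ := EuclideanDomain.gcd_dvd_left P Q
  obtain ⟨Q₁, h2⟩ := EuclideanDomain.gcd_dvd_right P Q
  have hD : EuclideanDomain.gcd P Q ≠ 0 := fun h => hP (by rw [h1, h, zero_mul])
  refine ⟨_, P₁, Q₁, h1, h2, hD, EuclideanDomain.gcdA P Q, EuclideanDomain.gcdB P Q, ?_⟩
  have := EuclideanDomain.gcd_eq_gcd_ab P Q
  refine mul_left_cancel₀ hD ?_
  linear_combination -(EuclideanDomain.gcdA P Q) * h1 - EuclideanDomain.gcdB P Q * h2 - this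

/-- A rational function on the disk, the numerator and denominator of which have the same modulus on
the unit circle, extends continuously to the closed disk with unimodular boundary values. -/
theorem exists_continuousOn_extension {P Q : ℂ[X]} (hP : P ≠ 0) {g : ℂ → ℂ}
    (hg : ContinuousOn g (Metric.ball 0 1))
    (h : ∀ x ∈ Metric.ball (0 : ℂ) 1, g x * P.eval x = Q.eval x)
    (hPQ : ∀ u : ℂ, ‖u‖ = 1 → ‖P.eval u‖ = ‖Q.eval u‖) :
    ∃ G : ℂ → ℂ, DiffContOnCl ℂ G (Metric.ball 0 1) ∧ (∀ x ∈ Metric.ball (0 : ℂ) 1, G x = g x) ∧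
      ∀ u : ℂ, ‖u‖ = 1 → ‖G u‖ = 1 := by
  -- After division by the common divisor the hypotheses persist by continuity. A zero of `P₁` in
  -- the closed disk would then be a zero of `Q₁`, against coprimality, so `Q₁ / P₁` is the
  -- extension.
  obtain ⟨D, P₁, Q₁, rfl, rfl, hD, hco⟩ := exists_isCoprime_factorization Q hP
  have h1 : ∀ x ∈ Metric.ball (0 : ℂ) 1, g x * P₁.eval x = Q₁.eval x := by
    intro x hx
    have hne : ∀ᶠ y in 𝓝[≠] x, D.eval y ≠ 0 := by
      have := D.differentiable.analyticAt x
      rcases this.eventually_eq_zero_or_eventually_ne_zero with h' | h'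
      · exfalso
        refine hD (D.eq_zero_of_infinite_isRoot (infinite_of_mem_nhds x h'))
      · exact h'
    have hev : ∀ᶠ y in 𝓝[≠] x, g y * P₁.eval y = Q₁.eval y := by
      filter_upwards [hne, nhdsWithin_le_nhds (Metric.isOpen_ball.mem_nhds hx)] with y hy hy'
      have := h y hy'
      rw [eval_mul, eval_mul] at this
      exact mul_left_cancel₀ hy (by linear_combination this)
    have hc : ContinuousAt (fun y => g y * P₁.eval y) x :=
      (hg.continuousAt (Metric.isOpen_ball.mem_nhds hx)).mul P₁.continuous.continuousAt
    exact tendsto_nhds_unique_of_eventuallyEq (hc.tendsto.mono_left nhdsWithin_le_nhds)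
      (Q₁.continuous.continuousAt.tendsto.mono_left nhdsWithin_le_nhds) hev
  have h2 : ∀ u : ℂ, ‖u‖ = 1 → ‖P₁.eval u‖ = ‖Q₁.eval u‖ := by
    have hc : ∀ R : ℂ[X], Continuous fun t : UnitAddCircle => ‖R.eval (AddCircle.toCircle t : ℂ)‖ :=
      fun R => (R.continuous.comp (Continuous.subtype_val AddCircle.continuous_toCircle)).norm
    have := (Continuous.ae_eq_iff_eq AddCircle.haarAddCircle (hc P₁) (hc Q₁)).1 (by
      filter_upwards [ae_eval_toCircle_ne_zero hD] with t ht
      have := hPQ (AddCircle.toCircle t : ℂ) (Circle.norm_coe _)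
      rw [eval_mul, eval_mul, norm_mul, norm_mul] at this
      exact mul_left_cancel₀ (norm_ne_zero_iff.2 ht) this)
    intro u hu
    obtain ⟨t, rfl⟩ := exists_toCircle_eq hu
    exact congrFun this t
  have hno : ∀ x ∈ Metric.closedBall (0 : ℂ) 1, P₁.eval x ≠ 0 := by
    intro x hx h0
    have hq : Q₁.eval x = 0 := by
      rcases (mem_closedBall_zero_iff.1 hx).lt_or_eq with h' | h'
      · rw [← h1 x (mem_ball_zero_iff.2 h'), h0, mul_zero]
      · rw [← norm_eq_zero, ← h2 x h', h0, norm_zero]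
    obtain ⟨a, b, hab⟩ := hco
    have := congrArg (eval x) hab
    simp [h0, hq] at this
  refine ⟨fun x => Q₁.eval x / P₁.eval x, ?_, fun x hx => ?_, fun u hu => ?_⟩
  · refine ⟨fun x hx => ?_, ?_⟩
    · exact (Q₁.differentiable.differentiableAt.div P₁.differentiable.differentiableAt
        (hno x (Metric.ball_subset_closedBall hx))).differentiableWithinAt
    · rw [closure_ball _ one_ne_zero]
      exact Q₁.continuous.continuousOn.div P₁.continuous.continuousOn hno
  · rw [div_eq_iff (hno x (Metric.ball_subset_closedBall hx)), h1 x hx]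
  · rw [norm_div, h2 u hu, div_self]
    rw [← h2 u hu]
    exact norm_ne_zero_iff.2 (hno u (mem_closedBall_zero_iff.2 hu.le))

/-- Boundary behaviour of a rational function as in `exists_continuousOn_extension`. -/
theorem norm_le_one_and_tendsto_one {P Q : ℂ[X]} (hP : P ≠ 0) {g : ℂ → ℂ}
    (hg : ContinuousOn g (Metric.ball 0 1))
    (h : ∀ x ∈ Metric.ball (0 : ℂ) 1, g x * P.eval x = Q.eval x)
    (hPQ : ∀ u : ℂ, ‖u‖ = 1 → ‖P.eval u‖ = ‖Q.eval u‖) :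
    (∀ x ∈ Metric.ball (0 : ℂ) 1, ‖g x‖ ≤ 1) ∧
      ∀ ε > 0, ∃ ρ < 1, ∀ x : ℂ, ρ < ‖x‖ → ‖x‖ < 1 → 1 - ε ≤ ‖g x‖ := by
  obtain ⟨G, hG, hGg, hG1⟩ := exists_continuousOn_extension hP hg h hPQ
  refine ⟨fun x hx => ?_, fun ε hε => ?_⟩
  · rw [← hGg x hx]
    refine Complex.norm_le_of_forall_mem_frontier_norm_le Metric.isBounded_ball hG
      (fun u hu => ?_) (subset_closure hx)
    rw [frontier_ball _ one_ne_zero, mem_sphere_zero_iff_norm] at hu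
    exact (hG1 u hu).le
  · have hu := (isCompact_closedBall (0 : ℂ) 1).uniformContinuousOn_of_continuous
      (by simpa [closure_ball] using hG.continuousOn)
    rw [Metric.uniformContinuousOn_iff] at hu
    obtain ⟨δ, hδ, hδ'⟩ := hu ε hε
    -- The maximum with `0` keeps `x` away from the origin, so that its radial projection `u = x /
    -- |x|` exists; uniform continuity compares `x` with `u`.
    refine ⟨max (1 - δ) 0, by simp [hδ], fun x hx hx1 => ?_⟩
    have hx0 : 0 < ‖x‖ := (le_max_right _ _).trans_lt hx
    have hxδ : 1 - δ < ‖x‖ := (le_max_left _ _).trans_lt hx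
    set u : ℂ := x / (‖x‖ : ℂ) with hu
    have hu1 : ‖u‖ = 1 := by simp [hu, hx0.ne']
    have hdist : dist x u < δ := by
      have : x - u = u * ((‖x‖ : ℂ) - 1) := by
        rw [hu]
        have : (‖x‖ : ℂ) ≠ 0 := by exact_mod_cast hx0.ne'
        field_simp
      rw [dist_eq_norm, this, norm_mul, hu1, one_mul]
      have : ((‖x‖ : ℂ) - 1) = ((‖x‖ - 1 : ℝ) : ℂ) := by push_cast; rfl
      rw [this, Complex.norm_real, Real.norm_eq_abs, abs_lt]
      constructor <;> linarith
    have := hδ' x (mem_closedBall_zero_iff.2 hx1.le) u (mem_closedBall_zero_iff.2 hu1.le) hdist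
    rw [hGg x (mem_ball_zero_iff.2 hx1), dist_eq_norm] at this
    have h3 := norm_sub_norm_le (G u) (g x)
    rw [hG1 u hu1, norm_sub_rev] at h3
    linarith

end Polynomials

/-! ### Rational inner functions: multiplication and division by `θ` -/

section RationalInner

open Polynomial

/-- `θ = q / p` on the bidisk, `p` and `q` have no common factor `w - c` with `|c| = 1`, and they
have the same modulus on `𝕋²`. -/
structure IsInnerQuotient (θ : HardySpace) (p q : ℂ[X][X]) : Prop where
  ne_zero : p ≠ 0
  mul_eq : ∀ x ∈ bidisk, θ x * p.evalEval x.1 x.2 = q.evalEval x.1 x.2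
  norm_eq : ∀ u v : ℂ, ‖u‖ = 1 → ‖v‖ = 1 → ‖p.evalEval u v‖ = ‖q.evalEval u v‖
  eval_ne_zero : ∀ c : ℂ, ‖c‖ = 1 → q.eval (C c) ≠ 0

theorem exists_bivariate (p : MvPolynomial (Fin 2) ℂ) :
    ∃ P : ℂ[X][X], (p ≠ 0 → P ≠ 0) ∧ ∀ x y, P.evalEval x y = MvPolynomial.eval ![x, y] p := by
  let P : ℂ[X][X] := MvPolynomial.eval₂Hom (C.comp C) ![C X, X] p
  have hP : ∀ x y, P.evalEval x y = MvPolynomial.eval ![x, y] p := by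
    intro x y
    have : (evalEvalRingHom x y).comp (MvPolynomial.eval₂Hom (C.comp C) ![C X, X]) =
        MvPolynomial.eval ![x, y] := by
      ext i
      · simp
      · fin_cases i <;> simp
    exact congrArg (fun f : MvPolynomial (Fin 2) ℂ →+* ℂ => f p) this
  refine ⟨P, fun hp h0 => hp (MvPolynomial.funext fun x => ?_), hP⟩
  have := hP (x 0) (x 1)
  rw [h0, evalEval_zero] at this
  rw [map_zero, show x = ![x 0, x 1] by ext i; fin_cases i <;> rfl, ← this]

/-- A factor `w - c` with `|c| = 1` has no zero in the bidisk, so common ones can be cancelled until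
the degree of `p` stops the process. -/
theorem exists_quotient_without_common_factor {θ : HardySpace} {p q : ℂ[X][X]} (hp : p ≠ 0)
    (h : ∀ x ∈ bidisk, θ x * p.evalEval x.1 x.2 = q.evalEval x.1 x.2) :
    ∃ p' q' : ℂ[X][X], p' ≠ 0 ∧
      (∀ x ∈ bidisk, θ x * p'.evalEval x.1 x.2 = q'.evalEval x.1 x.2) ∧
      ∀ c : ℂ, ‖c‖ = 1 → p'.eval (C c) = 0 → q'.eval (C c) ≠ 0 := by
  induction hn : p.natDegree using Nat.strong_induction_on generalizing p q with
  | _ n ih =>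
    by_cases hc : ∀ c : ℂ, ‖c‖ = 1 → p.eval (C c) = 0 → q.eval (C c) ≠ 0
    · exact ⟨p, q, hp, h, hc⟩
    push Not at hc
    obtain ⟨c, hc1, hpc, hqc⟩ := hc
    obtain ⟨p₁, rfl⟩ := dvd_iff_isRoot.2 hpc
    obtain ⟨q₁, rfl⟩ := dvd_iff_isRoot.2 hqc
    have hp₁ : p₁ ≠ 0 := right_ne_zero_of_mul hp
    refine ih p₁.natDegree ?_ hp₁ (q := q₁) (fun x hx => ?_) rfl
    · rw [← hn, natDegree_mul (X_sub_C_ne_zero _) hp₁, natDegree_X_sub_C]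
      omega
    · have h' := h x hx
      rw [evalEval_mul, evalEval_mul] at h'
      have h0 : (X - C (C c) : ℂ[X][X]).evalEval x.1 x.2 ≠ 0 := by
        intro h0
        have : x.2 = c := by simpa [evalEval, sub_eq_zero] using h0
        have := (mem_bidisk.1 hx).2
        simp_all
      exact mul_left_cancel₀ h0 (by linear_combination h')

theorem tendsto_torusPoint (t : UnitAddCircle × UnitAddCircle) :
    Tendsto (fun r : ℝ => torusPoint r r t) (𝓝[<] 1)
      (𝓝 ((AddCircle.toCircle t.1 : ℂ), (AddCircle.toCircle t.2 : ℂ))) := by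
  have hc : Continuous fun r : ℝ => torusPoint r r t := by
    unfold torusPoint; fun_prop
  have := (hc.tendsto 1).mono_left (nhdsWithin_le_nhds (s := Iio 1))
  simpa [torusPoint] using this

/-- Radial limits in `θ p = q` give equal moduli almost everywhere on the torus, and both moduli are
continuous. -/
theorem norm_evalEval_eq {θ : HardySpace} (hθ : IsInner θ) {p q : ℂ[X][X]}
    (h : ∀ x ∈ bidisk, θ x * p.evalEval x.1 x.2 = q.evalEval x.1 x.2) {u v : ℂ} (hu : ‖u‖ = 1)
    (hv : ‖v‖ = 1) : ‖p.evalEval u v‖ = ‖q.evalEval u v‖ := by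
  have key := (Continuous.ae_eq_iff_eq torusMeasure (continuous_evalEval_toCircle p).norm
    (continuous_evalEval_toCircle q).norm).1 (by
      filter_upwards [hθ] with t ht
      obtain ⟨c, hc, hlim⟩ := ht
      have hp := ((continuous_evalEval p).tendsto _).comp (tendsto_torusPoint t)
      have hq := ((continuous_evalEval q).tendsto _).comp (tendsto_torusPoint t)
      have := tendsto_nhds_unique_of_eventuallyEq (hlim.mul hp) hq (by
        filter_upwards [Ico_mem_nhdsLT (zero_lt_one (α := ℝ))] with r hr
        exact h _ (torusPoint_mem hr hr t))
      rw [← this, norm_mul, hc, one_mul])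
  obtain ⟨s, rfl⟩ := exists_toCircle_eq hu
  obtain ⟨t, rfl⟩ := exists_toCircle_eq hv
  exact congrFun key (s, t)

theorem exists_isInnerQuotient {θ : HardySpace} (hθ : IsInner θ) (hr : IsRational θ) :
    ∃ p q, IsInnerQuotient θ p q := by
  obtain ⟨p₀, q₀, hp₀, h₀⟩ := hr
  obtain ⟨p₁, hp₁, he₁⟩ := exists_bivariate p₀
  obtain ⟨q₁, -, he₂⟩ := exists_bivariate q₀
  obtain ⟨p, q, hp, h, hc⟩ := exists_quotient_without_common_factor (q := q₁) (hp₁ hp₀)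
    (fun x hx => by rw [he₁, he₂]; exact h₀ x hx)
  have hn : ∀ u v : ℂ, ‖u‖ = 1 → ‖v‖ = 1 → ‖p.evalEval u v‖ = ‖q.evalEval u v‖ :=
    fun u v hu hv => norm_evalEval_eq hθ h hu hv
  refine ⟨p, q, hp, h, hn, fun c hc1 h0 => hc c hc1 ?_ h0⟩
  -- If `q(·, c) = 0`, equality of moduli forces `p(·, c)` to vanish on the whole circle, so `w - c`
  -- would be a common factor.
  by_contra hne
  obtain ⟨t, ht⟩ := (ae_eval_toCircle_ne_zero hne).exists
  refine ht (norm_eq_zero.1 ((hn _ c (Circle.norm_coe _) hc1).trans ?_))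
  change ‖(q.eval (C c)).eval _‖ = 0
  simp [h0]

/-- The point `(x e^{2πi s}, x e^{2πi t})` of a diagonal slice. -/
def slicePoint (t : UnitAddCircle × UnitAddCircle) (x : ℂ) : ℂ × ℂ :=
  ((AddCircle.toCircle t.1 : ℂ) * x, (AddCircle.toCircle t.2 : ℂ) * x)

theorem slicePoint_mem (t : UnitAddCircle × UnitAddCircle) {x : ℂ}
    (hx : x ∈ Metric.ball (0 : ℂ) 1) : slicePoint t x ∈ bidisk := by
  rw [mem_bidisk]
  simpa [slicePoint, Circle.norm_coe] using hx

/-- Circles in diagonal slices are orbits of the diagonal rotations of the torus of equal radii;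
this links slice means with torus means. -/
theorem slicePoint_eq_torusPoint (t : UnitAddCircle × UnitAddCircle) (r : ℝ) (s : UnitAddCircle) :
    slicePoint t (r * (AddCircle.toCircle s : ℂ)) = torusPoint r r (t + (s, s)) := by
  simp only [slicePoint, torusPoint, Prod.fst_add, Prod.snd_add, AddCircle.toCircle_add,
    Circle.coe_mul]
  ext <;> simp only <;> ring

theorem differentiableOn_slice {f : ℂ × ℂ → ℂ} (hf : DifferentiableOn ℂ f bidisk)
    (t : UnitAddCircle × UnitAddCircle) :
    DifferentiableOn ℂ (fun x => f (slicePoint t x)) (Metric.ball 0 1) :=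
  hf.comp (by unfold slicePoint; fun_prop) fun _ hx => slicePoint_mem t hx

variable {θ : HardySpace} {p q : ℂ[X][X]}

/-- For almost every slice the restriction of `p` is not the zero polynomial. There `θ` is a
one-variable rational function of modulus one on the circle, so its modulus tends to one uniformly
at the boundary. -/
theorem IsInnerQuotient.ae_slice (h : IsInnerQuotient θ p q) :
    ∀ᵐ t ∂torusMeasure, (∀ x ∈ Metric.ball (0 : ℂ) 1, ‖θ (slicePoint t x)‖ ≤ 1) ∧
      ∀ ε > 0, ∃ ρ < 1, ∀ x : ℂ, ρ < ‖x‖ → ‖x‖ < 1 → 1 - ε ≤ ‖θ (slicePoint t x)‖ := by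
  filter_upwards [ae_evalEval_ne_zero h.ne_zero] with t ht
  refine norm_le_one_and_tendsto_one (P := slicePoly (AddCircle.toCircle t.1)
    (AddCircle.toCircle t.2) p) (Q := slicePoly (AddCircle.toCircle t.1) (AddCircle.toCircle t.2) q)
    (fun h0 => ht ?_) (differentiableOn_slice θ.differentiableOn t).continuousOn (fun x hx => ?_)
    (fun u hu => ?_)
  · have := eval_slicePoly (AddCircle.toCircle t.1) (AddCircle.toCircle t.2) 1 p
    rw [h0, eval_zero, mul_one, mul_one] at this
    exact this.symm
  · rw [eval_slicePoly, eval_slicePoly]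
    exact h.mul_eq _ (slicePoint_mem t hx)
  · rw [eval_slicePoly, eval_slicePoly]
    exact h.norm_eq _ _ (by rw [norm_mul, Circle.norm_coe, hu, mul_one])
      (by rw [norm_mul, Circle.norm_coe, hu, mul_one])

/-- The bound holds on almost every slice, hence on a dense subset of the torus, and it is a closed
condition. -/
theorem IsInnerQuotient.norm_le_one (h : IsInnerQuotient θ p q) {r : ℝ} (hr : r ∈ Ico (0 : ℝ) 1)
    (t : UnitAddCircle × UnitAddCircle) : ‖θ (torusPoint r r t)‖ ≤ 1 := by
  have hc := (continuous_comp_torusPoint θ.differentiableOn hr hr).norm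
  have hd : Dense {t | ‖θ (torusPoint r r t)‖ ≤ 1} := by
    refine Measure.dense_of_ae (μ := torusMeasure) ?_
    filter_upwards [h.ae_slice] with t ht
    have := ht.1 r (by simpa [abs_of_nonneg hr.1] using hr.2)
    have e := slicePoint_eq_torusPoint t r 0
    simp only [AddCircle.toCircle_zero, Circle.coe_one, mul_one] at e
    rw [e, show ((0 : UnitAddCircle), (0 : UnitAddCircle)) = 0 from rfl, add_zero] at this
    exact this
  have hcl : IsClosed {t | ‖θ (torusPoint r r t)‖ ≤ 1} := isClosed_le hc continuous_const
  have := hd.closure_eq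
  rw [hcl.closure_eq] at this
  exact (this ▸ mem_univ t : t ∈ {t | ‖θ (torusPoint r r t)‖ ≤ 1})

theorem IsInnerQuotient.exists_mul (h : IsInnerQuotient θ p q) (f : HardySpace) :
    ∃ g : HardySpace, (∀ x ∈ bidisk, g x = θ x * f x) ∧ ‖g‖ ≤ ‖f‖ := by
  simpa using HardySpace.exists_mul θ.differentiableOn zero_le_one
    (fun r hr t => h.norm_le_one hr t) f

theorem IsInnerQuotient.norm_le (h : IsInnerQuotient θ p q) : ‖θ‖ ≤ 1 := by
  refine HardySpace.norm_le_of_torusMean_le zero_le_one fun r hr => ?_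
  calc torusMean θ r ≤ ∫ _, (1 : ℝ) ∂torusMeasure := by
        refine integral_mono (integrable_of_continuous
          ((continuous_comp_torusPoint θ.differentiableOn hr hr).norm.pow 2))
          (integrable_const _) fun t => ?_
        exact pow_le_one₀ (norm_nonneg _) (h.norm_le_one hr t)
    _ = 1 ^ 2 := by simp

/-- The mean of `|f|²` over the circle of radius `r` of a slice. -/
def sliceMean (f : ℂ × ℂ → ℂ) (r : ℝ) (t : UnitAddCircle × UnitAddCircle) : ENNReal :=
  ∫⁻ s : UnitAddCircle, ‖f (slicePoint t (r * (AddCircle.toCircle s : ℂ)))‖ₑ ^ 2 ∂AddCircle.haarAddCircle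

theorem mul_toCircle_mem_ball {r : ℝ} (hr : r ∈ Ico (0 : ℝ) 1) (s : UnitAddCircle) :
    (r : ℂ) * (AddCircle.toCircle s : ℂ) ∈ Metric.ball (0 : ℂ) 1 := by
  simpa [Circle.norm_coe, abs_of_nonneg hr.1] using hr.2

theorem continuous_slice {f : ℂ × ℂ → ℂ} (hf : DifferentiableOn ℂ f bidisk) {r : ℝ}
    (hr : r ∈ Ico (0 : ℝ) 1) : Continuous fun x : (UnitAddCircle × UnitAddCircle) × UnitAddCircle =>
      f (slicePoint x.1 (r * (AddCircle.toCircle x.2 : ℂ))) := by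
  simp_rw [slicePoint_eq_torusPoint]
  exact (continuous_comp_torusPoint hf hr hr).comp (by fun_prop)

theorem measurable_sliceMean {f : ℂ × ℂ → ℂ} (hf : DifferentiableOn ℂ f bidisk) {r : ℝ}
    (hr : r ∈ Ico (0 : ℝ) 1) : Measurable (sliceMean f r) :=
  Measurable.lintegral_prod_right' (((continuous_slice hf hr).measurable.enorm).pow_const 2)

theorem ofReal_sq_norm (z : ℂ) : ENNReal.ofReal (‖z‖ ^ 2) = ‖z‖ₑ ^ 2 := by
  rw [ENNReal.ofReal_pow (norm_nonneg _), ofReal_norm]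

theorem ofReal_integral_sq_norm {X : Type*} [MeasurableSpace X] {μ : Measure X} {g : X → ℂ}
    (hg : Integrable (fun x => ‖g x‖ ^ 2) μ) :
    ENNReal.ofReal (∫ x, ‖g x‖ ^ 2 ∂μ) = ∫⁻ x, ‖g x‖ₑ ^ 2 ∂μ := by
  rw [ofReal_integral_eq_lintegral_ofReal hg (ae_of_all _ fun _ => by positivity)]
  simp_rw [ofReal_sq_norm]

/-- By Tonelli and rotation invariance, averaging the slice means counts each torus point with the
right weight. -/
theorem ofReal_torusMean {f : ℂ × ℂ → ℂ} (hf : DifferentiableOn ℂ f bidisk) {r : ℝ}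
    (hr : r ∈ Ico (0 : ℝ) 1) :
    ENNReal.ofReal (torusMean f r) = ∫⁻ t, sliceMean f r t ∂torusMeasure := by
  have hc := continuous_comp_torusPoint hf hr hr
  unfold torusMean sliceMean
  rw [ofReal_integral_sq_norm (integrable_of_continuous (hc.norm.pow 2)), lintegral_lintegral_swap
    (((continuous_slice hf hr).measurable.enorm).pow_const 2).aemeasurable]
  simp_rw [slicePoint_eq_torusPoint]
  have : ∀ s : UnitAddCircle,
      ∫⁻ t, ‖f (torusPoint r r (t + (s, s)))‖ₑ ^ 2 ∂torusMeasure =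
        ∫⁻ t, ‖f (torusPoint r r t)‖ₑ ^ 2 ∂torusMeasure := fun s =>
    lintegral_add_right_eq_self (fun t => ‖f (torusPoint r r t)‖ₑ ^ 2) (s, s)
  simp_rw [this]
  simp

/-- Regarding `g` as a function of two variables, Parseval writes each mean as a sum of terms
increasing in the radius. -/
theorem lintegral_circle_mono {g : ℂ → ℂ} (hg : DifferentiableOn ℂ g (Metric.ball 0 1)) {r ρ : ℝ}
    (hr : r ∈ Ico (0 : ℝ) 1) (hρ : ρ ∈ Ico (0 : ℝ) 1) (h : r ≤ ρ) :
    ∫⁻ s : UnitAddCircle, ‖g (r * (AddCircle.toCircle s : ℂ))‖ₑ ^ 2 ∂AddCircle.haarAddCircle ≤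
      ∫⁻ s : UnitAddCircle, ‖g (ρ * (AddCircle.toCircle s : ℂ))‖ₑ ^ 2
        ∂AddCircle.haarAddCircle := by
  have hd : DifferentiableOn ℂ (fun x : ℂ × ℂ => g x.1) bidisk :=
    hg.comp differentiableOn_fst fun x hx => by simpa using (mem_bidisk.1 hx).1
  have hm : ∀ a ∈ Ico (0 : ℝ) 1,
      ∫⁻ s : UnitAddCircle, ‖g (a * (AddCircle.toCircle s : ℂ))‖ₑ ^ 2 ∂AddCircle.haarAddCircle =
        ENNReal.ofReal (∫ t, ‖g (torusPoint a a t).1‖ ^ 2 ∂torusMeasure) := by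
    intro a ha
    have hc : Continuous fun s : UnitAddCircle => g (a * (AddCircle.toCircle s : ℂ)) :=
      hg.continuousOn.comp_continuous (by fun_prop) (mul_toCircle_mem_ball ha)
    have := integral_fun_fst (μ := (AddCircle.haarAddCircle : Measure UnitAddCircle))
      (ν := (AddCircle.haarAddCircle : Measure UnitAddCircle))
      (fun s : UnitAddCircle => ‖g (a * (AddCircle.toCircle s : ℂ))‖ ^ 2)
    simp only [probReal_univ, one_smul] at this
    simp only [torusPoint, torusMeasure]
    rw [this, ofReal_integral_sq_norm
      ((hc.norm.pow 2).integrable_of_hasCompactSupport (HasCompactSupport.of_compactSpace _))]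
  rw [hm r hr, hm ρ hρ]
  refine ENNReal.ofReal_le_ofReal
    (hasSum_le (fun k => ?_) (hasSum_sq_torus hd hr hr) (hasSum_sq_torus hd hρ hρ))
  simp only [norm_mul, norm_pow, Complex.norm_real, Real.norm_eq_abs, abs_of_nonneg hr.1,
    abs_of_nonneg hρ.1]
  have := hr.1
  have := hρ.1
  gcongr

theorem sliceMean_mono {f : ℂ × ℂ → ℂ} (hf : DifferentiableOn ℂ f bidisk) {r ρ : ℝ}
    (hr : r ∈ Ico (0 : ℝ) 1) (hρ : ρ ∈ Ico (0 : ℝ) 1) (h : r ≤ ρ)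
    (t : UnitAddCircle × UnitAddCircle) : sliceMean f r t ≤ sliceMean f ρ t :=
  lintegral_circle_mono (differentiableOn_slice hf t) hr hρ h

theorem le_liminf_of_forall_mul_le {a : ENNReal} {u : ℕ → ENNReal}
    (h : ∀ c : NNReal, c < 1 → ∀ᶠ n in atTop, (c : ENNReal) * a ≤ u n) : a ≤ liminf u atTop := by
  refine ENNReal.le_of_forall_lt_one_mul_le fun c hc => ?_
  lift c to NNReal using hc.ne_top
  exact le_liminf_of_le (by isBoundedDefault) (h c (by exact_mod_cast hc))

/-- For `c < 1`, near the boundary of almost every slice `|θ|² ≥ c`, so `c |g|² ≤ |f|²` on circles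
of large radius; the means of `|g|²` increase with the radius. -/
theorem IsInnerQuotient.sliceMean_le (h : IsInnerQuotient θ p q) {f g : ℂ × ℂ → ℂ}
    (hg : DifferentiableOn ℂ g bidisk) (hfg : ∀ x ∈ bidisk, f x = θ x * g x) {r : ℝ}
    (hr : r ∈ Ico (0 : ℝ) 1) {u : ℕ → ℝ} (hu : ∀ n, u n ∈ Ico (0 : ℝ) 1)
    (hlim : Tendsto u atTop (𝓝 1)) :
    ∀ᵐ t ∂torusMeasure, sliceMean g r t ≤ liminf (fun n => sliceMean f (u n) t) atTop := by
  filter_upwards [h.ae_slice] with t ht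
  refine le_liminf_of_forall_mul_le fun c hc => ?_
  obtain ⟨d, hd, hd1⟩ : ∃ d : NNReal, c ≤ d ^ 2 ∧ d < 1 :=
    ⟨NNReal.sqrt c, by rw [NNReal.sq_sqrt], by
      rw [← NNReal.sqrt_one]; exact NNReal.sqrt_lt_sqrt.2 hc⟩
  obtain ⟨ρ, hρ, hρ'⟩ := ht.2 (1 - d) (by simpa using hd1)
  filter_upwards [hlim.eventually (lt_mem_nhds hρ), hlim.eventually (lt_mem_nhds hr.2)]
    with n hn hn'
  calc (c : ENNReal) * sliceMean g r t ≤ (c : ENNReal) * sliceMean g (u n) t := by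
        gcongr
        exact sliceMean_mono hg hr (hu n) hn'.le t
    _ = ∫⁻ s : UnitAddCircle, (c : ENNReal) *
          ‖g (slicePoint t ((u n : ℂ) * (AddCircle.toCircle s : ℂ)))‖ₑ ^ 2
            ∂AddCircle.haarAddCircle := (lintegral_const_mul' _ _ (by simp)).symm
    _ ≤ sliceMean f (u n) t := by
        refine lintegral_mono fun s => ?_
        have hx := mul_toCircle_mem_ball (hu n) s
        have hnx : ‖(u n : ℂ) * (AddCircle.toCircle s : ℂ)‖ = u n := by
          simp [Circle.norm_coe, abs_of_nonneg (hu n).1]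
        have hθ := hρ' _ (hn.trans_eq hnx.symm) (mem_ball_zero_iff.1 hx)
        rw [sub_sub_cancel] at hθ
        have hθ' : (d : ENNReal) ≤ ‖θ (slicePoint t ((u n : ℂ) * (AddCircle.toCircle s : ℂ)))‖ₑ := by
          rw [enorm_eq_nnnorm, ENNReal.coe_le_coe]
          exact hθ
        rw [hfg _ (slicePoint_mem t hx), enorm_mul, mul_pow]
        gcongr
        calc (c : ENNReal) ≤ (d : ENNReal) ^ 2 := by exact_mod_cast hd
          _ ≤ _ := by gcongr

/-- Division by `θ` does not increase the norm of `H²(𝔻²)`. -/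
theorem IsInnerQuotient.exists_div (h : IsInnerQuotient θ p q) (f : HardySpace) {g : ℂ × ℂ → ℂ}
    (hg : DifferentiableOn ℂ g bidisk) (hfg : ∀ x ∈ bidisk, f x = θ x * g x) :
    ∃ k : HardySpace, (∀ x ∈ bidisk, k x = g x) ∧ ‖k‖ ≤ ‖f‖ := by
  refine HardySpace.exists_of_torusMean_le hg (norm_nonneg f) fun r hr => ?_
  -- A sequence of radii tending to `1`, since Fatou's lemma is applied along sequences. The
  -- threshold radius depends on the slice, so no single radius serves for all of them.
  let u : ℕ → ℝ := fun n => 1 - 1 / ((n : ℝ) + 1)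
  have hu : ∀ n, u n ∈ Ico (0 : ℝ) 1 := by
    intro n
    have h1 : 0 < 1 / ((n : ℝ) + 1) := by positivity
    have h2 : 1 / ((n : ℝ) + 1) ≤ 1 := by
      rw [div_le_one (by positivity)]
      linarith [n.cast_nonneg (α := ℝ)]
    exact ⟨by simp only [u]; linarith, by simp only [u]; linarith⟩
  have hlim : Tendsto u atTop (𝓝 1) := by
    simpa [u] using (tendsto_const_nhds (x := (1 : ℝ))).sub
      (tendsto_one_div_add_atTop_nhds_zero_nat (𝕜 := ℝ))
  rw [← ENNReal.ofReal_le_ofReal_iff (by positivity), ofReal_torusMean hg hr]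
  calc ∫⁻ t, sliceMean g r t ∂torusMeasure
      ≤ ∫⁻ t, liminf (fun n => sliceMean f (u n) t) atTop ∂torusMeasure :=
        lintegral_mono_ae (h.sliceMean_le hg hfg hr hu hlim)
    _ ≤ liminf (fun n => ∫⁻ t, sliceMean f (u n) t ∂torusMeasure) atTop :=
        lintegral_liminf_le fun n => measurable_sliceMean f.differentiableOn (hu n)
    _ ≤ ENNReal.ofReal (‖f‖ ^ 2) := by
        refine liminf_le_of_le (by isBoundedDefault) fun b hb => ?_
        obtain ⟨n, hn⟩ := hb.exists
        refine hn.trans ?_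
        rw [← ofReal_torusMean f.differentiableOn (hu n)]
        exact ENNReal.ofReal_le_ofReal (f.torusMean_le_norm_sq (hu n))

/-- The operator of multiplication by `θ` is an isometry, so `θ H²(𝔻²)` is closed. -/
theorem IsInnerQuotient.isClosed_multiples (h : IsInnerQuotient θ p q) :
    IsClosed (multiples θ : Set HardySpace) := by
  choose T hT hTn using h.exists_mul
  let A : HardySpace →ₗ[ℂ] HardySpace :=
    { toFun := T
      map_add' := fun f g => HardySpace.ext fun x hx => by
        rw [hT _ x hx, HardySpace.add_apply, HardySpace.add_apply, hT _ x hx, hT _ x hx, mul_add]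
      map_smul' := fun c f => HardySpace.ext fun x hx => by
        rw [hT _ x hx, RingHom.id_apply, HardySpace.smul_apply, HardySpace.smul_apply, hT _ x hx,
          mul_left_comm] }
  have hnorm : ∀ f, ‖A f‖ = ‖f‖ := by
    intro f
    refine le_antisymm (hTn f) ?_
    obtain ⟨k, hk, hkn⟩ := h.exists_div (T f) f.differentiableOn (hT f)
    rwa [HardySpace.ext hk] at hkn
  let I : HardySpace →ₗᵢ[ℂ] HardySpace := ⟨A, hnorm⟩
  have : (multiples θ : Set HardySpace) = range I := by
    ext f
    constructor
    · rintro ⟨g, hg⟩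
      exact ⟨g, HardySpace.ext fun x hx => (hT g x hx).trans (hg x hx).symm⟩
    · rintro ⟨g, rfl⟩
      exact ⟨g, hT g⟩
  rw [this]
  exact I.isometry.isClosedEmbedding.isClosed_range

end RationalInner

/-! ### Restriction to lines, cancellation, and Blaschke factors in `z` -/

theorem mk_mem_bidisk {z w : ℂ} (hz : ‖z‖ < 1) (hw : ‖w‖ < 1) : (z, w) ∈ bidisk :=
  mem_bidisk.2 ⟨hz, hw⟩

theorem differentiableOn_section_snd {f : ℂ × ℂ → ℂ} (hf : DifferentiableOn ℂ f bidisk) {l : ℂ}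
    (hl : ‖l‖ < 1) : DifferentiableOn ℂ (fun w => f (l, w)) (Metric.ball 0 1) :=
  hf.comp (by fun_prop) fun w hw => mk_mem_bidisk hl (by simpa using hw)

theorem differentiableOn_section_fst {f : ℂ × ℂ → ℂ} (hf : DifferentiableOn ℂ f bidisk) {w : ℂ}
    (hw : ‖w‖ < 1) : DifferentiableOn ℂ (fun z => f (z, w)) (Metric.ball 0 1) :=
  hf.comp (by fun_prop) fun z hz => mk_mem_bidisk (by simpa using hz) hw

/-- Cancellation of a factor `w - a` from an identity between continuous functions. -/
theorem eqOn_of_sub_mul_eq {F G : ℂ → ℂ} {U : Set ℂ} (hU : IsOpen U) (hF : ContinuousOn F U)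
    (hG : ContinuousOn G U) {a : ℂ} (h : ∀ w ∈ U, (w - a) * F w = (w - a) * G w) :
    ∀ w ∈ U, F w = G w := by
  intro w hw
  by_cases hwa : w = a
  · subst hwa
    refine tendsto_nhds_unique_of_eventuallyEq (l := 𝓝[≠] w)
      ((hF.continuousAt (hU.mem_nhds hw)).tendsto.mono_left nhdsWithin_le_nhds)
      ((hG.continuousAt (hU.mem_nhds hw)).tendsto.mono_left nhdsWithin_le_nhds) ?_
    filter_upwards [self_mem_nhdsWithin, nhdsWithin_le_nhds (hU.mem_nhds hw)] with y hy hyU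
    exact mul_left_cancel₀ (sub_ne_zero.2 hy) (h y hyU)
  · exact mul_left_cancel₀ (sub_ne_zero.2 hwa) (h w hw)

/-- The domain property of the ring of holomorphic functions on the disk. -/
theorem eq_zero_of_mul_eq_zero {F G : ℂ → ℂ} (hF : DifferentiableOn ℂ F (Metric.ball 0 1))
    (hG : DifferentiableOn ℂ G (Metric.ball 0 1))
    (h : ∀ w ∈ Metric.ball (0 : ℂ) 1, F w * G w = 0)
    (hne : ∃ w ∈ Metric.ball (0 : ℂ) 1, F w ≠ 0) : ∀ w ∈ Metric.ball (0 : ℂ) 1, G w = 0 := by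
  obtain ⟨a, ha, hFa⟩ := hne
  have hnear : ∀ᶠ w in 𝓝 a, G w = 0 := by
    have hc := (hF.continuousOn.continuousAt (Metric.isOpen_ball.mem_nhds ha)).eventually_ne hFa
    filter_upwards [hc, Metric.isOpen_ball.mem_nhds ha] with w hw hw'
    exact (mul_eq_zero.1 (h w hw')).resolve_left hw
  exact (hG.analyticOnNhd Metric.isOpen_ball).eqOn_zero_of_preconnected_of_eventuallyEq_zero
    (convex_ball (0 : ℂ) 1).isPreconnected ha hnear

section BlaschkeFactor

theorem norm_conj_mul_lt {l z : ℂ} (hl : ‖l‖ < 1) (hz : ‖z‖ ≤ 1) : ‖conj l * z‖ < 1 := by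
  rw [norm_mul, RCLike.norm_conj]
  calc ‖l‖ * ‖z‖ ≤ ‖l‖ * 1 := by gcongr
    _ < 1 := by rwa [mul_one]

theorem one_sub_conj_mul_ne_zero {l z : ℂ} (hl : ‖l‖ < 1) (hz : ‖z‖ ≤ 1) : 1 - conj l * z ≠ 0 := by
  intro h
  have := norm_conj_mul_lt hl hz
  rw [← sub_eq_zero.1 h] at this
  simp at this

theorem norm_blaschke_eq_one {l u : ℂ} (hl : ‖l‖ < 1) (hu : ‖u‖ = 1) :
    ‖(u - l) / (1 - conj l * u)‖ = 1 := by
  have h1 : 1 - conj l * u = u * conj (u - l) := by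
    rw [map_sub, mul_sub, Complex.mul_conj, Complex.normSq_eq_norm_sq, hu]
    push_cast
    ring
  have h2 := one_sub_conj_mul_ne_zero hl hu.le
  rw [norm_div, h1, norm_mul, hu, one_mul, RCLike.norm_conj, div_self]
  rw [h1] at h2
  exact norm_ne_zero_iff.2 ((map_ne_zero _).1 (right_ne_zero_of_mul h2))

/-- The Blaschke factor in the variable `z`. -/
theorem exists_blaschke {l : ℂ} (hl : ‖l‖ < 1) :
    ∃ φ : HardySpace, ∀ x ∈ bidisk, φ x = (x.1 - l) / (1 - conj l * x.1) := by
  have hd : DifferentiableOn ℂ (fun x : ℂ × ℂ => (x.1 - l) / (1 - conj l * x.1)) bidisk := by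
    have h1 : DifferentiableOn ℂ (fun x : ℂ × ℂ => x.1 - l) bidisk := by fun_prop
    have h2 : DifferentiableOn ℂ (fun x : ℂ × ℂ => 1 - conj l * x.1) bidisk := by fun_prop
    simp_rw [div_eq_mul_inv]
    exact h1.mul (h2.inv fun x hx => one_sub_conj_mul_ne_zero hl (mem_bidisk.1 hx).1.le)
  have hpos : 0 < 1 - ‖l‖ := by linarith
  obtain ⟨φ, hφ, -⟩ := HardySpace.exists_mul hd (C := 2 / (1 - ‖l‖)) (by positivity)
    (fun r hr t => by
      have hz := (mem_bidisk.1 (torusPoint_mem hr hr t)).1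
      set z := (torusPoint r r t).1
      rw [norm_div]
      have h1 : ‖z - l‖ ≤ 2 := (norm_sub_le _ _).trans (by linarith)
      have h2 : 1 - ‖l‖ ≤ ‖1 - conj l * z‖ := by
        have h3 := norm_sub_norm_le (1 : ℂ) (conj l * z)
        have h4 : ‖conj l * z‖ ≤ ‖l‖ := by
          rw [norm_mul, RCLike.norm_conj]
          exact mul_le_of_le_one_right (norm_nonneg _) hz.le
        rw [norm_one] at h3
        linarith
      gcongr) HardySpace.one
  exact ⟨φ, fun x hx => by rw [hφ x hx, HardySpace.one_apply hx, mul_one]⟩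

/-- An inner function that vanishes on a line `z = l` has a Blaschke factor in `z`. -/
theorem exists_section_ne_zero {θ : HardySpace} (hθ : IsInner θ) (hz : ¬ HasInnerFactorInZ θ)
    {l : ℂ} (hl : ‖l‖ < 1) : ∃ w ∈ Metric.ball (0 : ℂ) 1, θ (l, w) ≠ 0 := by
  by_contra! h
  apply hz
  obtain ⟨φ, hφ⟩ := exists_blaschke hl
  obtain ⟨g, hg⟩ := HardySpace.exists_sub_eq_mul_fst θ hl
  -- Since `θ = (z - l) g`, the cofactor of the Blaschke factor is `(1 - conj l * z) g`, which is
  -- visibly in the Hardy space.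
  let ψ : HardySpace := g - conj l • HardySpace.shiftZ g
  have hψ : ∀ x, ψ x = (1 - conj l * x.1) * g x := fun x => by
    simp only [ψ]
    rw [HardySpace.sub_apply, HardySpace.smul_apply, HardySpace.shiftZ_apply]
    ring
  have hmul : ∀ x ∈ bidisk, θ x = φ x * ψ x := by
    intro x hx
    have h1 := hg x hx
    rw [h x.2 (by simpa using (mem_bidisk.1 hx).2), sub_zero] at h1
    have h2 := one_sub_conj_mul_ne_zero hl (mem_bidisk.1 hx).1.le
    rw [h1, hφ x hx, hψ, ← mul_assoc, div_mul_cancel₀ _ h2]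
  have hlim : ∀ t : UnitAddCircle × UnitAddCircle, ∃ c : ℂ, ‖c‖ = 1 ∧
      Tendsto (fun r : ℝ => φ (torusPoint r r t)) (𝓝[<] 1) (𝓝 c) := by
    intro t
    have hu : ‖(AddCircle.toCircle t.1 : ℂ)‖ = 1 := Circle.norm_coe _
    refine ⟨_, norm_blaschke_eq_one hl hu, ?_⟩
    have h1 : Tendsto (fun r : ℝ => (torusPoint r r t).1) (𝓝[<] 1)
        (𝓝 (AddCircle.toCircle t.1 : ℂ)) :=
      (continuous_fst.tendsto _).comp (tendsto_torusPoint t)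
    have h2 := (h1.sub_const l).div ((h1.const_mul (conj l)).const_sub 1)
      (one_sub_conj_mul_ne_zero hl hu.le)
    refine h2.congr' ?_
    filter_upwards [Ico_mem_nhdsLT (zero_lt_one (α := ℝ))] with r hr
    exact (hφ _ (torusPoint_mem hr hr t)).symm
  refine ⟨φ, ψ, ae_of_all _ hlim, ?_, ?_, ⟨fun z => (z - l) / (1 - conj l * z), hφ⟩, hmul⟩
  · filter_upwards [hθ] with t ht
    obtain ⟨c, hc, hc'⟩ := ht
    obtain ⟨d, hd, hd'⟩ := hlim t
    have hd0 : d ≠ 0 := by rintro rfl; simp at hd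
    refine ⟨c / d, by rw [norm_div, hc, hd, div_one], (hc'.div hd' hd0).congr' ?_⟩
    filter_upwards [Ico_mem_nhdsLT (zero_lt_one (α := ℝ)), hd'.eventually_ne hd0] with r hr hr'
    rw [Pi.div_apply, hmul _ (torusPoint_mem hr hr t), mul_div_cancel_left₀ _ hr']
  · rintro ⟨c, hc⟩
    -- The Blaschke factor vanishes only on `z = l`, so any second point of the disk shows that it
    -- is not constant.
    obtain ⟨m, hm, hml⟩ : ∃ m : ℂ, ‖m‖ < 1 ∧ m ≠ l := by
      by_cases h0 : l = 0
      · exact ⟨1 / 2, by norm_num, by rw [h0]; norm_num⟩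
      · exact ⟨0, by simp, Ne.symm h0⟩
    have e1 := hc _ (mk_mem_bidisk hl (w := 0) (by simp))
    have e2 := hc _ (mk_mem_bidisk hm (w := 0) (by simp))
    rw [hφ _ (mk_mem_bidisk hl (w := 0) (by simp)), sub_self, zero_div] at e1
    rw [hφ _ (mk_mem_bidisk hm (w := 0) (by simp)), ← e1, div_eq_zero_iff] at e2
    rcases e2 with e2 | e2
    · exact hml (sub_eq_zero.1 e2)
    · exact one_sub_conj_mul_ne_zero hl hm.le e2

end BlaschkeFactor

/-! ### Kernel and range of `S_z - l` -/

section CompressedShift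

open Polynomial

variable {θ : HardySpace} {p q : ℂ[X][X]}

/-- The operator `S_z - l` on `K_θ`. -/
abbrev shiftSub (θ : HardySpace) (l : ℂ) : quotientModule θ →L[ℂ] quotientModule θ :=
  compressedShift θ - l • ContinuousLinearMap.id ℂ (quotientModule θ)

/-- The orthogonal projection of `H²(𝔻²)` onto `K_θ`. -/
abbrev projK (θ : HardySpace) : HardySpace →L[ℂ] quotientModule θ :=
  (quotientModule θ).orthogonalProjectionOnto

/-- The kernel of the projection is the closure of `θH²`, and `θH²` is closed. Computations in `K_θ`
thus become computations modulo `θH²`. -/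
theorem IsInnerQuotient.projK_eq_zero_iff (h : IsInnerQuotient θ p q) {f : HardySpace} :
    projK θ f = 0 ↔ f ∈ multiples θ := by
  rw [Submodule.orthogonalProjectionOnto_eq_zero_iff, quotientModule,
    Submodule.orthogonal_orthogonal_eq_closure, h.isClosed_multiples.submodule_topologicalClosure_eq]

theorem IsInnerQuotient.sub_projK_mem (h : IsInnerQuotient θ p q) (f : HardySpace) :
    f - (projK θ f : HardySpace) ∈ multiples θ := by
  rw [← h.projK_eq_zero_iff, map_sub, Submodule.orthogonalProjectionOnto_mem_subspace_eq_self,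
    sub_self]

theorem eq_zero_of_mem_multiples (k : quotientModule θ) (hk : (k : HardySpace) ∈ multiples θ) :
    k = 0 := by
  have : inner ℂ (k : HardySpace) (k : HardySpace) = 0 := k.2 _ hk
  exact Subtype.ext (inner_self_eq_zero.1 this)

theorem shiftZ_sub_mem_multiples {f : HardySpace} (hf : f ∈ multiples θ) (l : ℂ) :
    HardySpace.shiftZ f - l • f ∈ multiples θ := by
  obtain ⟨g, hg⟩ := hf
  refine ⟨HardySpace.shiftZ g - l • g, fun x hx => ?_⟩
  rw [HardySpace.sub_apply, HardySpace.smul_apply, HardySpace.shiftZ_apply, hg x hx,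
    HardySpace.sub_apply, HardySpace.smul_apply, HardySpace.shiftZ_apply]
  ring

theorem shiftSub_apply (l : ℂ) (k : quotientModule θ) :
    shiftSub θ l k = projK θ (HardySpace.shiftZ k - l • (k : HardySpace)) := by
  rw [map_sub, map_smul, Submodule.orthogonalProjectionOnto_mem_subspace_eq_self]
  rfl

/-- The range of `S_z - l`, described by restriction to the line `z = l`. -/
theorem IsInnerQuotient.projK_mem_range_iff (h : IsInnerQuotient θ p q) {l : ℂ} (hl : ‖l‖ < 1)
    (f : HardySpace) : projK θ f ∈ (shiftSub θ l).range ↔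
      ∃ g : HardySpace, ∀ w ∈ Metric.ball (0 : ℂ) 1, f (l, w) = θ (l, w) * g (l, w) := by
  constructor
  · rintro ⟨k, hk⟩
    have hk' : projK θ (f - (HardySpace.shiftZ k - l • (k : HardySpace))) = 0 := by
      rw [map_sub, ← shiftSub_apply, ← hk]
      exact sub_self _
    obtain ⟨g, hg⟩ := h.projK_eq_zero_iff.1 hk'
    refine ⟨g, fun w hw => ?_⟩
    rw [← hg _ (mk_mem_bidisk hl (by simpa using hw)), HardySpace.sub_apply, HardySpace.sub_apply,
      HardySpace.smul_apply, HardySpace.shiftZ_apply]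
    ring
  · rintro ⟨g, hg⟩
    obtain ⟨g', hg', -⟩ := h.exists_mul g
    -- `f - θg` vanishes on the line `z = l`, so it equals `(z - l) k`. Replacing `k` by its
    -- projection changes this product only by an element of `θH²`.
    obtain ⟨k, hk⟩ := HardySpace.exists_sub_eq_mul_fst (f - g') hl
    have hf : f = g' + (HardySpace.shiftZ k - l • k) := by
      refine HardySpace.ext fun x hx => ?_
      have h1 := hk x hx
      have hx' := mk_mem_bidisk hl (mem_bidisk.1 hx).2
      rw [HardySpace.sub_apply, HardySpace.sub_apply, hg' _ hx',
        hg _ (by simpa using (mem_bidisk.1 hx).2), sub_self, sub_zero] at h1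
      rw [HardySpace.add_apply, HardySpace.sub_apply, HardySpace.smul_apply,
        HardySpace.shiftZ_apply]
      linear_combination h1
    have hz : projK θ g' = 0 := h.projK_eq_zero_iff.2 ⟨g, hg'⟩
    have hM := h.projK_eq_zero_iff.2 (shiftZ_sub_mem_multiples (h.sub_projK_mem k) l)
    refine ⟨projK θ k, ?_⟩
    change shiftSub θ l (projK θ k) = _
    rw [hf, map_add, hz, zero_add, shiftSub_apply, ← sub_eq_zero, ← map_sub, ← neg_eq_zero,
      ← map_neg, ← hM]
    congr 1
    rw [map_sub, smul_sub]
    abel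

/-- If `(z - l) k = θ g`, then `θ(l, ·) g(l, ·) = 0`, so `g(l, ·) = 0` and `g = (z - l) g₁`.
Cancelling gives `k = θ g₁`, which lies in `θH² ∩ K_θ = 0`. -/
theorem IsInnerQuotient.ker_shiftSub_eq_bot (h : IsInnerQuotient θ p q) {l : ℂ} (hl : ‖l‖ < 1)
    (hne : ∃ w ∈ Metric.ball (0 : ℂ) 1, θ (l, w) ≠ 0) : (shiftSub θ l).ker = ⊥ := by
  rw [Submodule.eq_bot_iff]
  intro k hk
  have hk' : projK θ (HardySpace.shiftZ k - l • (k : HardySpace)) = 0 := by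
    rw [← shiftSub_apply]; exact hk
  obtain ⟨g, hg⟩ := h.projK_eq_zero_iff.1 hk'
  have hg' : ∀ x ∈ bidisk, (x.1 - l) * (k : HardySpace) x = θ x * g x := by
    intro x hx
    rw [← hg x hx, HardySpace.sub_apply, HardySpace.smul_apply, HardySpace.shiftZ_apply]
    ring
  have hgl : ∀ w ∈ Metric.ball (0 : ℂ) 1, g (l, w) = 0 := by
    refine eq_zero_of_mul_eq_zero (differentiableOn_section_snd θ.differentiableOn hl)
      (differentiableOn_section_snd g.differentiableOn hl) (fun w hw => ?_) hne
    rw [← hg' _ (mk_mem_bidisk hl (by simpa using hw))]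
    simp
  obtain ⟨g₁, hg₁⟩ := HardySpace.exists_sub_eq_mul_fst g hl
  refine eq_zero_of_mem_multiples k ⟨g₁, fun x hx => ?_⟩
  have hx2 := (mem_bidisk.1 hx).2
  have key := eqOn_of_sub_mul_eq (a := l) Metric.isOpen_ball
    (differentiableOn_section_fst (k : HardySpace).differentiableOn hx2).continuousOn
    ((differentiableOn_section_fst θ.differentiableOn hx2).mul
      (differentiableOn_section_fst g₁.differentiableOn hx2)).continuousOn (fun z hz => by
      have hzx := mk_mem_bidisk (by simpa using hz) hx2
      have e1 := hg' _ hzx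
      have e2 := hg₁ _ hzx
      simp only at e1 e2
      rw [hgl _ (by simpa using hx2), sub_zero] at e2
      rw [e1, e2]
      simp only [Pi.mul_apply]
      ring)
  exact key x.1 (by simpa using (mem_bidisk.1 hx).1)

theorem norm_compressedShift_le : ‖compressedShift θ‖ ≤ 1 := by
  refine ContinuousLinearMap.opNorm_le_bound _ zero_le_one fun k => ?_
  calc ‖projK θ (HardySpace.shiftZ k)‖ ≤ ‖HardySpace.shiftZ (k : HardySpace)‖ :=
        Submodule.norm_orthogonalProjectionOnto_apply_le _ _
    _ ≤ 1 * ‖k‖ := HardySpace.shiftZ.le_of_opNorm_le HardySpace.norm_shiftZ_le _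

/-- The chain `‖k‖ ≤ ‖l k‖ = ‖P(zk)‖ ≤ ‖zk‖ ≤ ‖k‖` consists of equalities, so the projection loses
nothing and `zk = lk`; but `z - l` has no zero in the bidisk. -/
theorem eq_zero_of_compressedShift_eq_smul {l : ℂ} (hl : 1 ≤ ‖l‖) {k : quotientModule θ}
    (hk : compressedShift θ k = l • k) : k = 0 := by
  set f : HardySpace := HardySpace.shiftZ k with hf
  have hP : ((projK θ f : quotientModule θ) : HardySpace) = l • (k : HardySpace) :=
    congrArg Subtype.val hk
  have hort : inner ℂ (f - l • (k : HardySpace)) (l • (k : HardySpace)) = 0 := by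
    rw [← hP]
    exact Submodule.inner_left_of_mem_orthogonal (projK θ f).2
      ((quotientModule θ).sub_starProjection_mem_orthogonal f)
  have hpyth := norm_add_sq_eq_norm_sq_add_norm_sq_of_inner_eq_zero (𝕜 := ℂ) _ _ hort
  rw [sub_add_cancel, norm_smul] at hpyth
  have h1 : ‖f‖ ≤ ‖(k : HardySpace)‖ := by
    simpa using HardySpace.shiftZ.le_of_opNorm_le HardySpace.norm_shiftZ_le k
  have h2 : ‖(k : HardySpace)‖ ≤ ‖l‖ * ‖(k : HardySpace)‖ :=
    le_mul_of_one_le_left (norm_nonneg _) hl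
  have h3 : f - l • (k : HardySpace) = 0 := by
    rw [← norm_eq_zero]
    have := norm_nonneg f
    have := norm_nonneg (k : HardySpace)
    nlinarith [norm_nonneg (f - l • (k : HardySpace))]
  refine Subtype.ext (HardySpace.ext fun x hx => ?_)
  have h4 : (x.1 - l) * (k : HardySpace) x = 0 := by
    have : (f - l • (k : HardySpace)) x = 0 := by rw [h3]; rfl
    rw [HardySpace.sub_apply, HardySpace.smul_apply, hf, HardySpace.shiftZ_apply] at this
    linear_combination this
  refine (mul_eq_zero.1 h4).resolve_left fun h5 => ?_
  have := (mem_bidisk.1 hx).1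
  rw [sub_eq_zero.1 h5] at this
  linarith

/-- Outside the open unit disk, `S_z - l` is invertible as soon as it is Fredholm. -/
theorem norm_lt_one_of_mem {l : ℂ} (hs : l ∈ spectrum ℂ (compressedShift θ))
    (he : l ∉ essentialSpectrum (compressedShift θ)) : ‖l‖ < 1 := by
  by_contra! hl
  have hF : (shiftSub θ l).IsFredholm := not_not.1 he
  refine mem_spectrum_iff.1 hs ⟨?_, ?_⟩
  · rw [Submodule.eq_bot_iff]
    intro k hk
    refine eq_zero_of_compressedShift_eq_smul hl (sub_eq_zero.1 ?_)
    exact hk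
  · rw [← topologicalClosure_range_eq_top norm_compressedShift_le hl
      fun k hk => eq_zero_of_compressedShift_eq_smul hl hk]
    exact hF.isClosed_range.submodule_topologicalClosure_eq.symm

end CompressedShift

/-! ### The codimension of the range as a number of zeros -/

section ZeroCount

open Polynomial

/-- If `b = g u` on the disk with `u` zero-free, and all zeros of the polynomial `b` lie in the
disk, then `g` has `deg b` zeros. -/
theorem hasZeroCount_of_eq_mul {g u : ℂ → ℂ} {b : ℂ[X]} (hb : b ≠ 0)
    (hg : DifferentiableOn ℂ g (Metric.ball 0 1)) (hu : DifferentiableOn ℂ u (Metric.ball 0 1))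
    (h : ∀ w ∈ Metric.ball (0 : ℂ) 1, b.eval w = g w * u w)
    (hu0 : ∀ w ∈ Metric.ball (0 : ℂ) 1, u w ≠ 0)
    (hroots : ∀ w, b.IsRoot w → w ∈ Metric.ball (0 : ℂ) 1) : HasZeroCount g b.natDegree := by
  classical
  refine ⟨b.roots.toFinset, fun w => ?_, ?_⟩
  · rw [Multiset.mem_toFinset, mem_roots hb]
    constructor
    · intro hw
      refine ⟨hroots w hw, ?_⟩
      have := h w (hroots w hw)
      rw [hw.eq_zero] at this
      exact (mul_eq_zero.1 this.symm).resolve_right (hu0 w (hroots w hw))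
    · rintro ⟨hw, hgw⟩
      rw [IsRoot, h w hw, hgw, zero_mul]
  · have horder : ∀ w ∈ b.roots.toFinset, analyticOrderAt g w = (b.roots.count w : ℕ∞) := by
      intro w hw
      rw [Multiset.mem_toFinset, mem_roots hb] at hw
      have hwb := Metric.isOpen_ball.mem_nhds (hroots w hw)
      rw [count_roots, (hg.analyticAt hwb).analyticOrderAt_eq_natCast]
      obtain ⟨c, hc, hcw⟩ := exists_eq_pow_rootMultiplicity_mul_and_not_dvd b hb w
      -- With `b = (z - w) ^ m * c` and `c(w) ≠ 0`, the zero-free cofactor of `(z - w) ^ m` in `g =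
      -- b / u` is `c / u`.
      refine ⟨fun z => c.eval z * (u z)⁻¹, ?_, ?_, ?_⟩
      · exact (c.differentiable.analyticAt w).mul
          ((hu.analyticAt hwb).inv (hu0 w (hroots w hw)))
      · refine mul_ne_zero (fun h0 => hcw (dvd_iff_isRoot.2 h0)) (inv_ne_zero (hu0 w (hroots w hw)))
      · filter_upwards [hwb] with z hz
        have e := h z hz
        conv_lhs at e => rw [hc]
        rw [eval_mul, eval_pow, eval_sub, eval_X, eval_C] at e
        rw [smul_eq_mul, ← mul_assoc, e, mul_inv_cancel_right₀ (hu0 z hz)]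
    rw [Finset.sum_congr rfl horder, ← Nat.cast_sum, Multiset.toFinset_sum_count_eq,
      IsAlgClosed.card_roots_eq_natDegree]

variable {θ : HardySpace} {p q : ℂ[X][X]}

/-- The map `f ↦ P f + Ran (S_z - l)`. -/
def cokerMap (θ : HardySpace) (l : ℂ) :
    HardySpace →L[ℂ] (quotientModule θ ⧸ (shiftSub θ l).range) :=
  (shiftSub θ l).range.mkQL ∘L projK θ

theorem IsInnerQuotient.cokerMap_eq_zero_iff (h : IsInnerQuotient θ p q) {l : ℂ} (hl : ‖l‖ < 1)
    (f : HardySpace) : cokerMap θ l f = 0 ↔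
      ∃ g : HardySpace, ∀ w ∈ Metric.ball (0 : ℂ) 1, f (l, w) = θ (l, w) * g (l, w) := by
  rw [← h.projK_mem_range_iff hl]
  exact Submodule.Quotient.mk_eq_zero _

theorem cokerMap_surjective (θ : HardySpace) (l : ℂ) : Function.Surjective (cokerMap θ l) := by
  intro y
  obtain ⟨k, rfl⟩ := (shiftSub θ l).range.mkQ_surjective y
  refine ⟨k, ?_⟩
  change (shiftSub θ l).range.mkQ (projK θ k) = _
  rw [Submodule.orthogonalProjectionOnto_mem_subspace_eq_self]

/-- The image of a dense subspace is dense in the finite-dimensional cokernel, where every subspace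
is closed. -/
theorem map_cokerMap_eq_top {l : ℂ} (hF : (shiftSub θ l).IsFredholm) {W : Submodule ℂ HardySpace}
    (hW : W.topologicalClosure = ⊤) : W.map (cokerMap θ l).toLinearMap = ⊤ := by
  have := hF.finite_coker
  have hcl : IsClosed ((shiftSub θ l).range : Set (quotientModule θ)) := hF.isClosed_range
  have hc : IsClosed ((W.map (cokerMap θ l).toLinearMap).comap
      (cokerMap θ l).toLinearMap : Set HardySpace) :=
    (Submodule.closed_of_finiteDimensional (W.map (cokerMap θ l).toLinearMap)).preimage
      (cokerMap θ l).continuous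
  have htop := (W.topologicalClosure_minimal (W.le_comap_map _) hc)
  rw [hW, top_le_iff] at htop
  rw [← Submodule.map_comap_eq_of_surjective (f := (cokerMap θ l).toLinearMap)
    (cokerMap_surjective θ l) (W.map _), htop, Submodule.map_top, LinearMap.range_eq_top]
  exact cokerMap_surjective θ l

/-- The polynomials in `w` that belong to `θ H²(𝔻²) + (z - l) H²(𝔻²)`. -/
def polyIdeal (θ : HardySpace) (l : ℂ) : Ideal ℂ[X] where
  carrier := {r | ∃ g : HardySpace, ∀ w ∈ Metric.ball (0 : ℂ) 1, r.eval w = θ (l, w) * g (l, w)}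
  zero_mem' := ⟨0, fun w _ => by simp [HardySpace.zero_apply]⟩
  add_mem' := by
    rintro r s ⟨f, hf⟩ ⟨g, hg⟩
    exact ⟨f + g, fun w hw => by
      rw [eval_add, hf w hw, hg w hw, HardySpace.add_apply, mul_add]⟩
  smul_mem' := by
    rintro r s ⟨f, hf⟩
    by_cases hl : ‖l‖ < 1
    · refine ⟨aeval HardySpace.shiftW r f, fun w hw => ?_⟩
      rw [HardySpace.aeval_shiftW_apply _ _ (mk_mem_bidisk hl (by simpa using hw)), smul_eq_mul,
        eval_mul, hf w hw]
      ring
    -- Off the disk `θ(l, ·)` is zero by the convention of extension by zero, so the set still is an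
    -- ideal.
    · refine ⟨0, fun w hw => ?_⟩
      have h0 : θ (l, w) = 0 := θ.eq_zero_of_notMem fun hm => hl (mem_bidisk.1 hm).1
      rw [smul_eq_mul, eval_mul, hf w hw, h0]
      ring

/-- The map `r ↦ r(w) + Ran (S_z - l)` on polynomials. -/
def polyCokerMap (θ : HardySpace) (l : ℂ) :
    ℂ[X] →ₗ[ℂ] (quotientModule θ ⧸ (shiftSub θ l).range) :=
  (cokerMap θ l).toLinearMap ∘ₗ
    (LinearMap.applyₗ HardySpace.one ∘ₗ ContinuousLinearMap.coeLM ℂ) ∘ₗ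
      (aeval HardySpace.shiftW : ℂ[X] →ₐ[ℂ] _).toLinearMap

theorem polyCokerMap_apply (l : ℂ) (r : ℂ[X]) :
    polyCokerMap θ l r = cokerMap θ l (aeval HardySpace.shiftW r HardySpace.one) := rfl

theorem aeval_shiftW_one_apply (r : ℂ[X]) {x : ℂ × ℂ} (hx : x ∈ bidisk) :
    aeval HardySpace.shiftW r HardySpace.one x = r.eval x.2 := by
  rw [HardySpace.aeval_shiftW_apply _ _ hx, HardySpace.one_apply hx, mul_one]

theorem IsInnerQuotient.polyCokerMap_eq_zero_iff (h : IsInnerQuotient θ p q) {l : ℂ}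
    (hl : ‖l‖ < 1) (r : ℂ[X]) : polyCokerMap θ l r = 0 ↔ r ∈ polyIdeal θ l := by
  rw [polyCokerMap_apply, h.cokerMap_eq_zero_iff hl]
  refine exists_congr fun g => forall₂_congr fun w hw => ?_
  rw [aeval_shiftW_one_apply _ (mk_mem_bidisk hl (by simpa using hw))]

/-- Monomials span a dense subspace, and `z ^ m w ^ n` agrees with `l ^ m w ^ n` on the line `z =
l`. -/
theorem IsInnerQuotient.polyCokerMap_surjective (h : IsInnerQuotient θ p q) {l : ℂ}
    (hl : ‖l‖ < 1) (hF : (shiftSub θ l).IsFredholm) : Function.Surjective (polyCokerMap θ l) := by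
  rw [← LinearMap.range_eq_top, eq_top_iff,
    ← map_cokerMap_eq_top hF HardySpace.monomialBasis.dense_span, Submodule.map_span,
    Submodule.span_le]
  rintro _ ⟨_, ⟨⟨m, n⟩, rfl⟩, rfl⟩
  refine ⟨C (l ^ m) * X ^ n, ?_⟩
  rw [polyCokerMap_apply]
  change _ = cokerMap θ l _
  rw [← sub_eq_zero, ← map_sub, h.cokerMap_eq_zero_iff hl]
  refine ⟨0, fun w hw => ?_⟩
  have hx := mk_mem_bidisk hl (by simpa using hw)
  rw [HardySpace.sub_apply, aeval_shiftW_one_apply _ hx, HardySpace.monomialBasis_apply _ hx,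
    HardySpace.zero_apply]
  simp

/-- The cokernel is `ℂ[w]` modulo `polyIdeal`, a principal ideal. It is nonzero since `ℂ[w]` has
infinite dimension, and the quotient has the degree of the generator as its dimension. -/
theorem IsInnerQuotient.exists_generator (h : IsInnerQuotient θ p q) {l : ℂ}
    (hl : ‖l‖ < 1) (hF : (shiftSub θ l).IsFredholm) :
    ∃ b : ℂ[X], b ≠ 0 ∧ (∀ r, r ∈ polyIdeal θ l ↔ b ∣ r) ∧
      b.natDegree = Module.finrank ℂ (quotientModule θ ⧸ (shiftSub θ l).range) := by
  have hfin := hF.finite_coker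
  obtain ⟨b, hb⟩ := IsPrincipalIdealRing.principal (polyIdeal θ l)
  have hb' : polyIdeal θ l = Ideal.span {b} := hb
  have hker : LinearMap.ker (polyCokerMap θ l) = (polyIdeal θ l).restrictScalars ℂ := by
    ext r
    exact h.polyCokerMap_eq_zero_iff hl r
  refine ⟨b, ?_, fun r => by rw [hb', Ideal.mem_span_singleton], ?_⟩
  · rintro rfl
    have hinj : Function.Injective (polyCokerMap θ l) := by
      rw [← LinearMap.ker_eq_bot, hker, hb']
      ext r
      simp
    exact Polynomial.not_finite (R := ℂ) (Module.Finite.of_injective _ hinj)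
  · rw [← finrank_quotient_span_eq_natDegree (f := b), ← hb']
    refine LinearEquiv.finrank_eq ?_
    exact (Submodule.Quotient.restrictScalarsEquiv ℂ (polyIdeal θ l)).symm.trans
      ((Submodule.quotEquivOfEq _ _ hker.symm).trans
        ((polyCokerMap θ l).quotKerEquivOfSurjective (h.polyCokerMap_surjective hl hF)))

theorem eq_zero_of_shiftW_eq_smul {m : ℂ} (hm : 1 ≤ ‖m‖) {f : HardySpace}
    (hf : HardySpace.shiftW f = m • f) : f = 0 := by
  refine HardySpace.ext fun x hx => ?_
  have e : HardySpace.shiftW f x = (m • f) x := by rw [hf]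
  rw [HardySpace.shiftW_apply _ hx, HardySpace.smul_apply] at e
  have e' : (x.2 - m) * f x = 0 := by linear_combination e
  refine (mul_eq_zero.1 e').resolve_left fun h0 => ?_
  have := (mem_bidisk.1 hx).2
  rw [sub_eq_zero.1 h0] at this
  linarith

/-- For `|m| ≥ 1` the multiples of `w - m` are dense in the Hardy space, so `1` is congruent to some
`(w - m) g`, and `g` may be replaced by a polynomial. This excludes roots of the generator outside
the open disk. -/
theorem IsInnerQuotient.exists_inverse_mod (h : IsInnerQuotient θ p q) {l : ℂ}
    (hl : ‖l‖ < 1) (hF : (shiftSub θ l).IsFredholm) {m : ℂ} (hm : 1 ≤ ‖m‖) :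
    ∃ s : ℂ[X], (X - C m) * s - 1 ∈ polyIdeal θ l := by
  have htop := map_cokerMap_eq_top hF (topologicalClosure_range_eq_top HardySpace.norm_shiftW_le hm
    fun f hf => eq_zero_of_shiftW_eq_smul hm hf)
  obtain ⟨_, ⟨g, rfl⟩, hg⟩ : cokerMap θ l HardySpace.one ∈ Submodule.map
      (cokerMap θ l).toLinearMap
      (HardySpace.shiftW - m • ContinuousLinearMap.id ℂ HardySpace).range := by
    rw [htop]; trivial
  obtain ⟨s, hs⟩ := h.polyCokerMap_surjective hl hF (cokerMap θ l g)
  rw [polyCokerMap_apply, ← sub_eq_zero, ← map_sub, h.cokerMap_eq_zero_iff hl] at hs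
  obtain ⟨k, hk⟩ := hs
  have hg' : cokerMap θ l (HardySpace.shiftW g - m • g - HardySpace.one) = 0 := by
    rw [map_sub, sub_eq_zero]
    exact hg
  obtain ⟨k', hk'⟩ := (h.cokerMap_eq_zero_iff hl _).1 hg'
  refine ⟨s, HardySpace.shiftW k - m • k + k', fun w hw => ?_⟩
  have hx := mk_mem_bidisk hl (mem_ball_zero_iff.1 hw)
  have e1 := hk w hw
  have e2 := hk' w hw
  rw [HardySpace.sub_apply, aeval_shiftW_one_apply _ hx] at e1
  rw [HardySpace.sub_apply, HardySpace.sub_apply, HardySpace.smul_apply,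
    HardySpace.shiftW_apply _ hx, HardySpace.one_apply hx] at e2
  rw [HardySpace.add_apply, HardySpace.sub_apply, HardySpace.smul_apply,
    HardySpace.shiftW_apply _ hx]
  simp only [eval_sub, eval_mul, eval_X, eval_C, eval_one] at e1 e2 ⊢
  linear_combination (w - m) * e1 + e2

/-- If `S_z - l` is Fredholm, the number of zeros of `θ(l, ·)` is the codimension of its range. -/
theorem IsInnerQuotient.hasZeroCount (h : IsInnerQuotient θ p q) {l : ℂ}
    (hl : ‖l‖ < 1) (hF : (shiftSub θ l).IsFredholm) :
    HasZeroCount (fun w => θ (l, w))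
      (Module.finrank ℂ (quotientModule θ ⧸ (shiftSub θ l).range)) := by
  obtain ⟨b, hb, hI, hdeg⟩ := h.exists_generator hl hF
  rw [← hdeg]
  obtain ⟨k, hk⟩ := (hI b).2 dvd_rfl
  refine hasZeroCount_of_eq_mul hb (differentiableOn_section_snd θ.differentiableOn hl)
    (differentiableOn_section_snd k.differentiableOn hl) hk (fun m hm hkm => ?_) fun m hm => ?_
  -- A zero `m` of the cofactor could be cancelled: `b / (w - m)` would still be divisible by `θ(l,
  -- ·)`, contradicting the minimal degree of `b`.
  · have hbm : b.IsRoot m := by rw [IsRoot, hk m hm, hkm, mul_zero]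
    obtain ⟨c, hc⟩ := dvd_iff_isRoot.2 hbm
    obtain ⟨k₁, hk₁⟩ := HardySpace.exists_sub_eq_mul_snd k (mem_ball_zero_iff.1 hm)
    have hcI : c ∈ polyIdeal θ l := by
      refine ⟨k₁, eqOn_of_sub_mul_eq (a := m) Metric.isOpen_ball c.continuous.continuousOn
        ((differentiableOn_section_snd θ.differentiableOn hl).mul
          (differentiableOn_section_snd k₁.differentiableOn hl)).continuousOn fun w hw => ?_⟩
      have e1 := hk w hw
      have e2 := hk₁ _ (mk_mem_bidisk hl (mem_ball_zero_iff.1 hw))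
      simp only at e2
      rw [hkm, sub_zero] at e2
      rw [hc, eval_mul, eval_sub, eval_X, eval_C, e2] at e1
      rw [e1]
      exact mul_left_comm _ _ _
    have hc0 : c ≠ 0 := by rintro rfl; exact hb (by rw [hc, mul_zero])
    have hle := natDegree_le_of_dvd ((hI c).1 hcI) hc0
    rw [hc, natDegree_mul (X_sub_C_ne_zero _) hc0, natDegree_X_sub_C] at hle
    omega
  -- A root `m` of `b` with `|m| ≥ 1` would make `w - m` a zero divisor modulo `b`, yet it is
  -- invertible there.
  · by_contra hmb
    obtain ⟨s, hs⟩ := h.exists_inverse_mod hl hF (m := m) (by simpa using hmb)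
    obtain ⟨c, hc⟩ := (hI _).1 hs
    have := congrArg (eval m) hc
    rw [eval_mul, hm.eq_zero] at this
    simp at this

end ZeroCount

/-! ### Holomorphic division on the bidisk -/

section Division

/-- Holomorphic dependence of an integral on two complex parameters. -/
theorem differentiableOn_intervalIntegral {O : Set (ℂ × ℂ)} (hO : IsOpen O) {G : ℂ × ℂ → ℝ → ℂ}
    {M a b : ℝ} (hab : a ≤ b) (hc : ∀ x ∈ O, Continuous (G x))
    (hd : ∀ t, DifferentiableOn ℂ (fun x => G x t) O) (hM : ∀ x ∈ O, ∀ t, ‖G x t‖ ≤ M) :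
    DifferentiableOn ℂ (fun x => ∫ t in a..b, G x t) O := by
  intro x₀ hx₀
  obtain ⟨r, hr, hball⟩ := Metric.isOpen_iff.1 hO x₀ hx₀
  have hfd : ∀ t, HasFDerivAt (fun x => G x t) (fderiv ℂ (fun x => G x t) x₀) x₀ := fun t =>
    ((hd t).differentiableAt (hO.mem_nhds hx₀)).hasFDerivAt
  -- Continuity in `t` is assumed for `G` only; each directional derivative is measurable as a limit
  -- of difference quotients along `1 / n`.
  have hdir : ∀ v : ℂ × ℂ, AEStronglyMeasurable
      (fun t => fderiv ℂ (fun x => G x t) x₀ v) (volume.restrict (Ioc a b)) := by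
    intro v
    have htop : Tendsto (fun n : ℕ => ‖(n : ℂ)‖) atTop atTop := by
      simpa using tendsto_natCast_atTop_atTop (R := ℝ)
    obtain ⟨N, hN⟩ : ∃ N : ℕ, ∀ n ≥ N, x₀ + (n : ℂ)⁻¹ • v ∈ O := by
      have ht : Tendsto (fun n : ℕ => x₀ + (n : ℂ)⁻¹ • v) atTop (𝓝 (x₀ + (0 : ℂ) • v)) :=
        tendsto_const_nhds.add (tendsto_inv_atTop_nhds_zero_nat.smul_const v)
      rw [zero_smul, add_zero] at ht
      exact eventually_atTop.1 (ht.eventually (hO.mem_nhds hx₀))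
    refine aestronglyMeasurable_of_tendsto_ae atTop
      (f := fun n t => ((n + N : ℕ) : ℂ) • (G (x₀ + ((n + N : ℕ) : ℂ)⁻¹ • v) t - G x₀ t))
      (fun n => ?_) (ae_of_all _ fun t => ?_)
    · have h1 := hc _ (hN _ (Nat.le_add_left N n))
      have h2 := hc _ hx₀
      exact Continuous.aestronglyMeasurable (by fun_prop)
    · exact (hfd t).lim v (htop.comp (tendsto_add_atTop_nat N))
  have hmeas : AEStronglyMeasurable (fun t => fderiv ℂ (fun x => G x t) x₀)
      (volume.restrict (Ioc a b)) := by
    have e : (fun t => fderiv ℂ (fun x => G x t) x₀) = fun t =>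
        fderiv ℂ (fun x => G x t) x₀ (1, 0) • ContinuousLinearMap.fst ℂ ℂ ℂ +
          fderiv ℂ (fun x => G x t) x₀ (0, 1) • ContinuousLinearMap.snd ℂ ℂ ℂ := by
      ext t <;> simp
    rw [e]
    exact ((hdir _).smul_const _).add ((hdir _).smul_const _)
  have key := hasFDerivAt_integral_of_dominated_loc_of_lip' (𝕜 := ℂ) (F := G)
    (μ := volume.restrict (Ioc a b)) (bound := fun _ => (M + M) / r) (Metric.ball_mem_nhds x₀ hr)
    (fun x hx => (hc x (hball hx)).aestronglyMeasurable)
    ((hc x₀ hx₀).integrableOn_Ioc) hmeas (ae_of_all _ fun t x hx => ?_)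
    (integrable_const _) (ae_of_all _ hfd)
  · simp_rw [intervalIntegral.integral_of_le hab]
    exact key.2.differentiableAt.differentiableWithinAt
  -- The Schwarz lemma turns the uniform bound `M` into the Lipschitz bound `2M / r` at the centre
  -- of the ball.
  · rw [← dist_eq_norm, ← dist_eq_norm]
    refine Complex.dist_le_div_mul_dist_of_mapsTo_ball (f := fun x => G x t)
      ((hd t).mono hball) (fun y hy => ?_) hx
    rw [Metric.mem_closedBall, dist_eq_norm]
    exact (norm_sub_le _ _).trans (add_le_add (hM y (hball hy) t) (hM x₀ hx₀ t))

theorem eventually_ne_zero_of_section {F : ℂ → ℂ} (hF : DifferentiableOn ℂ F (Metric.ball 0 1))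
    (hne : ∃ w ∈ Metric.ball (0 : ℂ) 1, F w ≠ 0) {a : ℂ} (ha : a ∈ Metric.ball (0 : ℂ) 1) :
    ∀ᶠ w in 𝓝[≠] a, F w ≠ 0 := by
  refine ((hF.analyticAt (Metric.isOpen_ball.mem_nhds ha)).eventually_eq_zero_or_eventually_ne_zero
    ).resolve_left fun h => ?_
  obtain ⟨w, hw, hFw⟩ := hne
  exact hFw ((hF.analyticOnNhd Metric.isOpen_ball).eqOn_zero_of_preconnected_of_eventuallyEq_zero
    (convex_ball (0 : ℂ) 1).isPreconnected ha h hw)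

/-- Local division: if `f(l, ·)` is divisible by `θ(l, ·)` for a dense set of `l`, then `f` is locally
divisible by `θ`. -/
theorem exists_local_quotient {f θ : ℂ × ℂ → ℂ} (hf : DifferentiableOn ℂ f bidisk)
    (hθ : DifferentiableOn ℂ θ bidisk) {D : Set ℂ} (hD : Metric.ball 0 1 ⊆ closure D)
    (hdiv : ∀ l ∈ D, ‖l‖ < 1 → ∃ h : ℂ → ℂ, DifferentiableOn ℂ h (Metric.ball 0 1) ∧
      ∀ w ∈ Metric.ball (0 : ℂ) 1, f (l, w) = θ (l, w) * h w)
    {x₀ : ℂ × ℂ} (hx₀ : x₀ ∈ bidisk) (hne : ∃ w ∈ Metric.ball (0 : ℂ) 1, θ (x₀.1, w) ≠ 0) :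
    ∃ (O : Set (ℂ × ℂ)) (H : ℂ × ℂ → ℂ), IsOpen O ∧ x₀ ∈ O ∧ DifferentiableOn ℂ H O ∧
      ∀ x ∈ O, f x = θ x * H x := by
  obtain ⟨hl₀, hw₀⟩ := mem_bidisk.1 hx₀
  obtain ⟨l₀, w₀⟩ := x₀
  simp only at hl₀ hw₀ hne
  have hw₀' : w₀ ∈ Metric.ball (0 : ℂ) 1 := mem_ball_zero_iff.2 hw₀
  -- Zeros of `θ(l₀, ·)` are isolated, so a small circle around `w₀` avoids them; by the tube lemma
  -- it avoids those of `θ(l, ·)` for all `l` near `l₀`.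
  obtain ⟨ε, hε, hεball, hεne⟩ : ∃ ε > 0, Metric.closedBall w₀ ε ⊆ Metric.ball 0 1 ∧
      ∀ w ∈ Metric.sphere w₀ ε, θ (l₀, w) ≠ 0 := by
    have h1 := eventually_ne_zero_of_section (differentiableOn_section_snd hθ hl₀) hne hw₀'
    rw [eventually_nhdsWithin_iff] at h1
    obtain ⟨ε, hε, h2⟩ := Metric.nhds_basis_closedBall.eventually_iff.1
      (h1.and (Metric.isOpen_ball.mem_nhds hw₀'))
    refine ⟨ε, hε, fun w hw => (h2 hw).2, fun w hw => (h2 (Metric.sphere_subset_closedBall hw)).1 ?_⟩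
    exact Metric.ne_of_mem_sphere hw hε.ne'
  have hopen : IsOpen (bidisk ∩ θ ⁻¹' {0}ᶜ) :=
    hθ.continuousOn.isOpen_inter_preimage isOpen_bidisk isOpen_compl_singleton
  have hsph : ∀ w ∈ Metric.sphere w₀ ε, w ∈ Metric.ball (0 : ℂ) 1 := fun w hw =>
    hεball (Metric.sphere_subset_closedBall hw)
  obtain ⟨U, V, hU, -, hlU, hSV, hUV⟩ := generalized_tube_lemma (isCompact_singleton (x := l₀))
    (isCompact_sphere w₀ ε) hopen (by
      rintro ⟨l, w⟩ ⟨hl, hw⟩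
      obtain rfl : l = l₀ := hl
      exact ⟨mk_mem_bidisk hl₀ (mem_ball_zero_iff.1 (hsph w hw)), hεne w hw⟩)
  obtain ⟨δ, hδ, hδU⟩ := Metric.nhds_basis_closedBall.mem_iff.1 (hU.mem_nhds (hlU rfl))
  have hmem : ∀ l ∈ Metric.closedBall l₀ δ, ∀ w ∈ Metric.sphere w₀ ε,
      (l, w) ∈ bidisk ∧ θ (l, w) ≠ 0 := fun l hl w hw => hUV ⟨hδU hl, hSV hw⟩
  have hδball : ∀ l ∈ Metric.closedBall l₀ δ, ‖l‖ < 1 := by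
    obtain ⟨w, hw⟩ := (NormedSpace.sphere_nonempty (x := w₀)).2 hε.le
    exact fun l hl => (mem_bidisk.1 (hmem l hl w hw).1).1
  let K : Set (ℂ × ℂ) := Metric.closedBall l₀ δ ×ˢ Metric.sphere w₀ ε
  have hKc : IsCompact K := (isCompact_closedBall _ _).prod (isCompact_sphere _ _)
  have hKcont : ContinuousOn (fun x => f x / θ x) K :=
    (hf.continuousOn.mono fun x hx => (hmem x.1 hx.1 x.2 hx.2).1).div
      (hθ.continuousOn.mono fun x hx => (hmem x.1 hx.1 x.2 hx.2).1)
      fun x hx => (hmem x.1 hx.1 x.2 hx.2).2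
  obtain ⟨M, hM⟩ := hKc.exists_bound_of_continuousOn hKcont
  -- The radius `ε / 2` keeps the Cauchy kernel bounded by `(ε / 2)⁻¹` on the circle of radius `ε`.
  let O : Set (ℂ × ℂ) := Metric.ball l₀ δ ×ˢ Metric.ball w₀ (ε / 2)
  have hO : IsOpen O := Metric.isOpen_ball.prod Metric.isOpen_ball
  have hOmem : ∀ x ∈ O, x ∈ bidisk := fun x hx =>
    mk_mem_bidisk (hδball _ (Metric.ball_subset_closedBall hx.1)) (mem_ball_zero_iff.1
      (hεball (Metric.closedBall_subset_closedBall (by linarith)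
        (Metric.ball_subset_closedBall hx.2))))
  have hcm : ∀ t, circleMap w₀ ε t ∈ Metric.sphere w₀ ε := circleMap_mem_sphere w₀ hε.le
  have hfar : ∀ x ∈ O, ∀ t, ε / 2 ≤ ‖circleMap w₀ ε t - x.2‖ := by
    intro x hx t
    have h1 : ‖circleMap w₀ ε t - w₀‖ = ε := by simpa [dist_eq_norm] using hcm t
    have h2 : ‖x.2 - w₀‖ < ε / 2 := mem_ball_iff_norm.1 hx.2
    have h3 := norm_sub_le_norm_sub_add_norm_sub (circleMap w₀ ε t) x.2 w₀
    linarith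
  have hfar0 : ∀ x ∈ O, ∀ t, circleMap w₀ ε t - x.2 ≠ 0 := fun x hx t h0 => by
    have := hfar x hx t
    rw [h0, norm_zero] at this
    linarith
  let G : ℂ × ℂ → ℝ → ℂ := fun x t => deriv (circleMap w₀ ε) t •
    ((circleMap w₀ ε t - x.2)⁻¹ • (f (x.1, circleMap w₀ ε t) / θ (x.1, circleMap w₀ ε t)))
  have hG : DifferentiableOn ℂ (fun x => ∫ t in (0 : ℝ)..2 * Real.pi, G x t) O := by
    refine differentiableOn_intervalIntegral hO (M := ε * ((ε / 2)⁻¹ * M)) Real.two_pi_pos.le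
      (fun x hx => ?_) (fun t => ?_) fun x hx t => ?_
    · have h1 : Continuous fun t => f (x.1, circleMap w₀ ε t) / θ (x.1, circleMap w₀ ε t) :=
        hKcont.comp_continuous (f := fun t => (x.1, circleMap w₀ ε t)) (by fun_prop)
          fun t => ⟨Metric.ball_subset_closedBall hx.1, hcm t⟩
      have h2 : Continuous fun t => (circleMap w₀ ε t - x.2)⁻¹ :=
        Continuous.inv₀ (by fun_prop) (hfar0 x hx)
      have h3 : Continuous (deriv (circleMap w₀ ε)) := by
        rw [funext (deriv_circleMap w₀ ε)]; fun_prop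
      exact h3.smul (h2.smul h1)
    · have h1 : ∀ x ∈ O, (x.1, circleMap w₀ ε t) ∈ bidisk ∧ θ (x.1, circleMap w₀ ε t) ≠ 0 :=
        fun x hx => hmem _ (Metric.ball_subset_closedBall hx.1) _ (hcm t)
      have h2 : DifferentiableOn ℂ (fun x : ℂ × ℂ => (x.1, circleMap w₀ ε t)) O := by fun_prop
      have h3 : DifferentiableOn ℂ (fun x : ℂ × ℂ => f (x.1, circleMap w₀ ε t)) O :=
        hf.comp h2 fun x hx => (h1 x hx).1
      have h4 : DifferentiableOn ℂ (fun x : ℂ × ℂ => θ (x.1, circleMap w₀ ε t)) O :=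
        hθ.comp h2 fun x hx => (h1 x hx).1
      have h5 : DifferentiableOn ℂ (fun x : ℂ × ℂ => circleMap w₀ ε t - x.2) O := by fun_prop
      simp only [G, div_eq_mul_inv]
      exact DifferentiableOn.const_smul (R := ℂ) ((h5.inv fun x hx => hfar0 x hx t).smul
        (h3.mul (h4.inv fun x hx => (h1 x hx).2))) _
    · simp only [G, norm_smul, norm_inv]
      have h1 := hfar x hx t
      have h2 : ‖deriv (circleMap w₀ ε) t‖ = ε := by simp [deriv_circleMap, abs_of_pos hε]
      rw [h2]
      gcongr
      exact hM (x.1, circleMap w₀ ε t) ⟨Metric.ball_subset_closedBall hx.1, hcm t⟩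
  refine ⟨O, fun x => (2 * Real.pi * Complex.I : ℂ)⁻¹ • ∫ t in (0 : ℝ)..2 * Real.pi, G x t, hO,
    ⟨Metric.mem_ball_self hδ, Metric.mem_ball_self (by positivity)⟩, hG.fun_const_smul _, ?_⟩
  set H : ℂ × ℂ → ℂ := fun x => (2 * Real.pi * Complex.I : ℂ)⁻¹ •
    ∫ t in (0 : ℝ)..2 * Real.pi, G x t with hH
  have hHc : ContinuousOn H O := (hG.fun_const_smul _).continuousOn
  -- `H` is the Cauchy integral of `f / θ` in `w`. For `l ∈ D` the integrand is that of the given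
  -- quotient, which Cauchy's formula recovers; density of `D` and continuity settle the remaining
  -- `l`.
  have hgood : ∀ x ∈ O, x.1 ∈ D → f x = θ x * H x := by
    intro x hx hxD
    have hx1 : ‖x.1‖ < 1 := (mem_bidisk.1 (hOmem x hx)).1
    obtain ⟨h, hh, hfh⟩ := hdiv x.1 hxD hx1
    have hxw : x.2 ∈ Metric.ball w₀ ε := Metric.ball_subset_ball (by linarith) hx.2
    have hC := (hh.mono hεball).circleIntegral_sub_inv_smul hxw
    have e : ∫ t in (0 : ℝ)..2 * Real.pi, G x t = ∮ z in C(w₀, ε), (z - x.2)⁻¹ • h z := by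
      refine circleIntegral.integral_congr (f := fun z => (z - x.2)⁻¹ • (f (x.1, z) / θ (x.1, z)))
        hε.le fun z hz => ?_
      have h1 := hmem _ (Metric.ball_subset_closedBall hx.1) z hz
      simp only
      rw [hfh z (hsph z hz), mul_div_cancel_left₀ _ h1.2]
    have h0 : (2 * Real.pi * Complex.I : ℂ) ≠ 0 := Complex.two_pi_I_ne_zero
    rw [hH]
    simp only
    rw [e, hC, inv_smul_smul₀ h0]
    exact hfh x.2 (mem_ball_zero_iff.2 (mem_bidisk.1 (hOmem x hx)).2)
  intro x hx
  by_contra hcon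
  have hat : ContinuousAt (fun z => f (z, x.2) - θ (z, x.2) * H (z, x.2)) x.1 := by
    have h1 : ContinuousAt (fun y => f y - θ y * H y) x :=
      (hf.continuousOn.continuousAt (isOpen_bidisk.mem_nhds (hOmem x hx))).sub
        ((hθ.continuousOn.continuousAt (isOpen_bidisk.mem_nhds (hOmem x hx))).mul
          (hHc.continuousAt (hO.mem_nhds hx)))
    exact ContinuousAt.comp (f := fun z => (z, x.2)) (g := fun y => f y - θ y * H y) h1
      (by fun_prop)
  have hcl : x.1 ∈ closure D := hD (mem_ball_zero_iff.2 (mem_bidisk.1 (hOmem x hx)).1)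
  obtain ⟨z, ⟨hz, hzne⟩, hzD⟩ := mem_closure_iff_nhds.1 hcl _ ((Metric.isOpen_ball.eventually_mem
    hx.1).and (hat.eventually_ne (sub_ne_zero.2 hcon)))
  exact hzne (sub_eq_zero.2 (hgood (z, x.2) ⟨hz, hx.2⟩ hzD))

/-- Global division on the bidisk, obtained by gluing local quotients. -/
theorem exists_quotient {f θ : ℂ × ℂ → ℂ} (hf : DifferentiableOn ℂ f bidisk)
    (hθ : DifferentiableOn ℂ θ bidisk) {D : Set ℂ} (hD : Metric.ball 0 1 ⊆ closure D)
    (hdiv : ∀ l ∈ D, ‖l‖ < 1 → ∃ h : ℂ → ℂ, DifferentiableOn ℂ h (Metric.ball 0 1) ∧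
      ∀ w ∈ Metric.ball (0 : ℂ) 1, f (l, w) = θ (l, w) * h w)
    (hne : ∀ l : ℂ, ‖l‖ < 1 → ∃ w ∈ Metric.ball (0 : ℂ) 1, θ (l, w) ≠ 0) :
    ∃ h : ℂ × ℂ → ℂ, DifferentiableOn ℂ h bidisk ∧ ∀ x ∈ bidisk, f x = θ x * h x := by
  have hloc : ∀ y : ℂ × ℂ, ∃ (O : Set (ℂ × ℂ)) (H : ℂ × ℂ → ℂ), y ∈ bidisk →
      IsOpen O ∧ y ∈ O ∧ DifferentiableOn ℂ H O ∧ ∀ x ∈ O, f x = θ x * H x := by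
    intro y
    by_cases hy : y ∈ bidisk
    · obtain ⟨O, H, h⟩ := exists_local_quotient hf hθ hD hdiv hy (hne _ (mem_bidisk.1 hy).1)
      exact ⟨O, H, fun _ => h⟩
    · exact ⟨∅, 0, fun h => absurd h hy⟩
  choose O H hOH using hloc
  have hfreq : ∀ x ∈ bidisk, ∃ᶠ y in 𝓝 x, θ y ≠ 0 := by
    intro x hx
    obtain ⟨h1, h2⟩ := mem_bidisk.1 hx
    have h3 := (eventually_ne_zero_of_section (differentiableOn_section_snd hθ h1) (hne _ h1)
      (mem_ball_zero_iff.2 h2)).frequently.filter_mono nhdsWithin_le_nhds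
    have h4 : Tendsto (fun w => (x.1, w)) (𝓝 x.2) (𝓝 x) := by
      have : Continuous fun w : ℂ => (x.1, w) := by fun_prop
      exact this.tendsto x.2
    exact h4.frequently h3
  -- Each point uses its own local quotient. Two of them agree on their common domain, since near
  -- every point there are points where `θ` can be cancelled.
  refine ⟨fun x => H x x, fun x₀ hx₀ => ?_, fun x hx => (hOH x hx).2.2.2 x (hOH x hx).2.1⟩
  obtain ⟨hO₀, hm₀, hd₀, he₀⟩ := hOH x₀ hx₀
  refine ((hd₀.differentiableAt (hO₀.mem_nhds hm₀)).congr_of_eventuallyEq ?_).differentiableWithinAt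
  filter_upwards [hO₀.mem_nhds hm₀, isOpen_bidisk.mem_nhds hx₀] with x hxO hx
  obtain ⟨hO₁, hm₁, hd₁, he₁⟩ := hOH x hx
  by_contra hcon
  have hat : ContinuousAt (fun y => H x y - H x₀ y) x :=
    (hd₁.continuousOn.continuousAt (hO₁.mem_nhds hm₁)).sub
      (hd₀.continuousOn.continuousAt (hO₀.mem_nhds hxO))
  obtain ⟨y, hy, h1, h2, h3⟩ := ((hfreq x hx).and_eventually
    ((hat.eventually_ne (sub_ne_zero.2 hcon)).and
      ((hO₁.eventually_mem hm₁).and (hO₀.eventually_mem hxO)))).exists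
  exact h1 (sub_eq_zero.2 (mul_left_cancel₀ hy ((he₁ y h2).symm.trans (he₀ y h3))))

end Division

/-! ### Density of the Fredholm points -/

section FredholmPoints

open Polynomial

variable {θ : HardySpace} {p q : ℂ[X][X]}

theorem exists_eq_sub_mul_snd {a : ℂ} (ha : 1 < ‖a‖) (k : HardySpace) :
    ∃ g : HardySpace, ∀ x ∈ bidisk, k x = (x.2 - a) * g x := by
  have hne : ∀ x ∈ bidisk, x.2 - a ≠ 0 := fun x hx h0 => by
    have := (mem_bidisk.1 hx).2
    rw [sub_eq_zero.1 h0] at this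
    linarith
  have hd : DifferentiableOn ℂ (fun x : ℂ × ℂ => (x.2 - a)⁻¹) bidisk :=
    DifferentiableOn.inv (by fun_prop) hne
  have hpos : 0 < ‖a‖ - 1 := by linarith
  obtain ⟨g, hg, -⟩ := HardySpace.exists_mul hd (C := (‖a‖ - 1)⁻¹) (by positivity)
    (fun r hr t => by
      have hw := (mem_bidisk.1 (torusPoint_mem hr hr t)).2
      rw [norm_inv]
      gcongr
      have := norm_sub_norm_le a (torusPoint r r t).2
      rw [norm_sub_rev] at this
      linarith) k
  exact ⟨g, fun x hx => by rw [hg x hx, mul_inv_cancel_left₀ (hne x hx)]⟩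

/-- Division by a polynomial without zeros on the unit circle, with remainder in a space of finite
dimension. -/
theorem exists_finite_remainder {l : ℂ} (hl : ‖l‖ < 1) (n : ℕ) :
    ∀ s : ℂ[X], s.natDegree = n → s ≠ 0 → (∀ w : ℂ, ‖w‖ = 1 → s.eval w ≠ 0) →
      ∃ F : Submodule ℂ HardySpace, FiniteDimensional ℂ F ∧ ∀ f : HardySpace, ∃ φ ∈ F,
        ∃ k : HardySpace, ∀ w ∈ Metric.ball (0 : ℂ) 1,
          f (l, w) - φ (l, w) = s.eval w * k (l, w) := by
  induction n with
  | zero =>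
    intro s hs hs0 _
    obtain ⟨c, rfl⟩ := natDegree_eq_zero.1 hs
    have hc : c ≠ 0 := by rintro rfl; simp at hs0
    refine ⟨⊥, inferInstance, fun f => ⟨0, zero_mem _, c⁻¹ • f, fun w _ => ?_⟩⟩
    rw [HardySpace.zero_apply, HardySpace.smul_apply, eval_C, mul_inv_cancel_left₀ hc, sub_zero]
  | succ n ih =>
    intro s hs hs0 hcirc
    obtain ⟨a, ha⟩ := IsAlgClosed.exists_root s (by
      rw [degree_eq_natDegree hs0, hs]; exact_mod_cast n.succ_ne_zero)
    obtain ⟨s₁, rfl⟩ := dvd_iff_isRoot.2 ha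
    have hs₁ : s₁ ≠ 0 := right_ne_zero_of_mul hs0
    rw [natDegree_mul (X_sub_C_ne_zero _) hs₁, natDegree_X_sub_C] at hs
    obtain ⟨F, hF, hdiv⟩ := ih s₁ (by omega) hs₁ fun w hw h0 => hcirc w hw (by rw [eval_mul, h0,
      mul_zero])
    -- A root inside the disk adds one dimension of remainders, spanned by the remaining factor; a
    -- root outside adds none, because `w - a` is then an invertible multiplier.
    rcases lt_trichotomy ‖a‖ 1 with ha1 | ha1 | ha1
    · refine ⟨F ⊔ ℂ ∙ (aeval HardySpace.shiftW s₁ HardySpace.one), inferInstance, fun f => ?_⟩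
      obtain ⟨φ, hφ, k, hk⟩ := hdiv f
      obtain ⟨g, hg⟩ := HardySpace.exists_sub_eq_mul_snd k ha1
      refine ⟨φ + k (l, a) • aeval HardySpace.shiftW s₁ HardySpace.one,
        Submodule.add_mem_sup hφ (Submodule.smul_mem _ _ (Submodule.mem_span_singleton_self _)),
        g, fun w hw => ?_⟩
      have hx := mk_mem_bidisk hl (mem_ball_zero_iff.1 hw)
      have e1 := hk w hw
      have e2 := hg _ hx
      rw [HardySpace.add_apply, HardySpace.smul_apply, aeval_shiftW_one_apply _ hx]
      simp only [eval_mul, eval_sub, eval_X, eval_C] at e2 ⊢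
      linear_combination e1 + s₁.eval w * e2
    · exact absurd ha (hcirc a ha1)
    · refine ⟨F, hF, fun f => ?_⟩
      obtain ⟨φ, hφ, k, hk⟩ := hdiv f
      obtain ⟨g, hg⟩ := exists_eq_sub_mul_snd ha1 k
      refine ⟨φ, hφ, g, fun w hw => ?_⟩
      have e2 := hg _ (mk_mem_bidisk hl (mem_ball_zero_iff.1 hw))
      rw [hk w hw, e2]
      simp only [eval_mul, eval_sub, eval_X, eval_C]
      ring

/-- `S_z - l` is Fredholm if the numerator of `θ` has no zeros on `{l} × 𝕋`. -/
theorem IsInnerQuotient.isFredholm_shiftSub (h : IsInnerQuotient θ p q) {l : ℂ} (hl : ‖l‖ < 1)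
    (hne : ∃ w ∈ Metric.ball (0 : ℂ) 1, θ (l, w) ≠ 0)
    (hq : ∀ w : ℂ, ‖w‖ = 1 → q.evalEval l w ≠ 0) : (shiftSub θ l).IsFredholm := by
  refine isFredholm_of_ker_eq_bot (h.ker_shiftSub_eq_bot hl hne) ?_
  have hs : ∀ w, (q.map (evalRingHom l)).eval w = q.evalEval l w := fun w => map_evalRingHom_eval l w q
  have hp : ∀ w, (p.map (evalRingHom l)).eval w = p.evalEval l w := fun w => map_evalRingHom_eval l w p
  obtain ⟨F, hF, hdiv⟩ := exists_finite_remainder hl _ (q.map (evalRingHom l)) rfl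
    (fun h0 => hq 1 norm_one (by rw [← hs, h0, eval_zero])) fun w hw => by rw [hs]; exact hq w hw
  -- On `z = l`, `q k = θ (p k)`, so multiples of `q(l, ·)` vanish in the cokernel and the
  -- finite-dimensional space of remainders fills it.
  have hsurj : Function.Surjective ((cokerMap θ l).toLinearMap ∘ₗ F.subtype) := by
    intro y
    obtain ⟨f, rfl⟩ := cokerMap_surjective θ l y
    obtain ⟨φ, hφ, k, hk⟩ := hdiv f
    refine ⟨⟨φ, hφ⟩, Eq.symm (sub_eq_zero.1 ?_)⟩
    change cokerMap θ l f - cokerMap θ l φ = 0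
    rw [← map_sub, h.cokerMap_eq_zero_iff hl]
    refine ⟨aeval HardySpace.shiftW (p.map (evalRingHom l)) k, fun w hw => ?_⟩
    have hx := mk_mem_bidisk hl (mem_ball_zero_iff.1 hw)
    have e := h.mul_eq _ hx
    rw [HardySpace.sub_apply, hk w hw, HardySpace.aeval_shiftW_apply _ _ hx, hs, hp]
    simp only at e
    rw [← e, mul_assoc]
  exact Module.Finite.of_surjective _ hsurj

/-- The points where `S_z - l` is Fredholm are dense in the unit disk. -/
theorem IsInnerQuotient.dense_isFredholm (h : IsInnerQuotient θ p q)
    (hne : ∀ l : ℂ, ‖l‖ < 1 → ∃ w ∈ Metric.ball (0 : ℂ) 1, θ (l, w) ≠ 0) :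
    Metric.ball 0 1 ⊆ closure {l : ℂ | (shiftSub θ l).IsFredholm} := by
  intro l hl
  rw [mem_closure_iff]
  intro U hU hlU
  obtain ⟨s, ⟨hsU, hs⟩, hsq⟩ := exists_forall_evalEval_ne_zero h.eval_ne_zero
    (hU.inter Metric.isOpen_ball) ⟨l, hlU, hl⟩
  rw [mem_ball_zero_iff] at hs
  exact ⟨s, hsU, h.isFredholm_shiftSub hs (hne s hs) hsq⟩

end FredholmPoints

/-! ### Evaluation at the origin and conjugation of components -/

theorem HardySpace.apply_zero (f : HardySpace) : f (0, 0) = inner ℂ HardySpace.one f := by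
  have h0 : ((0 : ℂ), (0 : ℂ)) ∈ bidisk := mk_mem_bidisk (by simp) (by simp)
  rw [HardySpace.one, HardySpace.inner_monomialBasis, HardySpace.apply_eq_tsum f h0,
    tsum_eq_single 0]
  · simp
  · rintro ⟨m, n⟩ hmn
    rcases Nat.eq_zero_or_pos m with rfl | hm
    · have hn : n ≠ 0 := by rintro rfl; exact hmn rfl
      simp [hn]
    · simp [hm.ne']

theorem HardySpace.norm_one_eq : ‖HardySpace.one‖ = 1 :=
  HardySpace.monomialBasis.orthonormal.1 0

theorem HardySpace.norm_apply_zero_le (f : HardySpace) : ‖f (0, 0)‖ ≤ ‖f‖ := by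
  rw [HardySpace.apply_zero]
  simpa [HardySpace.norm_one_eq] using norm_inner_le_norm (𝕜 := ℂ) HardySpace.one f

/-- A contraction in `H²(𝔻²)` that is unimodular at the origin is constant. -/
theorem HardySpace.eq_smul_one {f : HardySpace} (hf : ‖f‖ ≤ 1) (h0 : 1 ≤ ‖f (0, 0)‖) :
    f = f (0, 0) • HardySpace.one := by
  set c := f (0, 0) with hc
  have hort : inner ℂ (c • HardySpace.one) (f - c • HardySpace.one) = 0 := by
    rw [inner_smul_left, inner_sub_right, inner_smul_right, inner_self_eq_norm_sq_to_K,
      HardySpace.norm_one_eq, ← HardySpace.apply_zero, ← hc]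
    simp
  have hpyth := norm_add_sq_eq_norm_sq_add_norm_sq_of_inner_eq_zero (𝕜 := ℂ) _ _ hort
  rw [add_sub_cancel, norm_smul, HardySpace.norm_one_eq] at hpyth
  rw [← sub_eq_zero, ← norm_eq_zero]
  nlinarith [norm_nonneg f, norm_nonneg (f - c • HardySpace.one)]

open Polynomial in
-- If `1 = θ g`, division by `θ` gives `‖g‖ ≤ 1`, hence `|g(0)| ≤ 1` and `|θ(0)| ≥ 1`. As `‖θ‖ ≤ 1`,
-- equality holds in Cauchy–Schwarz against the function `1`.
theorem IsInnerQuotient.isConst_of_one_mem_multiples {θ : HardySpace} {p q : ℂ[X][X]}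
    (h : IsInnerQuotient θ p q) (h1 : HardySpace.one ∈ multiples θ) : IsConst θ := by
  obtain ⟨g, hg⟩ := h1
  obtain ⟨k, hk, hkn⟩ := h.exists_div HardySpace.one g.differentiableOn hg
  have h0 : ((0 : ℂ), (0 : ℂ)) ∈ bidisk := mk_mem_bidisk (by simp) (by simp)
  have e := hg _ h0
  rw [HardySpace.one_apply h0, ← hk _ h0] at e
  have e' : 1 = ‖θ (0, 0)‖ * ‖k (0, 0)‖ := by rw [← norm_mul, ← e, norm_one]
  have hk0 : ‖k (0, 0)‖ ≤ 1 :=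
    k.norm_apply_zero_le.trans (hkn.trans HardySpace.norm_one_eq.le)
  have hθ := HardySpace.eq_smul_one h.norm_le (by nlinarith [norm_nonneg (θ (0, 0))])
  refine ⟨θ (0, 0), fun x hx => ?_⟩
  conv_lhs => rw [hθ]
  rw [HardySpace.smul_apply, HardySpace.one_apply hx, mul_one]

theorem conjSet_connectedComponentIn {Ω : Set ℂ} {x : ℂ} (hx : x ∈ Ω) :
    conjSet (connectedComponentIn Ω x) = connectedComponentIn (conjSet Ω) (conj x) :=
  Complex.conjCLE.toHomeomorph.image_connectedComponentIn hx

theorem EnumeratesComponents.conjSet {ι : Type*} {Ω : Set ℂ} {Ωc : ι → Set ℂ}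
    (h : EnumeratesComponents Ω Ωc) :
    EnumeratesComponents (conjSet Ω) fun i => HardyBidisk.conjSet (Ωc i) := by
  refine ⟨(Set.image_injective.2 (starRingEnd ℂ).injective).comp h.1, ?_⟩
  have hr : range (fun i => HardyBidisk.conjSet (Ωc i)) = HardyBidisk.conjSet '' range Ωc :=
    range_comp _ _
  rw [hr, h.2]
  ext C
  constructor
  · rintro ⟨_, ⟨x, hx, rfl⟩, rfl⟩
    exact ⟨conj x, mem_image_of_mem _ hx, conjSet_connectedComponentIn hx⟩
  · rintro ⟨_, ⟨x, hx, rfl⟩, rfl⟩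
    exact ⟨_, ⟨x, hx, rfl⟩, conjSet_connectedComponentIn hx⟩

theorem EnumeratesComponents.exists_eq {ι : Type*} {Ω : Set ℂ} {Ωc : ι → Set ℂ}
    (h : EnumeratesComponents Ω Ωc) (i : ι) : ∃ x ∈ Ω, Ωc i = connectedComponentIn Ω x := by
  have : Ωc i ∈ {C | ∃ x ∈ Ω, C = connectedComponentIn Ω x} := h.2 ▸ mem_range_self i
  exact this

/-! ### The set `σ(S_z) \ σ_e(S_z)` and the defect -/

section FredholmDomain

open Polynomial ContinuousLinearMap

variable {θ : HardySpace} {p q : ℂ[X][X]}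

/-- The set `σ(S_z) \ σ_e(S_z)`. -/
abbrev fredholmDomain (θ : HardySpace) : Set ℂ :=
  spectrum ℂ (compressedShift θ) \ essentialSpectrum (compressedShift θ)

/-- The codimension of the range of `S_z - l`. -/
abbrev defect (θ : HardySpace) (l : ℂ) : ℕ :=
  Module.finrank ℂ (quotientModule θ ⧸ (shiftSub θ l).range)

theorem norm_lt_one {l : ℂ} (hl : l ∈ fredholmDomain θ) : ‖l‖ < 1 :=
  norm_lt_one_of_mem hl.1 hl.2

theorem isFredholm_of_mem {l : ℂ} (hl : l ∈ fredholmDomain θ) : (shiftSub θ l).IsFredholm :=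
  not_not.1 hl.2

theorem defect_pos {l : ℂ} (hl : l ∈ fredholmDomain θ) (hk : (shiftSub θ l).ker = ⊥) :
    0 < defect θ l := by
  have := (isFredholm_of_mem hl).finite_coker
  have hr : (shiftSub θ l).range ≠ ⊤ := fun h => mem_spectrum_iff.1 hl.1 ⟨hk, h⟩
  have := Submodule.Quotient.nontrivial_iff.2 hr
  exact Module.finrank_pos

/-- The defect is stable near `l` and positive at `l`, so nearby operators are not onto and nearby
points remain in the spectrum. -/
theorem eventually_mem_fredholmDomain {l : ℂ} (hl : l ∈ fredholmDomain θ)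
    (hk : (shiftSub θ l).ker = ⊥) :
    ∀ᶠ m in 𝓝 l, m ∈ fredholmDomain θ ∧ defect θ m = defect θ l := by
  filter_upwards [eventually_isFredholm hk (isFredholm_of_mem hl)] with m hm
  refine ⟨⟨mem_spectrum_iff.2 fun h => ?_, not_not.2 hm.1⟩, hm.2⟩
  have h1 := defect_pos hl hk
  have := Submodule.Quotient.subsingleton_iff.2 h.2
  rw [defect, ← hm.2, Module.finrank_zero_of_subsingleton] at h1
  exact h1.false

theorem defect_eq_of_mem_component (hk : ∀ l ∈ fredholmDomain θ, (shiftSub θ l).ker = ⊥)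
    {x l m : ℂ} (hl : l ∈ connectedComponentIn (fredholmDomain θ) x)
    (hm : m ∈ connectedComponentIn (fredholmDomain θ) x) : defect θ l = defect θ m := by
  refine isPreconnected_connectedComponentIn.constant (f := defect θ) (fun y hy => ?_) hl hm
  have hy' := connectedComponentIn_subset _ _ hy
  refine ContinuousAt.continuousWithinAt ?_
  refine (continuousAt_const (y := defect θ y)).congr ?_
  filter_upwards [eventually_mem_fredholmDomain hy' (hk y hy')] with m hm
  exact hm.2.symm

/-- An element of `K_θ` in all ranges `Ran (S_z - l)`, `l ∈ σ(S_z) \ σ_e(S_z)`, is zero. -/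
theorem IsInnerQuotient.eq_zero_of_forall_mem_range (h : IsInnerQuotient θ p q)
    (hne : ∀ l : ℂ, ‖l‖ < 1 → ∃ w ∈ Metric.ball (0 : ℂ) 1, θ (l, w) ≠ 0)
    {k : quotientModule θ} (hk : ∀ l ∈ fredholmDomain θ, k ∈ (shiftSub θ l).range) : k = 0 := by
  have hdiv : ∀ l ∈ {l : ℂ | (shiftSub θ l).IsFredholm}, ‖l‖ < 1 → ∃ g : ℂ → ℂ,
      DifferentiableOn ℂ g (Metric.ball 0 1) ∧
        ∀ w ∈ Metric.ball (0 : ℂ) 1, (k : HardySpace) (l, w) = θ (l, w) * g w := by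
    intro l hF hl
    -- Fredholm points outside the spectrum are harmless, since the range is everything there; so
    -- divisibility holds on the whole dense set of Fredholm points.
    have hmem : k ∈ (shiftSub θ l).range := by
      by_cases hs : l ∈ spectrum ℂ (compressedShift θ)
      · exact hk l ⟨hs, not_not.2 hF⟩
      · rw [mem_spectrum_iff, not_not] at hs
        rw [hs.2]
        trivial
    rw [← Submodule.orthogonalProjectionOnto_mem_subspace_eq_self (K := quotientModule θ) k,
      h.projK_mem_range_iff hl] at hmem
    obtain ⟨g, hg⟩ := hmem
    exact ⟨_, differentiableOn_section_snd g.differentiableOn hl, hg⟩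
  obtain ⟨g, hg, hkg⟩ := exists_quotient (k : HardySpace).differentiableOn θ.differentiableOn
    (h.dense_isFredholm hne) hdiv hne
  obtain ⟨g', hg', -⟩ := h.exists_div k hg hkg
  exact eq_zero_of_mem_multiples k ⟨g', fun x hx => by rw [hg' x hx]; exact hkg x hx⟩

end FredholmDomain

end HardyBidisk

end

/-! ### The adjoint of `S_z` in the Cowen–Douglas class -/

theorem theorem4p7 (θ : HardySpace) (hinner : IsInner θ) (hrat : IsRational θ)
    (hconst : ¬ IsConst θ) (hz : ¬ HasInnerFactorInZ θ)
    (Ω : Set ℂ) (hΩ : Ω = spectrum ℂ (compressedShift θ) \ essentialSpectrum (compressedShift θ))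
    {ι : Type*} (Ωc : ι → Set ℂ) (hΩc : EnumeratesComponents Ω Ωc) :
    ∃ α : ι → ℕ,
      (∀ i, ∀ l ∈ Ωc i, HasZeroCount (fun w => θ (l, w)) (α i)) ∧
      GeneralizedCowenDouglas (conjSet Ω) (fun i => conjSet (Ωc i)) α
        (ContinuousLinearMap.adjoint (compressedShift θ)) := by
  obtain ⟨p, q, h⟩ := exists_isInnerQuotient hinner hrat
  have hne : ∀ l : ℂ, ‖l‖ < 1 → ∃ w ∈ Metric.ball (0 : ℂ) 1, θ (l, w) ≠ 0 := fun l hl =>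
    exists_section_ne_zero hinner hz hl
  change Ω = fredholmDomain θ at hΩ
  subst hΩ
  have hker : ∀ l ∈ fredholmDomain θ, (shiftSub θ l).ker = ⊥ := fun l hl =>
    h.ker_shiftSub_eq_bot (norm_lt_one hl) (hne l (norm_lt_one hl))
  have hadj : ∀ l : ℂ, ContinuousLinearMap.adjoint (compressedShift θ) -
      (starRingEnd ℂ l) • ContinuousLinearMap.id ℂ (quotientModule θ) =
        ContinuousLinearMap.adjoint (shiftSub θ l) := fun l =>
    (adjoint_sub_smul_id _ l).symm
  choose x hx hxc using hΩc.exists_eq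
  have hsub : ∀ i, Ωc i ⊆ fredholmDomain θ := fun i => by
    rw [hxc]; exact connectedComponentIn_subset _ _
  have hα : ∀ i, ∀ l ∈ Ωc i, defect θ l = defect θ (x i) := fun i l hl => by
    rw [hxc] at hl
    exact defect_eq_of_mem_component hker hl (mem_connectedComponentIn (hx i))
  refine ⟨fun i => defect θ (x i), fun i l hl => ?_, ?_⟩
  · change HasZeroCount _ (defect θ (x i))
    rw [← hα i l hl]
    exact h.hasZeroCount (norm_lt_one (hsub i hl)) (isFredholm_of_mem (hsub i hl))
  refine
    { complete := inferInstance
      separable := inferInstance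
      isOpen := ?_
      isBounded := ?_
      nonempty := ?_
      components := hΩc.conjSet
      index_pos := fun i => defect_pos (hx i) (hker _ (hx i))
      range_eq := ?_
      span_ker := ?_
      rank_ker := ?_ }
  · have ho : IsOpen (fredholmDomain θ) := isOpen_iff_mem_nhds.2 fun l hl =>
      (eventually_mem_fredholmDomain hl (hker l hl)).mono fun m hm => hm.1
    exact Complex.conjCLE.toHomeomorph.isOpenMap _ ho
  · refine Metric.isBounded_ball (x := (0 : ℂ)) (r := 1) |>.subset ?_
    rintro _ ⟨l, hl, rfl⟩
    rw [mem_ball_zero_iff, RCLike.norm_conj]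
    exact norm_lt_one hl
  · refine Set.Nonempty.image _ (Set.nonempty_iff_ne_empty.2 fun hempty => hconst ?_)
    refine h.isConst_of_one_mem_multiples (h.projK_eq_zero_iff.1 ?_)
    -- With `Ω` empty the range condition is vacuous, so the projection of `1` vanishes.
    exact h.eq_zero_of_forall_mem_range hne fun l hl => by rw [hempty] at hl; exact hl.elim
  · rintro _ ⟨l, hl, rfl⟩
    rw [hadj]
    exact range_adjoint_eq_top (hker l hl) (isFredholm_of_mem hl)
  · rw [Submodule.topologicalClosure_eq_top_iff, Submodule.eq_bot_iff]
    intro k hk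
    refine h.eq_zero_of_forall_mem_range hne fun l hl => ?_
    have hcl : IsClosed ((shiftSub θ l).range : Set (quotientModule θ)) :=
      (isFredholm_of_mem hl).isClosed_range
    have hle : (ContinuousLinearMap.adjoint (shiftSub θ l)).ker ≤
        ⨆ m ∈ conjSet (fredholmDomain θ), (ContinuousLinearMap.adjoint (compressedShift θ) -
          m • ContinuousLinearMap.id ℂ (quotientModule θ)).ker := by
      rw [← hadj]
      exact le_iSup₂_of_le (starRingEnd ℂ l) (Set.mem_image_of_mem _ hl) le_rfl
    -- Orthogonality to the kernel of the adjoint places `k` in the closure of `Ran (S_z - l)`,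
    -- which is closed.
    have hk' := Submodule.orthogonal_le hle hk
    rw [← ContinuousLinearMap.orthogonal_range, Submodule.orthogonal_orthogonal_eq_closure,
      hcl.submodule_topologicalClosure_eq] at hk'
    exact hk'
  · rintro i _ ⟨l, hl, rfl⟩
    rw [hadj, rank_ker_adjoint (isFredholm_of_mem (hsub i hl))]
    exact congrArg Nat.cast (hα i l hl)
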